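/- Let $V$ be a $12$-dimensional complex vector space with a non-degenerate quadratic form $q$, let $\mathrm{G}=\mathrm{Spin}_{12}=\mathrm{Spin}(V)$, and let $X=OG_+(6,V)=\mathrm{G}/\mathrm{P}_6$ be one of the two components of the variety of maximal isotropic subspaces of $V$. Let $\mathcal{U}\subset V\otimes\mathcal{O}$ be the tautological subbundle, let $S^{+}$ and $S^-$ be the half-spin representations, labelled so that the line of pure spinors of a subspace $[U]\in X$ lies in $S^+$; these lines form the line bundle $\mathcal{O}(-1)\subset S^+\otimes\mathcal{O}$. Let $\mathcal{U}_{\omega_1+\omega_2}=\Sigma^{2,1}\mathcal{U}^\vee=\ker(\mathcal{U}^\vee\otimes\wedge^2\mathcal{U}^\vee\to\wedge^3\mathcal{U}^\vee)$ be the irreducible homogeneous bundle of highest weight $\omega_1+\omega_2$, and let $T$ be the cokernel of the $\mathrm{G}$-equivariant inclusion $\mathcal{U}^\vee\to V\otimes\wedge^2\mathcal{U}^\vee$, $f\mapsto\sum_k u_k\otimes(u_k^\vee\wedge f)$ ($u_1,\dots,u_6$ a basis of the fibre $U$ of $\mathcal{U}$ and $u_k^\vee$ the dual basis). Let $i:\mathcal{U}^\vee(-1)\to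 S^-\otimes\mathcal{O}$ be the inclusion given, on the fibre at $[U]$ and under $\mathcal{U}^\vee\simeq (V\otimes\mathcal{O})/\mathcal{U}$, by Clifford multiplication $v\otimes s\mapsto v\cdot s$ on pure spinors $s$ of $U$. Let $\wedge^3\eta:S^-\otimes S^+\to\wedge^3V$ be the $\mathrm{G}$-equivariant map which is the transpose of the antisymmetrized Clifford multiplication $\wedge^3V\otimes S^-\to S^+$, under the identifications $(\wedge^3V)^\vee\simeq\wedge^3V$ induced by $q$ and $(S^+)^\vee\simeq S^+$ given by a non-degenerate $\mathrm{G}$-invariant form. Then there exist a $\mathrm{G}$-equivariant vector bundle $R_6$ on $X$ whose semisimple reduction (the direct sum of the irreducible quotients of a filtration by $\mathrm{G}$-equivariant subbundles) is $$\mathrm{ss}(R_6)=\mathcal{U}^\vee(-2)\oplus\mathcal{U}_{\omega_1+\omega_2}(-2)$$ and an exact complex of $\mathrm{G}$-equivariant vector bundles and $\mathrm{G}$-equivariant morphisms $$0\to R_6\to\mathcal{U}^\vee(-1)\otimes S^+\to\wedge^3V\otimes\mathcal{O}\to T\to\mathcal{U}_{\omega_1+\omega_2}\to0,$$ in which the second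 map $\mathcal{U}^\vee(-1)\otimes S^+\to\wedge^3V\otimes\mathcal{O}$ is $\wedge^3\eta\circ(i\otimes\mathrm{id})$. -/

import Mathlib

open scoped TensorProduct

noncomputable section

namespace Spin12

/-! ### The quadratic space, its Clifford algebra and the spin group -/

/-- The model `ℂ⁶` of a maximal isotropic subspace. -/
abbrev M : Type := Fin 6 → ℂ

/-- The 12-dimensional space `V = M^∨ ⊕ M`. -/
abbrev V : Type := Module.Dual ℂ M × M

/-- The non-degenerate quadratic form `q(f, u) = f(u)` on `V`. -/
abbrev q : QuadraticForm ℂ V := QuadraticForm.dualProd ℂ M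

/-- The Clifford algebra of `(V, q)`, with the relations `v · v = q(v)`. -/
abbrev Cl : Type := CliffordAlgebra q

/-- The complex spin group `Spin₁₂`. -/
abbrev G : Type := ↥(spinGroup q)

/-- The vector component of an element of the Clifford algebra. -/
def vectorPart : Cl →ₗ[ℂ] V :=
  letI : Invertible (2 : ℂ) := invertibleOfNonzero two_ne_zero
  ExteriorAlgebra.ιInv ∘ₗ (CliffordAlgebra.equivExterior q).toLinearMap

theorem vectorPart_ι (v : V) : vectorPart (CliffordAlgebra.ι q v) = v := by
  simp only [vectorPart, LinearMap.comp_apply, LinearEquiv.coe_coe]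
  let _ : Invertible (2 : ℂ) := invertibleOfNonzero two_ne_zero
  have h : CliffordAlgebra.equivExterior q (CliffordAlgebra.ι q v) = ExteriorAlgebra.ι ℂ v :=
    CliffordAlgebra.changeForm_ι CliffordAlgebra.changeForm.associated_neg_proof v
  rw [h]
  exact ExteriorAlgebra.ι_leftInverse v

theorem ι_vectorPart_conj (g : G) (v : V) :
    CliffordAlgebra.ι q (vectorPart ((g : Cl) * CliffordAlgebra.ι q v * ((g⁻¹ : G) : Cl))) =
      (g : Cl) * CliffordAlgebra.ι q v * ((g⁻¹ : G) : Cl) := by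
  let _ : Invertible (2 : ℂ) := invertibleOfNonzero two_ne_zero
  obtain ⟨w, hw⟩ := spinGroup.conjAct_smul_ι_mem_range_ι (x := spinGroup.toUnits g) g.2 v
  have h : ConjAct.toConjAct (spinGroup.toUnits g) • CliffordAlgebra.ι q v =
      (g : Cl) * CliffordAlgebra.ι q v * ((g⁻¹ : G) : Cl) := rfl
  rw [← h, ← hw, vectorPart_ι]

/-- The vector representation `v ↦ g v g⁻¹` of the spin group on `V`. -/
def vectorRep : G →* Module.End ℂ V where
  toFun g := vectorPart ∘ₗ LinearMap.mulRight ℂ ((g⁻¹ : G) : Cl) ∘ₗ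
    LinearMap.mulLeft ℂ (g : Cl) ∘ₗ CliffordAlgebra.ι q
  map_one' := by
    ext1 <;> ext <;> simp [vectorPart_ι]
  map_mul' g h := by
    refine LinearMap.ext fun v => ?_
    simp only [LinearMap.comp_apply, LinearMap.mulLeft_apply, LinearMap.mulRight_apply,
      Module.End.mul_apply]
    rw [ι_vectorPart_conj h v]
    simp [mul_assoc]

theorem ι_vectorRep (g : G) (v : V) :
    CliffordAlgebra.ι q (vectorRep g v) =
      (g : Cl) * CliffordAlgebra.ι q v * ((g⁻¹ : G) : Cl) :=
  ι_vectorPart_conj g v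

/-! ### Spinors -/

/-- The space of spinors `S = ⋀ M^∨`. -/
abbrev S : Type := ExteriorAlgebra ℂ (Module.Dual ℂ M)

/-- Clifford multiplication `V → End S`: a vector `(f, u)` acts by exterior multiplication with
`f` plus contraction with `u`. -/
def cliffordMul : V →ₗ[ℂ] Module.End ℂ S :=
  (LinearMap.mul ℂ S ∘ₗ ExteriorAlgebra.ι ℂ) ∘ₗ LinearMap.fst ℂ _ _ +
    (CliffordAlgebra.contractLeft (Q := (0 : QuadraticForm ℂ (Module.Dual ℂ M))) ∘ₗ
      Module.Dual.eval ℂ M) ∘ₗ LinearMap.snd ℂ _ _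

theorem cliffordMul_apply (v : V) (s : S) :
    cliffordMul v s = ExteriorAlgebra.ι ℂ v.1 * s +
      CliffordAlgebra.contractLeft (Q := (0 : QuadraticForm ℂ (Module.Dual ℂ M)))
        (Module.Dual.eval ℂ M v.2) s := rfl

theorem cliffordMul_sq (v : V) :
    cliffordMul v * cliffordMul v = algebraMap ℂ (Module.End ℂ S) (q v) := by
  refine LinearMap.ext fun s => ?_
  have h1 : ExteriorAlgebra.ι ℂ v.1 * (ExteriorAlgebra.ι ℂ v.1 * s) = 0 := by
    rw [← mul_assoc, ExteriorAlgebra.ι_sq_zero, zero_mul]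
  have h2 := CliffordAlgebra.contractLeft_ι_mul
    (Q := (0 : QuadraticForm ℂ (Module.Dual ℂ M))) (Module.Dual.eval ℂ M v.2) v.1 s
  have h3 := CliffordAlgebra.contractLeft_contractLeft
    (Q := (0 : QuadraticForm ℂ (Module.Dual ℂ M))) (Module.Dual.eval ℂ M v.2) s
  rw [Module.End.mul_apply, cliffordMul_apply, cliffordMul_apply, mul_add, map_add, h1, h3,
    Module.algebraMap_end_apply]
  change 0 + _ + (CliffordAlgebra.contractLeft _ (CliffordAlgebra.ι _ _ * _) + 0) = _
  rw [h2]
  change 0 + CliffordAlgebra.ι _ _ * _ + _ = _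
  simp

/-- The spinor module: the action of the Clifford algebra on `S`. -/
def spinAction : Cl →ₐ[ℂ] Module.End ℂ S :=
  CliffordAlgebra.lift q ⟨cliffordMul, cliffordMul_sq⟩

theorem spinAction_ι (v : V) : spinAction (CliffordAlgebra.ι q v) = cliffordMul v :=
  CliffordAlgebra.lift_ι_apply _ _ _

/-- The spin representation of `G` on `S = S⁺ ⊕ S⁻`. -/
def spinRep : G →* Module.End ℂ S :=
  (spinAction : Cl →* Module.End ℂ S).comp (spinGroup q).subtype

/-- The half-spin spaces: `half 0 = S⁺` is the even part and `half 1 = S⁻` the odd part of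
`S = ⋀ M^∨`. -/
def half (i : ZMod 2) : Submodule ℂ S :=
  CliffordAlgebra.evenOdd (0 : QuadraticForm ℂ (Module.Dual ℂ M)) i

theorem contractLeft_mem_half (d : Module.Dual ℂ (Module.Dual ℂ M)) (i : ZMod 2) {s : S}
    (hs : s ∈ half i) :
    CliffordAlgebra.contractLeft (Q := (0 : QuadraticForm ℂ (Module.Dual ℂ M))) d s
      ∈ half (i + 1) := by
  induction s, hs using CliffordAlgebra.evenOdd_induction with
  | range_ι_pow x hx =>
    have hi : i = 0 ∨ i = 1 :=
      (show ∀ k : ZMod 2, k = 0 ∨ k = 1 by decide) i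
    rcases hi with rfl | rfl
    · obtain ⟨r, rfl⟩ := Submodule.mem_one.1 (by simpa using hx)
      simp
    · have hx' : x ∈ LinearMap.range
          (CliffordAlgebra.ι (0 : QuadraticForm ℂ (Module.Dual ℂ M))) := by
        rw [show (1 : ZMod 2).val = 1 from rfl, pow_one] at hx
        exact hx
      obtain ⟨f, rfl⟩ := hx'
      rw [CliffordAlgebra.contractLeft_ι]
      exact CliffordAlgebra.one_le_evenOdd_zero _ (Submodule.algebraMap_mem _)
  | add x y hx hy ihx ihy => rw [map_add]; exact add_mem ihx ihy
  | ι_mul_ι_mul a b x hx ih =>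
    have hab := CliffordAlgebra.ι_mul_ι_mem_evenOdd_zero
      (0 : QuadraticForm ℂ (Module.Dual ℂ M)) a b
    have mul1 : ∀ (c : Module.Dual ℂ M) (k : ZMod 2)
        {y : CliffordAlgebra (0 : QuadraticForm ℂ (Module.Dual ℂ M))},
        y ∈ CliffordAlgebra.evenOdd _ k →
        CliffordAlgebra.ι _ c * y ∈ CliffordAlgebra.evenOdd _ (k + 1) := fun c k y hy => by
      rw [add_comm k 1]
      exact CliffordAlgebra.evenOdd_mul_le _ _ _
        (Submodule.mul_mem_mul (CliffordAlgebra.ι_mem_evenOdd_one _ _) hy)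
    rw [mul_assoc, CliffordAlgebra.contractLeft_ι_mul, CliffordAlgebra.contractLeft_ι_mul]
    refine sub_mem (Submodule.smul_mem _ _ (mul1 b i hx)) ?_
    rw [mul_sub]
    refine sub_mem ?_ ?_
    · rw [mul_smul_comm]
      exact Submodule.smul_mem _ _ (mul1 a i hx)
    · have h := mul1 a _ (mul1 b _ ih)
      rwa [(show ∀ k : ZMod 2, k + 1 + 1 + 1 = k + 1 by decide) i] at h

theorem cliffordMul_mem_half (v : V) (i : ZMod 2) {s : S} (hs : s ∈ half i) :
    cliffordMul v s ∈ half (i + 1) := by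
  rw [cliffordMul_apply]
  refine add_mem ?_ (contractLeft_mem_half _ _ hs)
  rw [add_comm i 1]
  exact CliffordAlgebra.evenOdd_mul_le _ _ _
    (Submodule.mul_mem_mul (CliffordAlgebra.ι_mem_evenOdd_one _ _) hs)

theorem spinAction_mem_half {x : Cl} (hx : x ∈ CliffordAlgebra.evenOdd q 0) (i : ZMod 2) {s : S}
    (hs : s ∈ half i) : spinAction x s ∈ half i := by
  induction x, hx using CliffordAlgebra.even_induction with
  | algebraMap r =>
    rw [AlgHom.commutes, Module.algebraMap_end_apply]
    exact Submodule.smul_mem _ _ hs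
  | add x y hx hy ihx ihy => rw [map_add]; exact add_mem ihx ihy
  | ι_mul_ι_mul a b x hx ih =>
    rw [map_mul, map_mul, spinAction_ι, spinAction_ι]
    have h := cliffordMul_mem_half a _ (cliffordMul_mem_half b _ ih)
    rwa [(show ∀ k : ZMod 2, k + 1 + 1 = k by decide) i] at h

/-- The half-spin representations of `G` on `S⁺` (`i = 0`) and `S⁻` (`i = 1`). -/
def halfSpinRep (i : ZMod 2) : G →* Module.End ℂ (half i) where
  toFun g := (spinRep g).restrict fun _ hs => spinAction_mem_half g.2.2 i hs
  map_one' := by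
    refine LinearMap.ext fun s => Subtype.ext ?_
    change spinRep 1 (s : S) = s
    rw [map_one, Module.End.one_apply]
  map_mul' g h := by
    refine LinearMap.ext fun s => Subtype.ext ?_
    change spinRep (g * h) (s : S) = spinRep g (spinRep h (s : S))
    rw [map_mul, Module.End.mul_apply]

/-! ### The variety `X = OG₊(6, V) = Spin₁₂ / P₆` -/

/-- The maximal isotropic subspace `0 ⊕ M` of `V`. -/
def baseSubspace : Submodule ℂ V := LinearMap.range (LinearMap.inr ℂ (Module.Dual ℂ M) M)

/-- The spinor variety `OG₊(6, V)`: the orbit under the spin group of the maximal isotropic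
subspace `0 ⊕ M`, i.e. the component containing `0 ⊕ M` of the variety of maximal isotropic
subspaces of `V`. -/
structure OGplus : Type where
  space : Submodule ℂ V
  mem_orbit : ∃ g : G, space = baseSubspace.map (vectorRep g)

theorem OGplus.ext_space {x y : OGplus} (h : x.space = y.space) : x = y := by
  cases x; cases y; cases h; rfl

instance : MulAction G OGplus where
  smul g x := ⟨x.space.map (vectorRep g), by
    obtain ⟨h, hh⟩ := x.mem_orbit
    refine ⟨g * h, ?_⟩
    rw [hh, map_mul, Module.End.mul_eq_comp, Submodule.map_comp]⟩
  one_smul x := OGplus.ext_space <| by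
    change x.space.map (vectorRep 1) = x.space
    rw [map_one, Module.End.one_eq_id, Submodule.map_id]
  mul_smul g h x := OGplus.ext_space <| by
    change x.space.map (vectorRep (g * h)) = (x.space.map (vectorRep h)).map (vectorRep g)
    rw [map_mul, Module.End.mul_eq_comp, Submodule.map_comp]

theorem space_smul (g : G) (x : OGplus) : (g • x).space = x.space.map (vectorRep g) := rfl

/-- The orbit map `G → X = G / P`, `g ↦ g (0 ⊕ M)`. -/
def orbitMap (g : G) : OGplus := ⟨baseSubspace.map (vectorRep g), g, rfl⟩

/-! ### Regular functions

`G` is a Zariski closed subset of the vector space `Cl`; the variety structure of `X = G / P` is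
that of a quotient: a set, resp. a function, on `X` is open, resp. regular, when its pullback to
`G` is. In the same way `G × X` is a quotient of `G × G`. -/

/-- Zariski open sets for an algebra `A` of functions on a set `Y`. -/
def IsOpenFor {Y : Type} (A : Subalgebra ℂ (Y → ℂ)) (W : Set Y) : Prop :=
  ∀ y ∈ W, ∃ a ∈ A, a y ≠ 0 ∧ ∀ z, a z ≠ 0 → z ∈ W

/-- A function on `W ⊆ Y` is regular when locally it is a quotient of elements of `A`. -/
def IsRegularFor {Y : Type} (A : Subalgebra ℂ (Y → ℂ)) (W : Set Y) (f : W → ℂ) : Prop :=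
  ∀ y : W, ∃ a ∈ A, ∃ b ∈ A, b y ≠ 0 ∧ ∀ z : W, b z ≠ 0 → f z = a z / b z

/-- The coordinate ring of `G`: restrictions to `G` of polynomial functions on `Cl`. -/
def coordRing : Subalgebra ℂ (G → ℂ) :=
  Algebra.adjoin ℂ {f | ∃ φ : Module.Dual ℂ Cl, f = fun g : G => φ (g : Cl)}

/-- The coordinate ring of `G × G`. -/
def coordRingProd : Subalgebra ℂ (G × G → ℂ) :=
  Algebra.adjoin ℂ {f | ∃ φ : Module.Dual ℂ Cl,
    (f = fun p : G × G => φ (p.1 : Cl)) ∨ (f = fun p : G × G => φ (p.2 : Cl))}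

/-- Zariski open subsets of `X`. -/
def IsOpenX (W : Set OGplus) : Prop := IsOpenFor coordRing (orbitMap ⁻¹' W)

/-- Regular functions on a subset `W` of `X` (used for `W` open). -/
def IsRegularX (W : Set OGplus) (f : W → ℂ) : Prop :=
  IsRegularFor coordRing (orbitMap ⁻¹' W) fun g => f ⟨orbitMap g.1, g.2⟩

/-- Regular functions on a subset `W` of `G × X` (used for `W` open). -/
def IsRegularGX (W : Set (G × OGplus)) (f : W → ℂ) : Prop :=
  IsRegularFor coordRingProd ((fun p : G × G => (p.1, orbitMap p.2)) ⁻¹' W)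
    fun p => f ⟨(p.1.1, orbitMap p.1.2), p.2⟩

/-! ### Equivariant vector bundles on `X` -/

/-- A family of complex vector spaces on `X` with a fibrewise linear action of `G` lifting the
action on `X`: for `g x = y` the element `g` acts by a linear map from the fibre at `x` to the
fibre at `y`. -/
structure EquivFamily where
  fib : OGplus → Type
  [addCommGroup : ∀ x, AddCommGroup (fib x)]
  [module : ∀ x, Module ℂ (fib x)]
  act : ∀ (g : G) {x y : OGplus}, g • x = y → (fib x →ₗ[ℂ] fib y)
  act_one : ∀ {x : OGplus} (h : (1 : G) • x = x) (v : fib x), act 1 h v = v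
  act_mul : ∀ (g g' : G) {x y z : OGplus} (h : g • x = y) (h' : g' • y = z)
    (h'' : (g' * g) • x = z) (v : fib x), act (g' * g) h'' v = act g' h' (act g h v)

attribute [instance] EquivFamily.addCommGroup EquivFamily.module

/-- A frame of rank `r` of a family over a Zariski open subset of `X`. -/
structure LocalFrame (E : EquivFamily) (r : ℕ) where
  dom : Set OGplus
  isOpen : IsOpenX dom
  basis : ∀ x : dom, Module.Basis (Fin r) ℂ (E.fib x)

/-- The structure of a `G`-equivariant algebraic vector bundle on an equivariant family: an atlas
of local frames (local trivializations) with regular transition functions, in which the action of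
`G` is regular. -/
structure BundleAtlas (E : EquivFamily) where
  rank : ℕ
  frames : Set (LocalFrame E rank)
  cover : ∀ x, ∃ e ∈ frames, x ∈ e.dom
  transition : ∀ e ∈ frames, ∀ e' ∈ frames, ∀ i j : Fin rank,
    IsRegularX (e.dom ∩ e'.dom) fun x =>
      (e'.basis ⟨x.1, x.2.2⟩).repr (e.basis ⟨x.1, x.2.1⟩ j) i
  action : ∀ e ∈ frames, ∀ e' ∈ frames, ∀ i j : Fin rank,
    IsRegularGX {p | p.2 ∈ e.dom ∧ p.1 • p.2 ∈ e'.dom} fun p =>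
      (e'.basis ⟨p.1.1 • p.1.2, p.2.2⟩).repr (E.act p.1.1 rfl (e.basis ⟨p.1.2, p.2.1⟩ j)) i

/-- The family is a `G`-equivariant algebraic vector bundle on `X`. -/
def EquivFamily.IsVectorBundle (E : EquivFamily) : Prop := Nonempty (BundleAtlas E)

/-- Morphisms of `G`-equivariant vector bundles: fibrewise linear maps which commute with the
action and are given by matrices of regular functions in local trivializations. -/
structure Hom (E F : EquivFamily) where
  app : ∀ x, E.fib x →ₗ[ℂ] F.fib x
  equivariant : ∀ (g : G) {x y : OGplus} (h : g • x = y) (v : E.fib x),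
    app y (E.act g h v) = F.act g h (app x v)
  regular : ∀ (a : BundleAtlas E) (b : BundleAtlas F), ∀ e ∈ a.frames, ∀ e' ∈ b.frames,
    ∀ (i : Fin b.rank) (j : Fin a.rank), IsRegularX (e.dom ∩ e'.dom) fun x =>
      (e'.basis ⟨x.1, x.2.2⟩).repr (app x.1 (e.basis ⟨x.1, x.2.1⟩ j)) i

namespace Hom

variable {E F H : EquivFamily}

/-- Injectivity on every fibre. -/
def Injective (φ : Hom E F) : Prop := ∀ x, Function.Injective (φ.app x)

/-- Surjectivity on every fibre. -/
def Surjective (φ : Hom E F) : Prop := ∀ x, Function.Surjective (φ.app x)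

/-- Exactness at the middle term, on every fibre. -/
def Exact (φ : Hom E F) (ψ : Hom F H) : Prop := ∀ x, Function.Exact (φ.app x) (ψ.app x)

/-- `0 → E → F → H → 0` is exact. -/
def ShortExact (φ : Hom E F) (ψ : Hom F H) : Prop :=
  φ.Injective ∧ φ.Exact ψ ∧ ψ.Surjective

end Hom

/-! ### Constructions of equivariant bundles -/

namespace EquivFamily

/-- The trivial bundle `W ⊗ 𝒪` of a representation `W` of `G`. -/
abbrev trivial {W : Type} [AddCommGroup W] [Module ℂ W] (ρ : G →* Module.End ℂ W) :
    EquivFamily where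
  fib _ := W
  act g _ _ _ := ρ g
  act_one _ v := by rw [map_one, Module.End.one_apply]
  act_mul g g' _ _ _ _ _ _ v := by rw [map_mul, Module.End.mul_apply]

/-- The subbundle given by a `G`-stable family of subspaces. -/
abbrev sub (E : EquivFamily) (N : ∀ x, Submodule ℂ (E.fib x))
    (hN : ∀ (g : G) {x y : OGplus} (h : g • x = y), ∀ v ∈ N x, E.act g h v ∈ N y) :
    EquivFamily where
  fib x := N x
  act g _ _ h := (E.act g h).restrict (hN g h)
  act_one h v := Subtype.ext (E.act_one h v.1)
  act_mul g g' _ _ _ h h' h'' v := Subtype.ext (E.act_mul g g' h h' h'' v.1)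

theorem inv_smul_eq {g : G} {x y : OGplus} (h : g • x = y) : g⁻¹ • y = x := by
  rw [← h, inv_smul_smul]

/-- The dual bundle; `g` acts by the transpose of `g⁻¹`. -/
abbrev dual (E : EquivFamily) : EquivFamily where
  fib x := Module.Dual ℂ (E.fib x)
  act g _ _ h := (E.act g⁻¹ (inv_smul_eq h)).dualMap
  act_one {x} h f := by
    refine LinearMap.ext fun v => ?_
    rw [LinearMap.dualMap_apply]
    congr 1
    have key : ∀ (g : G) (hg : g • x = x), g = 1 → E.act g hg v = v := by
      rintro g hg rfl
      exact E.act_one hg v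
    exact key _ _ inv_one
  act_mul g g' x y z h h' h'' f := by
    refine LinearMap.ext fun v => ?_
    simp only [LinearMap.dualMap_apply]
    congr 1
    have key : ∀ (k : G) (hk : k • z = x), k = g⁻¹ * g'⁻¹ →
        E.act k hk v = E.act g⁻¹ (inv_smul_eq h) (E.act g'⁻¹ (inv_smul_eq h') v) := by
      rintro k hk rfl
      exact E.act_mul _ _ _ _ hk v
    exact key _ _ (mul_inv_rev g' g)

/-- The tensor product of two bundles. -/
abbrev tensor (E F : EquivFamily) : EquivFamily where
  fib x := E.fib x ⊗[ℂ] F.fib x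
  act g _ _ h := TensorProduct.map (E.act g h) (F.act g h)
  act_one h t := by
    rw [show E.act 1 h = LinearMap.id from LinearMap.ext (E.act_one h),
      show F.act 1 h = LinearMap.id from LinearMap.ext (F.act_one h), TensorProduct.map_id,
      LinearMap.id_apply]
  act_mul g g' _ _ _ h h' h'' t := by
    rw [show E.act (g' * g) h'' = E.act g' h' ∘ₗ E.act g h from
        LinearMap.ext (E.act_mul g g' h h' h''),
      show F.act (g' * g) h'' = F.act g' h' ∘ₗ F.act g h from
        LinearMap.ext (F.act_mul g g' h h' h''), TensorProduct.map_comp, LinearMap.comp_apply]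

/-- The direct sum of two bundles. -/
abbrev prod (E F : EquivFamily) : EquivFamily where
  fib x := E.fib x × F.fib x
  act g _ _ h := (E.act g h).prodMap (F.act g h)
  act_one h t := Prod.ext (E.act_one h t.1) (F.act_one h t.2)
  act_mul g g' _ _ _ h h' h'' t :=
    Prod.ext (E.act_mul g g' h h' h'' t.1) (F.act_mul g g' h h' h'' t.2)

/-- The zero bundle. -/
abbrev zero : EquivFamily := trivial (W := PUnit) 1

/-- The direct sum of a finite list of bundles. -/
def directSum (l : List EquivFamily) : EquivFamily := l.foldr prod zero

/-- The exterior powers `∧ⁿ E`. -/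
abbrev ext (n : ℕ) (E : EquivFamily) : EquivFamily where
  fib x := ⋀[ℂ]^n (E.fib x)
  act g _ _ h := exteriorPower.map n (E.act g h)
  act_one h t := by
    rw [show E.act 1 h = LinearMap.id from LinearMap.ext (E.act_one h), exteriorPower.map_id,
      LinearMap.id_apply]
  act_mul g g' _ _ _ h h' h'' t := by
    rw [show E.act (g' * g) h'' = E.act g' h' ∘ₗ E.act g h from
        LinearMap.ext (E.act_mul g g' h h' h'')]
    exact LinearMap.congr_fun (exteriorPower.map_comp (E.act g h) (E.act g' h')) t

/-- The multiplication `W ⊗ ∧²W → ∧³W ⊆ ∧W`. -/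
def wedge (W : Type) [AddCommGroup W] [Module ℂ W] :
    W ⊗[ℂ] (⋀[ℂ]^2 W) →ₗ[ℂ] ExteriorAlgebra ℂ W :=
  LinearMap.mul' ℂ (ExteriorAlgebra ℂ W) ∘ₗ
    TensorProduct.map (ExteriorAlgebra.ι ℂ) (Submodule.subtype _)

theorem wedge_natural {W W' : Type} [AddCommGroup W] [Module ℂ W] [AddCommGroup W'] [Module ℂ W']
    (f : W →ₗ[ℂ] W') (t : W ⊗[ℂ] (⋀[ℂ]^2 W)) :
    wedge W' (TensorProduct.map f (exteriorPower.map 2 f) t) =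
      ExteriorAlgebra.map f (wedge W t) := by
  have hmap : ∀ b : ⋀[ℂ]^2 W, ((exteriorPower.map 2 f b : ⋀[ℂ]^2 W') : ExteriorAlgebra ℂ W') =
      ExteriorAlgebra.map f (b : ExteriorAlgebra ℂ W) := by
    intro b
    have hb : b ∈ Submodule.span ℂ (Set.range (exteriorPower.ιMulti ℂ 2 (M := W))) := by
      rw [exteriorPower.ιMulti_span]; trivial
    induction hb using Submodule.span_induction with
    | mem b hb =>
      obtain ⟨m, rfl⟩ := hb
      rw [exteriorPower.map_apply_ιMulti, exteriorPower.ιMulti_apply_coe,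
        exteriorPower.ιMulti_apply_coe, ExteriorAlgebra.map_apply_ιMulti]
    | zero => simp
    | add b c _ _ hb hc => rw [map_add, Submodule.coe_add, hb, hc, Submodule.coe_add, map_add]
    | smul r b _ hb => rw [map_smul, Submodule.coe_smul, hb, Submodule.coe_smul, map_smul]
  induction t with
  | zero => simp
  | add a b ha hb => rw [map_add, map_add, ha, hb, map_add, map_add]
  | tmul a b =>
    simp only [wedge, TensorProduct.map_tmul, LinearMap.comp_apply, LinearMap.mul'_apply,
      map_mul, Submodule.subtype_apply, hmap, ExteriorAlgebra.map_apply_ι]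

/-- The Schur functor `Σ^{2,1} E = ker (E ⊗ ∧²E → ∧³E)`. -/
abbrev schur21 (E : EquivFamily) : EquivFamily :=
  (tensor E (ext 2 E)).sub (fun x => LinearMap.ker (wedge (E.fib x))) fun g x y h v hv => by
    have hv' : wedge (E.fib x) v = 0 := hv
    change wedge (E.fib y) (TensorProduct.map (E.act g h) (exteriorPower.map 2 (E.act g h)) v) = 0
    rw [wedge_natural, hv', map_zero]

end EquivFamily

/-! ### The bundles of the complex -/

/-- The trivial bundle `V ⊗ 𝒪`. -/
abbrev trivialV : EquivFamily := EquivFamily.trivial vectorRep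

/-- The trivial bundles `S⁺ ⊗ 𝒪` (`i = 0`) and `S⁻ ⊗ 𝒪` (`i = 1`). -/
abbrev trivialHalf (i : ZMod 2) : EquivFamily := EquivFamily.trivial (halfSpinRep i)

/-- The tautological bundle `𝒰 ⊆ V ⊗ 𝒪`, with fibre `U` at `[U]`. -/
abbrev taut : EquivFamily :=
  trivialV.sub (fun x => x.space) fun g x y h v hv => by
    subst h
    exact Submodule.mem_map_of_mem hv

/-- The dual tautological bundle `𝒰^∨ = 𝒰_{ω₁}`. -/
abbrev tautDual : EquivFamily := taut.dual

/-- The pure spinors of a subspace `U` of `V`: those killed by Clifford multiplication by `U`. -/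
def pureSpinors (U : Submodule ℂ V) : Submodule ℂ S where
  carrier := {s | ∀ u ∈ U, cliffordMul u s = 0}
  add_mem' ha hb u hu := by rw [map_add, ha u hu, hb u hu, add_zero]
  zero_mem' u _ := map_zero _
  smul_mem' c s hs u hu := by rw [map_smul, hs u hu, smul_zero]

theorem cliffordMul_vectorRep (g : G) (v : V) (s : S) :
    cliffordMul (vectorRep g v) (spinRep g s) = spinRep g (cliffordMul v s) := by
  have h : ∀ k : G, spinRep k = spinAction (k : Cl) := fun _ => rfl
  rw [← spinAction_ι, ι_vectorRep, h, map_mul, map_mul, spinAction_ι, ← Module.End.mul_apply,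
    mul_assoc, ← map_mul]
  have h1 : ((g⁻¹ : G) : Cl) * (g : Cl) = 1 := congrArg Subtype.val (inv_mul_cancel g)
  rw [h1, map_one, mul_one, Module.End.mul_apply]

/-- The line bundle `𝒪(-1) ⊆ S⁺ ⊗ 𝒪` whose fibre at `[U]` is the line of pure spinors of `U`
(these are even for `[U] ∈ OG₊`), so that `𝒪(1) = 𝒰_{ω₆}` embeds `X` in `ℙ(S⁺)`. -/
abbrev spinLine : EquivFamily :=
  (EquivFamily.trivial spinRep).sub (fun x => pureSpinors x.space) fun g x y h s hs => by
    subst h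
    rintro _ ⟨u, hu, rfl⟩
    change cliffordMul (vectorRep g u) (spinRep g s) = 0
    rw [cliffordMul_vectorRep, hs u hu, map_zero]

/-- The twist `E(-n)`. -/
def twistNeg (E : EquivFamily) : ℕ → EquivFamily
  | 0 => E
  | n + 1 => (twistNeg E n).tensor spinLine

/-- The bundle `𝒰_{ω₁+ω₂} = Σ^{2,1} 𝒰^∨`. -/
abbrev schurDual : EquivFamily := tautDual.schur21

/-! ### Irreducible bundles and semisimplification -/

/-- An equivariant bundle is irreducible if it is nonzero and has no equivariant subbundles except
`0` and itself. (Every `G`-stable family of subspaces is an equivariant subbundle, since `G` acts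
transitively on `X`.) -/
def EquivFamily.IsIrreducible (E : EquivFamily) : Prop :=
  (∃ x, Nontrivial (E.fib x)) ∧
    ∀ N : ∀ x, Submodule ℂ (E.fib x),
      (∀ (g : G) {x y : OGplus} (h : g • x = y), ∀ v ∈ N x, E.act g h v ∈ N y) →
        (∀ x, N x = ⊥) ∨ ∀ x, N x = ⊤

/-- `E` has a finite filtration by equivariant subbundles whose successive quotients are the
irreducible bundles in the list. -/
inductive HasCompositionSeries : EquivFamily → List EquivFamily → Prop
  | nil (E : EquivFamily) (hE : E.IsVectorBundle) (h : ∀ x, Subsingleton (E.fib x)) :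
      HasCompositionSeries E []
  | cons (E' E F : EquivFamily) (l : List EquivFamily) (hE : E.IsVectorBundle)
      (hF : F.IsVectorBundle) (hirr : F.IsIrreducible) (φ : Hom E' E) (ψ : Hom E F)
      (hex : φ.ShortExact ψ) (hl : HasCompositionSeries E' l) :
      HasCompositionSeries E (F :: l)

/-- `A` is the semisimple reduction of `E`: it is isomorphic to the direct sum of the irreducible
quotients of a composition series of `E`. -/
def IsSemisimplification (E A : EquivFamily) : Prop :=
  ∃ l : List EquivFamily, HasCompositionSeries E l ∧
    ∃ φ : Hom A (EquivFamily.directSum l), φ.Injective ∧ φ.Surjective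

/-! ### The maps of the complex -/

theorem cliffordMul_triple_mem (v : Fin 3 → V) :
    ∀ s ∈ half 1, ((1 / 6 : ℂ) • ∑ σ : Equiv.Perm (Fin 3), (Equiv.Perm.sign σ : ℤ) •
      (cliffordMul (v (σ 0)) * cliffordMul (v (σ 1)) * cliffordMul (v (σ 2)))) s ∈ half 0 := by
  intro s hs
  rw [LinearMap.smul_apply, LinearMap.sum_apply]
  refine Submodule.smul_mem _ _ (Submodule.sum_mem _ fun σ _ => ?_)
  rw [LinearMap.smul_apply]
  exact zsmul_mem (cliffordMul_mem_half (v (σ 0)) (1 + 1 + 1) (cliffordMul_mem_half (v (σ 1)) (1 + 1)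
    (cliffordMul_mem_half (v (σ 2)) 1 hs))) _

/-- The map `∧³η : ∧³V ⊗ S⁻ → S⁺` on decomposable trivectors: the antisymmetrization in
`v₁, v₂, v₃` of the iterated Clifford multiplication `s ↦ v₁ · (v₂ · (v₃ · s))`. -/
def trivectorMul (v : Fin 3 → V) : half 1 →ₗ[ℂ] half 0 :=
  ((1 / 6 : ℂ) • ∑ σ : Equiv.Perm (Fin 3), (Equiv.Perm.sign σ : ℤ) •
    (cliffordMul (v (σ 0)) * cliffordMul (v (σ 1)) * cliffordMul (v (σ 2)))).restrict
      (cliffordMul_triple_mem v)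

/-- The isomorphism `∧³V ≃ ∧³V^∨ = (∧³V)^∨` induced by `q`: it pairs `v₁ ∧ v₂ ∧ v₃` and
`w₁ ∧ w₂ ∧ w₃` to `det (b(vᵢ, wⱼ))`, with `b` the polar form of `q`. -/
def trivectorPairing : ⋀[ℂ]^3 V →ₗ[ℂ] Module.Dual ℂ (⋀[ℂ]^3 V) :=
  exteriorPower.pairingDual ℂ V 3 ∘ₗ exteriorPower.map 3 (QuadraticMap.polarBilin q)

/-- `β` is a non-degenerate `G`-invariant bilinear form on `S⁺`, i.e. an isomorphism of
representations `S⁺ ≃ (S⁺)^∨`. -/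
def IsInvariantForm (β : LinearMap.BilinForm ℂ (half 0)) : Prop :=
  β.Nondegenerate ∧ ∀ (g : G) (s t : half 0), β (halfSpinRep 0 g s) (halfSpinRep 0 g t) = β s t

/-- The map `ξ : S⁻ ⊗ S⁺ → ∧³V` obtained from `∧³η : ∧³V ⊗ S⁻ → S⁺` by transposition, where
`S⁺ ≃ (S⁺)^∨` by `β` and `∧³V ≃ (∧³V)^∨` by `q`. -/
def IsTransposeOfTrivectorMul (β : LinearMap.BilinForm ℂ (half 0))
    (ξ : half 1 →ₗ[ℂ] half 0 →ₗ[ℂ] ⋀[ℂ]^3 V) : Prop :=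
  ∀ (s : half 1) (t : half 0) (v : Fin 3 → V),
    trivectorPairing (ξ s t) (exteriorPower.ιMulti ℂ 3 v) = β (trivectorMul v s) t

/-- The inclusion `i : 𝒰^∨(-1) → S⁻ ⊗ 𝒪` given by Clifford multiplication: with `𝒰^∨ = V / 𝒰` via
the polar form `b` of `q`, it maps `b(v, -) ⊗ s` to `v · s` for every pure spinor `s` of `U`. -/
def IsCliffordInclusion (i : Hom (tautDual.tensor spinLine) (trivialHalf 1)) : Prop :=
  ∀ (x : OGplus) (v : V) (s : pureSpinors x.space),
    ((i.app x ((QuadraticMap.polarBilin q v ∘ₗ x.space.subtype) ⊗ₜ[ℂ] s) : half 1) : S) =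
      cliffordMul v (s : S)

/-- The inclusion `j : 𝒰^∨ → V ⊗ ∧²𝒰^∨`, `j(f) = ∑ₖ bₖ ⊗ (bₖ^∨ ∧ f)` for any basis `b₁, …, b₆` of
the fibre `U` of `𝒰`, with dual basis `b₁^∨, …, b₆^∨` of `U^∨`. -/
def IsContractionInclusion (j : Hom tautDual (trivialV.tensor (EquivFamily.ext 2 tautDual))) :
    Prop :=
  ∀ (x : OGplus) (b : Module.Basis (Fin 6) ℂ x.space) (f : Module.Dual ℂ x.space),
    j.app x f =
      ∑ k : Fin 6, (b k : V) ⊗ₜ[ℂ] exteriorPower.ιMulti ℂ 2 ![b.coord k, f]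

end Spin12

end

open Spin12

noncomputable section

namespace Spin12

/-! ### Regular functions -/

namespace IsRegularFor

variable {Y Z : Type} {A : Subalgebra ℂ (Y → ℂ)} {B : Subalgebra ℂ (Z → ℂ)} {W : Set Y}

/-! Everything in sight is `G`-equivariant and `G` acts transitively on `X`, so injectivity,
surjectivity and exactness need only be checked on the fibre at the base point `[0 ⊕ M]`. Regularity
is also automatic. An equivariant family of linear maps at `g • base` is the map at the base point
conjugated by `g`, hence has regular matrix entries (`EquivFamily.regular_of_equivariant`). A family
whose base fibre is an algebraic representation of the stabilizer is a vector bundle, because the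
orbit map has regular sections over the translates of the big cell
(`EquivFamily.IsAlgebraic.isVectorBundle`). What remains is linear algebra on `V = M^∨ ⊕ M` and `S =
⋀ M^∨`, where the pure spinor of the base point is `1` and the inclusion `i` sends `f ⊗ 1` to the
covector `f`.

`R` is the kernel of the second map `d₂`. The third map polarizes a trivector to `V ⊗ ∧²V`,
restricts the last two factors to `𝒰` (this is `comul`) and reduces modulo the contraction
inclusion. The fourth restricts the remaining factor and projects onto `Σ²¹`. Exactness at `T` and
at the last term is pure multilinear algebra: an element that becomes a polarization over `𝒰^∨`
comes from a trivector (`exists_comul_of_toSchur21`).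

Exactness at `∧³V` is a duality argument. A trivector `ω` orthogonal to the image of `d₂` is one
whose Clifford action kills every covector; a degree count shows that such `ω` lies in `triC`, the
span of the `v ∧ u ∧ u'` with `u, u' ∈ M` (`mem_triC_of_trivMul`). Pairing with `triC` is evaluation
of `comul` (`ev12_comul`), so the kernel of `comul` lies in the image of `d₂`. Conversely `comul ∘
d₂` does not vanish: its image is exactly that of the contraction inclusion (`comul_xi`), because `v
∧ u ∧ u'` sends a covector to a scalar. This is why `T` has to be the quotient by that inclusion.

For the kernel of `d₂`, write an element as `∑ wᵢ ⊗ 1 ⊗ sᵢ` and test it against trivectors of the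
three types `∧³M^∨`, `M ∧ ∧²M^∨` and `triC`. The outcome is that the `sᵢ` have degree at most two
and `∑ wᵢ ∧ (sᵢ)₂ = 0` (`baseD2_baseElt_eq_zero_iff`). The degree-zero part is the subbundle
`𝒰^∨(-2)`. The degree-two part is not stable, but modulo degree zero it is the quotient
`Σ²¹𝒰^∨(-2)`. The two factors are irreducible because transvections of `M` come from the stabilizer
and already act irreducibly on `M^∨` and on `Σ²¹M^∨` (`eq_bot_or_ker_wedge_le`). -/

theorem of_mem {a : Y → ℂ} (ha : a ∈ A) : IsRegularFor A W fun y => a y := fun y =>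
  ⟨a, ha, 1, one_mem A, by simp, fun z _ => by simp⟩

theorem const (c : ℂ) : IsRegularFor A W fun _ => c :=
  of_mem (a := fun _ => c) (A.algebraMap_mem c)

theorem add {f g : W → ℂ} (hf : IsRegularFor A W f) (hg : IsRegularFor A W g) :
    IsRegularFor A W fun y => f y + g y := fun y => by
  obtain ⟨a, ha, b, hb, hby, h⟩ := hf y
  obtain ⟨a', ha', b', hb', hby', h'⟩ := hg y
  refine ⟨a * b' + a' * b, add_mem (mul_mem ha hb') (mul_mem ha' hb), b * b', mul_mem hb hb',
    mul_ne_zero hby hby', fun z hz => ?_⟩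
  have h1 : b z ≠ 0 := left_ne_zero_of_mul hz
  have h2 : b' z ≠ 0 := right_ne_zero_of_mul hz
  simp only [h z h1, h' z h2, Pi.add_apply, Pi.mul_apply]
  field_simp

theorem mul {f g : W → ℂ} (hf : IsRegularFor A W f) (hg : IsRegularFor A W g) :
    IsRegularFor A W fun y => f y * g y := fun y => by
  obtain ⟨a, ha, b, hb, hby, h⟩ := hf y
  obtain ⟨a', ha', b', hb', hby', h'⟩ := hg y
  refine ⟨a * a', mul_mem ha ha', b * b', mul_mem hb hb',
    mul_ne_zero hby hby', fun z hz => ?_⟩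
  have h1 : b z ≠ 0 := left_ne_zero_of_mul hz
  have h2 : b' z ≠ 0 := right_ne_zero_of_mul hz
  simp only [h z h1, h' z h2, Pi.mul_apply]
  field_simp

theorem inv {f : W → ℂ} (hf : IsRegularFor A W f) (h0 : ∀ y, f y ≠ 0) :
    IsRegularFor A W fun y => (f y)⁻¹ := fun y => by
  obtain ⟨a, ha, b, hb, hby, h⟩ := hf y
  have hay : a y ≠ 0 := fun e => h0 y (by rw [h y hby, e, zero_div])
  refine ⟨b * b, mul_mem hb hb, a * b, mul_mem ha hb, mul_ne_zero hay hby, fun z hz => ?_⟩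
  have h1 : a z ≠ 0 := left_ne_zero_of_mul hz
  have h2 : b z ≠ 0 := right_ne_zero_of_mul hz
  simp only [h z h2, Pi.mul_apply]
  field_simp

theorem sum {ι : Type*} (s : Finset ι) {f : ι → W → ℂ}
    (hf : ∀ i ∈ s, IsRegularFor A W (f i)) : IsRegularFor A W fun y => ∑ i ∈ s, f i y := by
  classical
  induction s using Finset.induction_on with
  | empty => simpa using const (A := A) (W := W) 0
  | insert i s hi ih =>
    simp only [Finset.sum_insert hi]
    exact (hf i (Finset.mem_insert_self _ _)).add
      (ih fun j hj => hf j (Finset.mem_insert_of_mem hj))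

theorem comp {W' : Set Z} {f : W' → ℂ} (hf : IsRegularFor B W' f) (F : Y → Z)
    (hF : ∀ b ∈ B, b ∘ F ∈ A) (hW : ∀ y ∈ W, F y ∈ W') :
    IsRegularFor A W fun y => f ⟨F y, hW y y.2⟩ := fun y => by
  obtain ⟨a, ha, b, hb, hby, h⟩ := hf ⟨F y, hW y y.2⟩
  exact ⟨a ∘ F, hF a ha, b ∘ F, hF b hb, hby, fun z hz => h _ hz⟩

end IsRegularFor

/-! ### Regular maps to the Clifford algebra -/

instance : Module.Finite ℂ S :=
  Module.Finite.of_basis (Module.finBasis ℂ (Module.Dual ℂ M)).ExteriorAlgebra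

instance : Module.Finite ℂ Cl :=
  letI : Invertible (2 : ℂ) := invertibleOfNonzero two_ne_zero
  haveI : Module.Finite ℂ (ExteriorAlgebra ℂ V) :=
    Module.Finite.of_basis (Module.finBasis ℂ V).ExteriorAlgebra
  Module.Finite.equiv (CliffordAlgebra.equivExterior q).symm

/-- Expanding the first factor in a basis turns a functional of a product into a sum of products of
functionals, so multiplication of `Cl` is polynomial in coordinates. -/
theorem dual_mul_eq_sum (φ : Module.Dual ℂ Cl) (x y : Cl) :
    φ (x * y) = ∑ k, (Module.finBasis ℂ Cl).coord k x *
      (φ ∘ₗ LinearMap.mulLeft ℂ (Module.finBasis ℂ Cl k)) y := by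
  have h : φ (x * y) = φ ((∑ k, (Module.finBasis ℂ Cl).repr x k • Module.finBasis ℂ Cl k) * y) := by
    rw [Module.Basis.sum_repr]
  rw [h, Finset.sum_mul, map_sum]
  refine Finset.sum_congr rfl fun k _ => ?_
  rw [smul_mul_assoc, map_smul]
  rfl

/-- A map to the Clifford algebra is regular if its coordinates are. -/
def IsRegularCl {Y : Type} (A : Subalgebra ℂ (Y → ℂ)) (W : Set Y) (γ : W → Cl) : Prop :=
  ∀ φ : Module.Dual ℂ Cl, IsRegularFor A W fun y => φ (γ y)

namespace IsRegularCl

variable {Y Z : Type} {A : Subalgebra ℂ (Y → ℂ)} {B : Subalgebra ℂ (Z → ℂ)} {W : Set Y}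

theorem const (c : Cl) : IsRegularCl A W fun _ => c := fun φ => IsRegularFor.const (φ c)

theorem map {γ : W → Cl} (hγ : IsRegularCl A W γ) (L : Cl →ₗ[ℂ] Cl) :
    IsRegularCl A W fun y => L (γ y) := fun φ => hγ (φ ∘ₗ L)

theorem add {γ δ : W → Cl} (hγ : IsRegularCl A W γ) (hδ : IsRegularCl A W δ) :
    IsRegularCl A W fun y => γ y + δ y := fun φ => by
  simp only [map_add]
  exact (hγ φ).add (hδ φ)

theorem smul {f : W → ℂ} {γ : W → Cl} (hf : IsRegularFor A W f) (hγ : IsRegularCl A W γ) :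
    IsRegularCl A W fun y => f y • γ y := fun φ => by
  simp only [map_smul, smul_eq_mul]
  exact hf.mul (hγ φ)

theorem mul {γ δ : W → Cl} (hγ : IsRegularCl A W γ) (hδ : IsRegularCl A W δ) :
    IsRegularCl A W fun y => γ y * δ y := fun φ => by
  simp only [dual_mul_eq_sum]
  exact IsRegularFor.sum _ fun k _ => (hγ _).mul (hδ _)

theorem list_prod {ι : Type*} (l : List ι) {γ : ι → W → Cl}
    (hγ : ∀ i ∈ l, IsRegularCl A W (γ i)) :
    IsRegularCl A W fun y => (l.map fun i => γ i y).prod := by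
  induction l with
  | nil => simpa using const (A := A) (W := W) 1
  | cons i l ih =>
    simp only [List.map_cons, List.prod_cons]
    exact (hγ i (by simp)).mul (ih fun j hj => hγ j (by simp [hj]))

theorem comp {W' : Set Z} {γ : W' → Cl} (hγ : IsRegularCl B W' γ) (F : Y → Z)
    (hF : ∀ b ∈ B, b ∘ F ∈ A) (hW : ∀ y ∈ W, F y ∈ W') :
    IsRegularCl A W fun y => γ ⟨F y, hW y y.2⟩ := fun φ => (hγ φ).comp F hF hW

theorem coordRing_comp {γ : W → G} (hγ : IsRegularCl A W fun y => (γ y : Cl)) {a : G → ℂ}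
    (ha : a ∈ coordRing) : IsRegularFor A W fun y => a (γ y) := by
  induction ha using Algebra.adjoin_induction with
  | mem a ha => obtain ⟨φ, rfl⟩ := ha; exact hγ φ
  | algebraMap c => exact IsRegularFor.const c
  | add a b _ _ ha hb => exact ha.add hb
  | mul a b _ _ ha hb => exact ha.mul hb

end IsRegularCl

theorem coe_inv_G (g : G) : ((g⁻¹ : G) : Cl) = star (g : Cl) := rfl

/-- The anti-involution `star` of the Clifford algebra as a linear map. -/
def starCl : Cl →ₗ[ℂ] Cl :=
  CliffordAlgebra.reverse ∘ₗ (CliffordAlgebra.involute : Cl →ₐ[ℂ] Cl).toLinearMap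

theorem dual_mem_coordRing (φ : Module.Dual ℂ Cl) : (fun g : G => φ (g : Cl)) ∈ coordRing :=
  Algebra.subset_adjoin ⟨φ, rfl⟩

theorem comp_mem_of_adjoin {Y Z : Type} {A : Subalgebra ℂ (Y → ℂ)} {s : Set (Z → ℂ)} (F : Y → Z)
    (h : ∀ b ∈ s, b ∘ F ∈ A) : ∀ b ∈ Algebra.adjoin ℂ s, b ∘ F ∈ A := by
  intro b hb
  induction hb using Algebra.adjoin_induction with
  | mem b hb => exact h b hb
  | algebraMap c => exact A.algebraMap_mem c
  | add a b _ _ ha hb => exact A.add_mem ha hb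
  | mul a b _ _ ha hb => exact A.mul_mem ha hb

/-- Inversion on the spin group is `star`, which is the restriction of a linear map of `Cl`. -/
theorem coordRing_comp_inv {a : G → ℂ} (ha : a ∈ coordRing) :
    (fun g => a g⁻¹) ∈ coordRing := by
  refine comp_mem_of_adjoin (A := coordRing) (fun g : G => g⁻¹) ?_ a ha
  rintro _ ⟨φ, rfl⟩
  exact dual_mem_coordRing (φ ∘ₗ starCl)

theorem coordRing_coe_mul {b : Module.Dual ℂ Cl} (x y : G → Cl)
    (hx : ∀ φ : Module.Dual ℂ Cl, (fun g => φ (x g)) ∈ coordRing)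
    (hy : ∀ φ : Module.Dual ℂ Cl, (fun g => φ (y g)) ∈ coordRing) :
    (fun g => b (x g * y g)) ∈ coordRing := by
  let B := Module.finBasis ℂ Cl
  have h : (fun g => b (x g * y g)) =
      ∑ k, (fun g => B.coord k (x g)) * (fun g => (b ∘ₗ LinearMap.mulLeft ℂ (B k)) (y g)) := by
    funext g
    rw [dual_mul_eq_sum, Finset.sum_apply]
    rfl
  rw [h]
  exact sum_mem fun k _ => mul_mem (hx _) (hy _)

/-- Matrix coefficients of the vector representation are regular. -/
theorem vectorRep_coeff_mem (φ : Module.Dual ℂ V) (v : V) :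
    (fun g => φ (vectorRep g v)) ∈ coordRing := by
  have h : (fun g => φ (vectorRep g v)) = fun g : G =>
      (φ ∘ₗ vectorPart) ((g : Cl) * (CliffordAlgebra.ι q v * starCl (g : Cl))) := by
    funext g
    rw [← mul_assoc]
    rfl
  rw [h]
  refine coordRing_coe_mul _ _ dual_mem_coordRing fun ψ => ?_
  exact dual_mem_coordRing (ψ ∘ₗ LinearMap.mulLeft ℂ (CliffordAlgebra.ι q v) ∘ₗ starCl)

theorem spinRep_coeff_mem (φ : Module.Dual ℂ S) (s : S) :
    (fun g => φ (spinRep g s)) ∈ coordRing :=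
  dual_mem_coordRing (φ ∘ₗ LinearMap.applyₗ s ∘ₗ spinAction.toLinearMap)

/-- Pulling back regular functions from `G × G` along a map with regular components. -/
theorem coordRingProd_comp {Y : Type} {A : Subalgebra ℂ (Y → ℂ)} (F : Y → G × G)
    (h1 : ∀ φ : Module.Dual ℂ Cl, (fun y => φ ((F y).1 : Cl)) ∈ A)
    (h2 : ∀ φ : Module.Dual ℂ Cl, (fun y => φ ((F y).2 : Cl)) ∈ A) :
    ∀ b ∈ coordRingProd, b ∘ F ∈ A := by
  refine comp_mem_of_adjoin F ?_
  rintro _ ⟨φ, rfl | rfl⟩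
  · exact h1 φ
  · exact h2 φ

theorem coordRing_comp_prod {F : G × G → G}
    (h : ∀ φ : Module.Dual ℂ Cl, (fun p => φ (F p : Cl)) ∈ coordRingProd) :
    ∀ b ∈ coordRing, b ∘ F ∈ coordRingProd := by
  refine comp_mem_of_adjoin F ?_
  rintro _ ⟨φ, rfl⟩
  exact h φ

theorem fst_mem_coordRingProd (φ : Module.Dual ℂ Cl) :
    (fun p : G × G => φ (p.1 : Cl)) ∈ coordRingProd :=
  Algebra.subset_adjoin ⟨φ, Or.inl rfl⟩

theorem snd_mem_coordRingProd (φ : Module.Dual ℂ Cl) :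
    (fun p : G × G => φ (p.2 : Cl)) ∈ coordRingProd :=
  Algebra.subset_adjoin ⟨φ, Or.inr rfl⟩

theorem mul_mem_coordRingProd (φ : Module.Dual ℂ Cl) :
    (fun p : G × G => φ ((p.1 * p.2 : G) : Cl)) ∈ coordRingProd := by
  let B := Module.finBasis ℂ Cl
  have h : (fun p : G × G => φ ((p.1 * p.2 : G) : Cl)) =
      ∑ k, (fun p : G × G => B.coord k (p.1 : Cl)) *
        (fun p : G × G => (φ ∘ₗ LinearMap.mulLeft ℂ (B k)) (p.2 : Cl)) := by
    funext p
    change φ ((p.1 : Cl) * (p.2 : Cl)) = _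
    rw [dual_mul_eq_sum, Finset.sum_apply]
    rfl
  rw [h]
  exact sum_mem fun k _ => mul_mem (fst_mem_coordRingProd _) (snd_mem_coordRingProd _)

theorem left_mul_mem_coordRing (h : G) : ∀ b ∈ coordRing, b ∘ (fun g : G => h * g) ∈ coordRing := by
  refine comp_mem_of_adjoin _ ?_
  rintro _ ⟨φ, rfl⟩
  exact dual_mem_coordRing (φ ∘ₗ LinearMap.mulLeft ℂ (h : Cl))

/-! ### Homogeneity -/

/-- The base point `[0 ⊕ M]` of `X`. -/
def base : OGplus where
  space := baseSubspace
  mem_orbit := ⟨1, by rw [map_one, Module.End.one_eq_id, Submodule.map_id]⟩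

theorem orbitMap_eq (g : G) : orbitMap g = g • base := rfl

theorem exists_smul_base (x : OGplus) : ∃ g : G, g • base = x := by
  obtain ⟨g, hg⟩ := x.mem_orbit
  exact ⟨g, OGplus.ext_space hg.symm⟩

namespace EquivFamily

variable (E F : EquivFamily)

theorem act_inv_act {g : G} {x y : OGplus} (h : g • x = y) (h' : g⁻¹ • y = x) (v : E.fib x) :
    E.act g⁻¹ h' (E.act g h v) = v := by
  have key : ∀ (k : G) (hk : k • x = x), k = 1 → E.act k hk v = v := by
    rintro k hk rfl
    exact E.act_one hk v
  rw [← E.act_mul g g⁻¹ h h' (by rw [inv_mul_cancel, one_smul])]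
  exact key _ _ (inv_mul_cancel g)

theorem act_act_inv {g : G} {x y : OGplus} (h : g • x = y) (h' : g⁻¹ • y = x) (v : E.fib y) :
    E.act g h (E.act g⁻¹ h' v) = v := by
  have key : ∀ (k : G) (hk : k • y = y), k = 1 → E.act k hk v = v := by
    rintro k hk rfl
    exact E.act_one hk v
  rw [← E.act_mul g⁻¹ g h' h (by rw [mul_inv_cancel, one_smul])]
  exact key _ _ (mul_inv_cancel g)

/-- The action of `g` as an isomorphism between fibres. -/
def actEquiv (g : G) {x y : OGplus} (h : g • x = y) : E.fib x ≃ₗ[ℂ] E.fib y :=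
  LinearEquiv.ofLinearMap (E.act g h) (E.act g⁻¹ (inv_smul_eq h))
    (LinearMap.ext (E.act_act_inv h _)) (LinearMap.ext (E.act_inv_act h _))

theorem actEquiv_apply (g : G) {x y : OGplus} (h : g • x = y) (v : E.fib x) :
    E.actEquiv g h v = E.act g h v := rfl

theorem actEquiv_symm_apply (g : G) {x y : OGplus} (h : g • x = y) (v : E.fib y) :
    (E.actEquiv g h).symm v = E.act g⁻¹ (inv_smul_eq h) v := rfl

variable {E F}

theorem repr_act_congr {r : ℕ} (e : LocalFrame E r) {g g' : G} {x z z' : OGplus} (hg : g = g')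
    (hz : z ∈ e.dom) (hz' : z' ∈ e.dom) (h : g • x = z) (h' : g' • x = z') (v : E.fib x)
    (i : Fin r) :
    (e.basis ⟨z, hz⟩).repr (E.act g h v) i = (e.basis ⟨z', hz'⟩).repr (E.act g' h' v) i := by
  subst hg
  subst h
  subst h'
  rfl

/-- Equivariant families of linear maps are regular. -/
theorem regular_of_equivariant (app : ∀ x, E.fib x →ₗ[ℂ] F.fib x)
    (happ : ∀ (g : G) {x y : OGplus} (h : g • x = y) (v : E.fib x),
      app y (E.act g h v) = F.act g h (app x v))
    (a : BundleAtlas E) (b : BundleAtlas F) (e : LocalFrame E a.rank) (he : e ∈ a.frames)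
    (e' : LocalFrame F b.rank) (he' : e' ∈ b.frames) (i : Fin b.rank) (j : Fin a.rank) :
    IsRegularX (e.dom ∩ e'.dom) fun x =>
      (e'.basis ⟨x.1, x.2.2⟩).repr (app x.1 (e.basis ⟨x.1, x.2.1⟩ j)) i := by
  obtain ⟨e₀, he₀, hb₀⟩ := a.cover base
  obtain ⟨e₁, he₁, hb₁⟩ := b.cover base
  have hinv : ∀ g : G, g⁻¹ • orbitMap g = base := fun g => by
    rw [orbitMap_eq, inv_smul_smul]
  -- The map at `g • base` is the map at the base point conjugated by `g`. The two outer matrices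
  -- are regular by the `action` clauses of the atlases, pulled back along `g ↦ (g⁻¹, g)` here and
  -- along `g ↦ (g, 1)` in `h2`; the middle one is constant.
  have h1 : ∀ k, IsRegularFor coordRing (orbitMap ⁻¹' (e.dom ∩ e'.dom)) fun g =>
      (e₀.basis ⟨base, hb₀⟩).repr (E.act g.1⁻¹ (hinv g.1) (e.basis ⟨orbitMap g.1, g.2.1⟩ j)) k := by
    intro k
    have h := (a.action e he e₀ he₀ k j)
    have h' := IsRegularFor.comp (A := coordRing) (W := orbitMap ⁻¹' (e.dom ∩ e'.dom)) h
      (fun g : G => (g⁻¹, g))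
      (coordRingProd_comp _ (fun φ => dual_mem_coordRing (φ ∘ₗ starCl)) dual_mem_coordRing)
      (fun g hg => ⟨hg.1, by change g⁻¹ • orbitMap g ∈ _; rwa [hinv]⟩)
    convert h' using 2 with g
    exact repr_act_congr e₀ rfl _ _ _ _ _ _
  have h2 : ∀ l, IsRegularFor coordRing (orbitMap ⁻¹' (e.dom ∩ e'.dom)) fun g =>
      (e'.basis ⟨orbitMap g.1, g.2.2⟩).repr
        (F.act g.1 (orbitMap_eq g.1).symm (e₁.basis ⟨base, hb₁⟩ l)) i := by
    intro l
    have h := (b.action e₁ he₁ e' he' i l)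
    have hone : orbitMap 1 = base := by rw [orbitMap_eq, one_smul]
    have h' := IsRegularFor.comp (A := coordRing) (W := orbitMap ⁻¹' (e.dom ∩ e'.dom)) h
      (fun g : G => (g, 1))
      (coordRingProd_comp _ dual_mem_coordRing (fun φ => coordRing.algebraMap_mem (φ ((1 : G) : Cl))))
      (fun g hg => ⟨by change orbitMap 1 ∈ _; rwa [hone], by
        change g • orbitMap 1 ∈ _; rw [hone]; exact hg.2⟩)
    convert h' using 2 with g
    have key : ∀ (z : OGplus) (hz : z = base) (hz' : z ∈ e₁.dom) (hgz : g.1 • z ∈ e'.dom),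
        (e'.basis ⟨orbitMap g.1, g.2.2⟩).repr
          (F.act g.1 (orbitMap_eq g.1).symm (e₁.basis ⟨base, hb₁⟩ l)) i =
        (e'.basis ⟨g.1 • z, hgz⟩).repr (F.act g.1 rfl (e₁.basis ⟨z, hz'⟩ l)) i := by
      rintro z rfl hz' hgz
      rfl
    exact key _ hone _ _
  have hsum : ∀ g : orbitMap ⁻¹' (e.dom ∩ e'.dom),
      (e'.basis ⟨orbitMap g.1, g.2.2⟩).repr (app _ (e.basis ⟨orbitMap g.1, g.2.1⟩ j)) i =
      ∑ k, ∑ l, (e₀.basis ⟨base, hb₀⟩).repr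
          (E.act g.1⁻¹ (hinv g.1) (e.basis ⟨orbitMap g.1, g.2.1⟩ j)) k *
        ((e₁.basis ⟨base, hb₁⟩).repr (app base (e₀.basis ⟨base, hb₀⟩ k)) l *
        (e'.basis ⟨orbitMap g.1, g.2.2⟩).repr
          (F.act g.1 (orbitMap_eq g.1).symm (e₁.basis ⟨base, hb₁⟩ l)) i) := by
    intro g
    set v := e.basis ⟨orbitMap g.1, g.2.1⟩ j with hv
    set u := E.act g.1⁻¹ (hinv g.1) v with hu
    have hvu : v = E.act g.1 (orbitMap_eq g.1).symm u := (E.act_act_inv _ _ v).symm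
    have hu' : u = ∑ k, (e₀.basis ⟨base, hb₀⟩).repr u k • e₀.basis ⟨base, hb₀⟩ k :=
      ((e₀.basis ⟨base, hb₀⟩).sum_repr u).symm
    rw [hvu, happ]
    conv_lhs => rw [hu']
    simp only [map_sum, map_smul, Finsupp.coe_finsetSum, Finset.sum_apply, Finsupp.smul_apply,
      smul_eq_mul]
    refine Finset.sum_congr rfl fun k _ => ?_
    rw [← Finset.mul_sum]
    congr 1
    have hw := ((e₁.basis ⟨base, hb₁⟩).sum_repr (app base (e₀.basis ⟨base, hb₀⟩ k))).symm
    conv_lhs => rw [hw]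
    simp only [map_sum, map_smul, Finsupp.coe_finsetSum, Finset.sum_apply, Finsupp.smul_apply,
      smul_eq_mul]
  unfold IsRegularX
  simp only [hsum]
  exact IsRegularFor.sum _ fun k _ => IsRegularFor.sum _ fun l _ =>
    (h1 k).mul ((IsRegularFor.const _).mul (h2 l))

end EquivFamily

/-- An equivariant family of linear maps as a morphism of bundles. -/
def Hom.ofEquivariant {E F : EquivFamily} (app : ∀ x, E.fib x →ₗ[ℂ] F.fib x)
    (happ : ∀ (g : G) {x y : OGplus} (h : g • x = y) (v : E.fib x),
      app y (E.act g h v) = F.act g h (app x v)) : Hom E F where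
  app := app
  equivariant := happ
  regular := EquivFamily.regular_of_equivariant app happ

namespace Hom

variable {E F H : EquivFamily}

theorem app_act_inv (φ : Hom E F) (g : G) {x y : OGplus} (h : g • x = y) (v : E.fib y) :
    φ.app x (E.act g⁻¹ (EquivFamily.inv_smul_eq h) v) =
      F.act g⁻¹ (EquivFamily.inv_smul_eq h) (φ.app y v) :=
  φ.equivariant _ _ _

/-- An element carrying the base point to `x` identifies the map at `x` with the map at the base
point; the next two lemmas use the same transport. -/
theorem injective_of_base (φ : Hom E F) (h : Function.Injective (φ.app base)) : φ.Injective := by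
  intro x
  obtain ⟨g, hg⟩ := exists_smul_base x
  intro v w hvw
  have := congrArg (F.act g⁻¹ (EquivFamily.inv_smul_eq hg)) hvw
  rw [← φ.app_act_inv g hg, ← φ.app_act_inv g hg] at this
  exact (E.actEquiv g hg).symm.injective (h this)

theorem surjective_of_base (φ : Hom E F) (h : Function.Surjective (φ.app base)) :
    φ.Surjective := by
  intro x
  obtain ⟨g, hg⟩ := exists_smul_base x
  intro w
  obtain ⟨v, hv⟩ := h (F.act g⁻¹ (EquivFamily.inv_smul_eq hg) w)
  refine ⟨E.act g hg v, ?_⟩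
  rw [φ.equivariant g hg, hv, F.act_act_inv]

theorem exact_of_base (φ : Hom E F) (ψ : Hom F H)
    (h : Function.Exact (φ.app base) (ψ.app base)) : φ.Exact ψ := by
  intro x
  obtain ⟨g, hg⟩ := exists_smul_base x
  intro v
  constructor
  · intro hv
    have h1 : ψ.app base (F.act g⁻¹ (EquivFamily.inv_smul_eq hg) v) = 0 := by
      rw [ψ.app_act_inv g hg, hv, map_zero]
    obtain ⟨u, hu⟩ := (h _).1 h1
    exact ⟨E.act g hg u, by rw [φ.equivariant g hg, hu, F.act_act_inv]⟩
  · rintro ⟨u, rfl⟩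
    have h1 : ψ.app base (φ.app base (E.act g⁻¹ (EquivFamily.inv_smul_eq hg) u)) = 0 :=
      (h _).2 ⟨_, rfl⟩
    rw [φ.app_act_inv g hg, ψ.app_act_inv g hg] at h1
    exact (H.actEquiv g hg).symm.map_eq_zero_iff.1 h1

/-- The morphism determined by an equivariant linear map between the fibres at the base point. -/
def ofBase (f : E.fib base →ₗ[ℂ] F.fib base)
    (hf : ∀ (g : G) (h : g • base = base) (v : E.fib base), f (E.act g h v) = F.act g h (f v)) :
    Hom E F :=
  Hom.ofEquivariant
    (fun x => F.act (exists_smul_base x).choose (exists_smul_base x).choose_spec ∘ₗ f ∘ₗ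
      E.act _ (EquivFamily.inv_smul_eq (exists_smul_base x).choose_spec))
    fun g x y h v => by
      set k := (exists_smul_base x).choose
      have hk : k • base = x := (exists_smul_base x).choose_spec
      set l := (exists_smul_base y).choose
      have hl : l • base = y := (exists_smul_base y).choose_spec
      simp only [LinearMap.comp_apply]
      apply (F.actEquiv l hl).symm.injective
      simp only [EquivFamily.actEquiv_symm_apply]
      rw [F.act_inv_act]
      -- The chosen representatives of `x` and `y` differ from `g` by an element of the stabilizer,
      -- and equivariance of `f` under that element removes the dependence on the choices.
      have hb : (l⁻¹ * (g * k)) • base = base := by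
        rw [mul_smul, mul_smul, hk, h, EquivFamily.inv_smul_eq hl]
      have h1 : ∀ (K : EquivFamily) (w : K.fib base),
          K.act l⁻¹ (EquivFamily.inv_smul_eq hl) (K.act g h (K.act k hk w)) =
            K.act (l⁻¹ * (g * k)) hb w := by
        intro K w
        rw [K.act_mul (g * k) l⁻¹ (by rw [mul_smul, hk, h]) (EquivFamily.inv_smul_eq hl),
          K.act_mul k g hk h]
      have h2 : v = E.act k hk (E.act k⁻¹ (EquivFamily.inv_smul_eq hk) v) :=
        (E.act_act_inv hk _ v).symm
      rw [h1 F, ← hf, ← h1 E, ← h2]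

/-- The representative chosen for the base point need not be `1`, but it lies in the stabilizer, so
conjugating `f` by it changes nothing. -/
theorem ofBase_app_base (f : E.fib base →ₗ[ℂ] F.fib base)
    (hf : ∀ (g : G) (h : g • base = base) (v : E.fib base), f (E.act g h v) = F.act g h (f v)) :
    (ofBase f hf).app base = f := by
  refine LinearMap.ext fun v => ?_
  change F.act _ _ (f (E.act _ _ v)) = _
  rw [hf, F.act_act_inv]

end Hom

/-! ### Elements of the spin group -/

theorem ι_mul_ι_swap (v w : V) : CliffordAlgebra.ι q v * CliffordAlgebra.ι q w =
    algebraMap ℂ Cl (QuadraticMap.polar q v w) - CliffordAlgebra.ι q w * CliffordAlgebra.ι q v :=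
  eq_sub_of_add_eq (CliffordAlgebra.ι_mul_ι_add_swap v w)

theorem polar_q (v w : V) : QuadraticMap.polar q v w = v.1 w.2 + w.1 v.2 := by
  simp only [QuadraticMap.polar, QuadraticForm.dualProd_apply, Prod.fst_add, Prod.snd_add,
    LinearMap.add_apply, map_add]
  ring

theorem ι_mul_self_of_unit {v : V} (hv : q v = 1) :
    CliffordAlgebra.ι q v * CliffordAlgebra.ι q v = 1 := by
  rw [CliffordAlgebra.ι_sq_scalar, hv, map_one]

/-- The product of two unit vectors, as an element of the spin group. -/
def unitMul (v w : V) (hv : q v = 1) (hw : q w = 1) : G :=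
  ⟨CliffordAlgebra.ι q v * CliffordAlgebra.ι q w, by
    have key : ∀ u : V, q u = 1 → ∃ U : Clˣ, U ∈ lipschitzGroup q ∧
        (U : Cl) = CliffordAlgebra.ι q u := fun u hu =>
      ⟨⟨_, _, ι_mul_self_of_unit hu, ι_mul_self_of_unit hu⟩,
        Subgroup.subset_closure ⟨u, rfl⟩, rfl⟩
    obtain ⟨U, hU, hUv⟩ := key v hv
    obtain ⟨U', hU', hUw⟩ := key w hw
    refine spinGroup.mem_iff.2 ⟨pinGroup.mem_iff.2 ⟨⟨U * U', mul_mem hU hU', ?_⟩, ?_⟩, ?_⟩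
    · simp [hUv, hUw]
    · have h1 := ι_mul_self_of_unit hv
      have h2 := ι_mul_self_of_unit hw
      rw [Unitary.mem_iff]
      simp only [star_mul, CliffordAlgebra.star_ι, neg_mul_neg]
      constructor
      · rw [mul_assoc, ← mul_assoc (CliffordAlgebra.ι q v), h1, one_mul, h2]
      · rw [mul_assoc, ← mul_assoc (CliffordAlgebra.ι q w), h2, one_mul, h1]
    · exact CliffordAlgebra.ι_mul_ι_mem_evenOdd_zero q v w⟩

theorem coe_unitMul (v w : V) (hv : q v = 1) (hw : q w = 1) :
    (unitMul v w hv hw : Cl) = CliffordAlgebra.ι q v * CliffordAlgebra.ι q w := rfl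

/-- Exponentials `1 + f e` of isotropic bivectors belong to the spin group. -/
theorem exists_coe_eq_one_add (x e f : V) (hx : q x = 1) (he : q e = 0) (hf : q f = 0)
    (hxe : QuadraticMap.polar q x e = 0) (hxf : QuadraticMap.polar q x f = 0)
    (hfe : QuadraticMap.polar q f e = 0) :
    ∃ g : G, (g : Cl) = 1 + CliffordAlgebra.ι q f * CliffordAlgebra.ι q e := by
  have hq : ∀ v w : V, q (v + w) = q v + q w + QuadraticMap.polar q v w := fun v w => by
    simp only [QuadraticMap.polar]; ring
  have hp : ∀ c : ℂ, QuadraticMap.polar q (c • x + (1 / 2 : ℂ) • f) e = 0 := fun c => by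
    rw [QuadraticMap.polar_add_left, QuadraticMap.polar_smul_left, QuadraticMap.polar_smul_left,
      hxe, hfe]
    simp
  have hn : ∀ c : ℂ, c * c = 1 → q (c • x + (1 / 2 : ℂ) • f) = 1 := fun c hc => by
    rw [hq, QuadraticMap.map_smul, QuadraticMap.map_smul, hx, hf, QuadraticMap.polar_smul_left,
      QuadraticMap.polar_smul_right, hxf, hc]
    simp
  have hn' : ∀ c : ℂ, c * c = 1 → q (c • x + (1 / 2 : ℂ) • f + e) = 1 := fun c hc => by
    rw [hq, hn c hc, he, hp]
    simp
  have h1 : (1 : ℂ) * 1 = 1 := by norm_num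
  have h2 : (-1 : ℂ) * (-1) = 1 := by norm_num
  -- For a unit vector `v` orthogonal to the isotropic `e`, the vector `v + e` is again unit and `v
  -- (v + e) = 1 + v e`. Taking `v = ±x + f/2`, the two factors multiply to `1 + f e`: the
  -- first-order terms add up to `f e`, and the cross term contains `e² = 0` after `e` is moved past
  -- `v`.
  refine ⟨unitMul _ _ (hn 1 h1) (hn' 1 h1) * unitMul _ _ (hn (-1) h2) (hn' (-1) h2), ?_⟩
  have hmul : ∀ c : ℂ, (hc : c * c = 1) → (unitMul _ _ (hn c hc) (hn' c hc) : Cl) =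
      1 + CliffordAlgebra.ι q (c • x + (1 / 2 : ℂ) • f) * CliffordAlgebra.ι q e := fun c hc => by
    rw [coe_unitMul, map_add _ (c • x + (1 / 2 : ℂ) • f) e, mul_add, ι_mul_self_of_unit (hn c hc)]
  change (unitMul _ _ (hn 1 h1) (hn' 1 h1) : Cl) * (unitMul _ _ (hn (-1) h2) (hn' (-1) h2) : Cl) = _
  rw [hmul 1 h1, hmul (-1) h2]
  set E := CliffordAlgebra.ι q e with hE
  set a := CliffordAlgebra.ι q ((1 : ℂ) • x + (1 / 2 : ℂ) • f) with ha
  set b := CliffordAlgebra.ι q ((-1 : ℂ) • x + (1 / 2 : ℂ) • f) with hb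
  have hab : a + b = CliffordAlgebra.ι q f := by
    rw [ha, hb, ← map_add]
    congr 1
    module
  have hEE : E * E = 0 := by rw [hE, CliffordAlgebra.ι_sq_scalar, he, map_zero]
  have hbE : b * E = -(E * b) := by
    rw [hE, hb, ι_mul_ι_swap, hp, map_zero, zero_sub]
  have h0 : a * E * (b * E) = 0 := by
    rw [hbE, mul_neg, mul_assoc, ← mul_assoc E E, hEE, zero_mul, mul_zero, neg_zero]
  have h3 : (1 + a * E) * (1 + b * E) = 1 + (a + b) * E + a * E * (b * E) := by noncomm_ring
  rw [h3, h0, hab, add_zero]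

/-- The inverse of `1 + f e` is its `star`, namely `1 + e f`. In `(1 + f e) v (1 + e f)` the
second-order term dies because `e² = f² = 0` and `f e = -e f`, and the first-order terms are
evaluated by the Clifford relation. -/
theorem vectorRep_of_coe_eq {e f : V} (he : q e = 0) (hf : q f = 0)
    (hfe : QuadraticMap.polar q f e = 0) {g : G}
    (hg : (g : Cl) = 1 + CliffordAlgebra.ι q f * CliffordAlgebra.ι q e) (v : V) :
    vectorRep g v = v + QuadraticMap.polar q e v • f - QuadraticMap.polar q f v • e := by
  have hinj : Function.Injective (CliffordAlgebra.ι q) := fun a b h => by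
    rw [← vectorPart_ι a, h, vectorPart_ι]
  apply hinj
  rw [ι_vectorRep, coe_inv_G, hg, star_add, star_one, star_mul, CliffordAlgebra.star_ι,
    CliffordAlgebra.star_ι, neg_mul_neg, map_sub, map_add, map_smul, map_smul]
  have hev := ι_mul_ι_swap e v
  have hfv := ι_mul_ι_swap f v
  have hef := ι_mul_ι_swap f e
  rw [hfe, map_zero, zero_sub] at hef
  have hee : CliffordAlgebra.ι q e * CliffordAlgebra.ι q e = 0 := by
    rw [CliffordAlgebra.ι_sq_scalar, he, map_zero]
  have hff : CliffordAlgebra.ι q f * CliffordAlgebra.ι q f = 0 := by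
    rw [CliffordAlgebra.ι_sq_scalar, hf, map_zero]
  rw [Algebra.smul_def, Algebra.smul_def]
  set E := CliffordAlgebra.ι q e
  set F := CliffordAlgebra.ι q f
  set v' := CliffordAlgebra.ι q v
  set α := algebraMap ℂ Cl (QuadraticMap.polar q e v) with hα
  set β := algebraMap ℂ Cl (QuadraticMap.polar q f v) with hβ
  have cα : ∀ y : Cl, α * y = y * α := fun y => Algebra.commutes _ y
  have cβ : ∀ y : Cl, β * y = y * β := fun y => Algebra.commutes _ y
  have h1 : F * E * v' = α * F - β * E + v' * (F * E) := by
    rw [mul_assoc, hev, mul_sub, ← cα, ← mul_assoc F, hfv, sub_mul]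
    noncomm_ring
  have h2 : F * E * v' * (E * F) = 0 := by
    rw [mul_assoc F, hev, mul_sub, sub_mul, ← cα]
    have h3 : α * F * (E * F) = 0 := by
      rw [mul_assoc, ← mul_assoc F, hef, neg_mul, mul_assoc E, hff, mul_zero, neg_zero, mul_zero]
    have h4 : F * (v' * E) * (E * F) = 0 := by
      rw [mul_assoc F, mul_assoc v', ← mul_assoc E E, hee, zero_mul, mul_zero, mul_zero]
    rw [h3, h4, sub_zero]
  have h5 : v' * (E * F) = -(v' * (F * E)) := by rw [hef, mul_neg, neg_neg]
  rw [add_mul, one_mul, mul_add, mul_one, add_mul, h2, add_zero, h1, h5]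
  noncomm_ring

/-- The coordinate functionals on `M`, a basis of `M^∨`. -/
def w (i : Fin 6) : Module.Dual ℂ M := LinearMap.proj i

/-- The standard basis of `M`. -/
def e (i : Fin 6) : M := Pi.single i 1

theorem w_apply (i : Fin 6) (m : M) : w i m = m i := rfl

theorem w_e (i j : Fin 6) : w i (e j) = if i = j then 1 else 0 := by
  rw [w_apply, e, Pi.single_apply]

theorem sum_smul_e (m : M) : ∑ i, m i • e i = m := by
  funext j
  simp [e, Finset.sum_apply, Pi.single_apply]

theorem sum_smul_w (f : Module.Dual ℂ M) : ∑ i, f (e i) • w i = f := by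
  refine LinearMap.ext fun m => ?_
  conv_rhs => rw [← sum_smul_e m]
  simp [w_apply, mul_comm]

theorem exists_ne_ne (i j : Fin 6) : ∃ k : Fin 6, k ≠ i ∧ k ≠ j := by
  revert i j; decide

/-- The element `1 + a wᵢ wⱼ` of the unipotent radical opposite to the stabilizer of the base
point. -/
theorem exists_opposite (i j : Fin 6) (a : ℂ) : ∃ g : G, (g : Cl) = 1 +
    a • (CliffordAlgebra.ι q (w i, 0) * CliffordAlgebra.ι q (w j, 0)) := by
  -- A third index supplies the unit vector `(wₖ, eₖ)`, orthogonal to both isotropic vectors.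
  obtain ⟨k, hki, hkj⟩ := exists_ne_ne i j
  obtain ⟨g, hg⟩ := exists_coe_eq_one_add (w k, e k) (w j, 0) (a • (w i, 0))
    (by simp [w_e]) (by simp) (by simp) (by simp [polar_q, w_e, hkj.symm])
    (by simp [polar_q, w_e, hki.symm]) (by simp [polar_q])
  exact ⟨g, by rw [hg, map_smul, smul_mul_assoc]⟩

/-- The element `1 + t wᵢ eⱼ`, `i ≠ j`, of the stabilizer of the base point. -/
theorem exists_levi {i j : Fin 6} (hij : i ≠ j) (t : ℂ) : ∃ g : G, ∀ v : V,
    vectorRep g v = (v.1 + (t * v.1 (e j)) • w i, v.2 - (t * v.2 i) • e j) := by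
  obtain ⟨k, hki, hkj⟩ := exists_ne_ne i j
  have h1 : q (0, e j) = 0 := by simp
  have h2 : q (t • (w i, 0)) = 0 := by simp
  have h3 : QuadraticMap.polar q (t • (w i, 0)) (0, e j) = 0 := by simp [polar_q, w_e, hij]
  obtain ⟨g, hg⟩ := exists_coe_eq_one_add (w k, e k) (0, e j) (t • (w i, 0))
    (by simp [w_e]) h1 h2 (by simp [polar_q, w_e, hkj])
    (by simp [polar_q, w_e, hki.symm]) h3
  refine ⟨g, fun v => ?_⟩
  rw [vectorRep_of_coe_eq h1 h2 h3 hg]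
  refine Prod.ext ?_ ?_
  · simp [polar_q, smul_smul, mul_comm]
  · simp [polar_q, w_apply]

/-! ### The big cell -/

/-- The element `∏ (1 + (ωᵢⱼ / 2) wᵢ wⱼ)` of the spin group. -/
def cellElt (ω : Matrix (Fin 6) (Fin 6) ℂ) : G :=
  ((Finset.univ : Finset (Fin 6 × Fin 6)).toList.map
    fun p => (exists_opposite p.1 p.2 (ω p.1 p.2 / 2)).choose).prod

theorem coe_cellElt (ω : Matrix (Fin 6) (Fin 6) ℂ) : (cellElt ω : Cl) =
    ((Finset.univ : Finset (Fin 6 × Fin 6)).toList.map fun p => (1 : Cl) + (ω p.1 p.2 / 2) •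
      (CliffordAlgebra.ι q (w p.1, 0) * CliffordAlgebra.ι q (w p.2, 0))).prod := by
  have h := map_list_prod (spinGroup q).subtype
    ((Finset.univ : Finset (Fin 6 × Fin 6)).toList.map
      fun p => (exists_opposite p.1 p.2 (ω p.1 p.2 / 2)).choose)
  rw [List.map_map] at h
  refine h.trans ?_
  congr 1
  exact List.map_congr_left fun p _ => (exists_opposite p.1 p.2 (ω p.1 p.2 / 2)).choose_spec

theorem vectorRep_opposite {i j : Fin 6} {a : ℂ} {g : G} (hg : (g : Cl) = 1 +
    a • (CliffordAlgebra.ι q (w i, 0) * CliffordAlgebra.ι q (w j, 0))) (v : V) :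
    vectorRep g v = (v.1 + a • (v.2 j • w i - v.2 i • w j), v.2) := by
  rw [vectorRep_of_coe_eq (e := (w j, 0)) (f := a • (w i, 0)) (by simp) (by simp)
    (by simp [polar_q]) (by rw [hg, map_smul, smul_mul_assoc])]
  refine Prod.ext ?_ ?_
  · simp only [polar_q, w_apply, Prod.fst_sub, Prod.fst_add, Prod.smul_fst, Prod.smul_snd,
      map_zero, add_zero, LinearMap.smul_apply, smul_zero, smul_eq_mul]
    module
  · simp

/-- The factors fix `M^∨` and move `M` only by elements of `M^∨`, so their effects add up. For skew
`ω` the ordered pairs `(i, j)` and `(j, i)` contribute equally, which absorbs the factor `1/2` in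
`cellElt`. -/
theorem vectorRep_cellElt (ω : Matrix (Fin 6) (Fin 6) ℂ) (hω : ω.transpose = -ω) (v : V) :
    vectorRep (cellElt ω) v = (v.1 + ∑ i, (ω.mulVec v.2) i • w i, v.2) := by
  have key : ∀ l : List (Fin 6 × Fin 6), vectorRep ((l.map
      fun p => (exists_opposite p.1 p.2 (ω p.1 p.2 / 2)).choose).prod) v =
      (v.1 + (l.map fun p => (ω p.1 p.2 / 2) • (v.2 p.2 • w p.1 - v.2 p.1 • w p.2)).sum, v.2) := by
    intro l
    induction l with
    | nil => simp
    | cons p l ih =>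
      rw [List.map_cons, List.prod_cons, map_mul, Module.End.mul_apply, ih,
        vectorRep_opposite (exists_opposite p.1 p.2 (ω p.1 p.2 / 2)).choose_spec]
      rw [List.map_cons, List.sum_cons]
      refine Prod.ext ?_ rfl
      simp only
      module
  rw [cellElt, key]
  refine Prod.ext ?_ rfl
  simp only [Finset.sum_map_toList]
  congr 1
  have hs : ∀ i j, ω i j = -ω j i := fun i j => by
    have := congrFun (congrFun hω j) i
    simpa using this
  simp only [smul_sub, Finset.sum_sub_distrib, Fintype.sum_prod_type]
  have h2 : ∑ i, ∑ j, (ω i j / 2) • v.2 i • w j = -∑ i, ∑ j, (ω i j / 2) • v.2 j • w i := by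
    rw [Finset.sum_comm, ← Finset.sum_neg_distrib]
    refine Finset.sum_congr rfl fun i _ => ?_
    rw [← Finset.sum_neg_distrib]
    refine Finset.sum_congr rfl fun j _ => ?_
    rw [hs j i]
    module
  rw [h2, sub_neg_eq_add, ← Finset.sum_add_distrib]
  refine Finset.sum_congr rfl fun i _ => ?_
  rw [← Finset.sum_add_distrib, Matrix.mulVec, dotProduct, Finset.sum_smul]
  refine Finset.sum_congr rfl fun j _ => ?_
  module

/-- The two blocks of the vector representation on `M`. -/
def blockB (g : G) : Matrix (Fin 6) (Fin 6) ℂ := fun i k => (vectorRep g (0, e k)).1 (e i)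

/-- The two blocks of the vector representation on `M`. -/
def blockD (g : G) : Matrix (Fin 6) (Fin 6) ℂ := fun i k => (vectorRep g (0, e k)).2 i

theorem blockB_mem (i k : Fin 6) : (fun g => blockB g i k) ∈ coordRing :=
  vectorRep_coeff_mem (LinearMap.applyₗ (e i) ∘ₗ LinearMap.fst ℂ _ _) _

theorem blockD_mem (i k : Fin 6) : (fun g => blockD g i k) ∈ coordRing :=
  vectorRep_coeff_mem (w i ∘ₗ LinearMap.snd ℂ _ _) _

theorem det_mem {Y : Type} (A : Subalgebra ℂ (Y → ℂ)) (N : Y → Matrix (Fin 6) (Fin 6) ℂ)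
    (hN : ∀ i j, (fun y => N y i j) ∈ A) : (fun y => (N y).det) ∈ A := by
  have h : (fun y => (N y).det) = ∑ σ : Equiv.Perm (Fin 6),
      algebraMap ℂ (Y → ℂ) ((Equiv.Perm.sign σ : ℤ) : ℂ) * ∏ i, fun y => N y (σ i) i := by
    funext y
    rw [Matrix.det_apply']
    simp [Finset.sum_apply, Finset.prod_apply]
  rw [h]
  exact sum_mem fun σ _ => mul_mem (A.algebraMap_mem _) (prod_mem fun i _ => hN _ _)

theorem adjugate_mem {Y : Type} (A : Subalgebra ℂ (Y → ℂ)) (N : Y → Matrix (Fin 6) (Fin 6) ℂ)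
    (hN : ∀ i j, (fun y => N y i j) ∈ A) (i j : Fin 6) :
    (fun y => (N y).adjugate i j) ∈ A := by
  simp only [Matrix.adjugate_apply]
  refine det_mem A _ fun k l => ?_
  simp only [Matrix.updateRow_apply]
  split_ifs
  · exact A.algebraMap_mem _
  · exact hN _ _

theorem vectorRep_base (g : G) (m : M) : vectorRep g (0, m) =
    (∑ i, ((blockB g).mulVec m) i • w i, (blockD g).mulVec m) := by
  have h : ((0, m) : V) = ∑ k, m k • ((0, e k) : V) := by
    refine Prod.ext ?_ ?_
    · simp [Prod.fst_sum]
    · simp only [Prod.snd_sum, Prod.smul_snd]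
      exact (sum_smul_e m).symm
  rw [h, map_sum]
  simp only [map_smul]
  refine Prod.ext ?_ ?_
  · simp only [Prod.fst_sum, Prod.smul_fst]
    rw [← sum_smul_w (∑ k, m k • (vectorRep g (0, e k)).1)]
    refine Finset.sum_congr rfl fun i _ => ?_
    congr 1
    simp [Matrix.mulVec, dotProduct, blockB, LinearMap.sum_apply, mul_comm]
  · simp only [Prod.snd_sum, Prod.smul_snd]
    funext i
    simp [Matrix.mulVec, dotProduct, blockD, Finset.sum_apply, mul_comm]

theorem q_vectorRep (g : G) (v : V) : q (vectorRep g v) = q v := by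
  have hinj : Function.Injective (algebraMap ℂ Cl) := (algebraMap ℂ Cl).injective
  apply hinj
  rw [← CliffordAlgebra.ι_sq_scalar, ι_vectorRep, ← CliffordAlgebra.ι_sq_scalar]
  have h1 : ((g⁻¹ : G) : Cl) * (g : Cl) = 1 := congrArg Subtype.val (inv_mul_cancel g)
  have h2 : (g : Cl) * ((g⁻¹ : G) : Cl) = 1 := congrArg Subtype.val (mul_inv_cancel g)
  calc (g : Cl) * CliffordAlgebra.ι q v * ((g⁻¹ : G) : Cl) *
        ((g : Cl) * CliffordAlgebra.ι q v * ((g⁻¹ : G) : Cl))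
      = (g : Cl) * CliffordAlgebra.ι q v * (((g⁻¹ : G) : Cl) * (g : Cl)) *
        CliffordAlgebra.ι q v * ((g⁻¹ : G) : Cl) := by simp only [mul_assoc]
    _ = (g : Cl) * (CliffordAlgebra.ι q v * CliffordAlgebra.ι q v) * ((g⁻¹ : G) : Cl) := by
        rw [h1, mul_one, mul_assoc (g : Cl)]
    _ = _ := by
        rw [CliffordAlgebra.ι_sq_scalar, ← Algebra.commutes, mul_assoc, h2, mul_one]

theorem polar_vectorRep (g : G) (v v' : V) :
    QuadraticMap.polar q (vectorRep g v) (vectorRep g v') = QuadraticMap.polar q v v' := by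
  simp only [QuadraticMap.polar, ← map_add, q_vectorRep]

theorem mem_smul_base (g : G) (v : V) :
    v ∈ (g • base).space ↔ ∃ m : M, vectorRep g (0, m) = v := by
  constructor
  · rintro ⟨_, ⟨m, rfl⟩, rfl⟩; exact ⟨m, rfl⟩
  · rintro ⟨m, rfl⟩; exact ⟨_, ⟨m, rfl⟩, rfl⟩

theorem vectorRep_cellElt_base (ω : Matrix (Fin 6) (Fin 6) ℂ) (hω : ω.transpose = -ω) (m : M) :
    vectorRep (cellElt ω) (0, m) = (∑ i, (ω.mulVec m) i • w i, m) := by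
  rw [vectorRep_cellElt ω hω, zero_add]

theorem sum_smul_w_injective {a b : Fin 6 → ℂ} (h : ∑ i, a i • w i = ∑ i, b i • w i) : a = b := by
  funext k
  have := LinearMap.congr_fun h (e k)
  simpa [LinearMap.sum_apply, w_e] using this

/-- A point of the cell is the graph of `ω : M → M^∨`; the subspace `g • base` consists of the pairs
`(B m, D m)`, and lying on that graph means `B = ω D`. -/
theorem blockB_eq {g : G} {ω : Matrix (Fin 6) (Fin 6) ℂ} (hω : ω.transpose = -ω)
    (h : g • base = cellElt ω • base) : blockB g = ω * blockD g := by
  have key : ∀ m, (blockB g).mulVec m = ω.mulVec ((blockD g).mulVec m) := by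
    intro m
    have hm : vectorRep g (0, m) ∈ (cellElt ω • base).space := by
      rw [← h]; exact (mem_smul_base g _).2 ⟨m, rfl⟩
    obtain ⟨m', hm'⟩ := (mem_smul_base _ _).1 hm
    rw [vectorRep_cellElt_base ω hω, vectorRep_base] at hm'
    have h2 := congrArg Prod.snd hm'
    simp only at h2
    rw [← h2]
    exact (sum_smul_w_injective (congrArg Prod.fst hm')).symm
  refine Matrix.ext_of_mulVec_single fun i => ?_
  rw [key, Matrix.mulVec_mulVec]

theorem det_blockD_ne_zero {g : G} {ω : Matrix (Fin 6) (Fin 6) ℂ} (hω : ω.transpose = -ω)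
    (h : g • base = cellElt ω • base) : (blockD g).det ≠ 0 := by
  have hs : Function.Surjective (blockD g).mulVec := by
    intro m
    have hm : vectorRep (cellElt ω) (0, m) ∈ (g • base).space := by
      rw [h]; exact (mem_smul_base _ _).2 ⟨m, rfl⟩
    obtain ⟨m', hm'⟩ := (mem_smul_base _ _).1 hm
    rw [vectorRep_cellElt_base ω hω, vectorRep_base] at hm'
    exact ⟨m', congrArg Prod.snd hm'⟩
  have := Matrix.mulVec_surjective_iff_isUnit.1 hs
  exact ((Matrix.isUnit_iff_isUnit_det _).1 this).ne_zero

/-- When `D` is invertible, `g • base` is the graph of `B D⁻¹`. Isotropy of `0 ⊕ M` is preserved by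
`g` and reads `Dᵀ B + Bᵀ D = 0`, which is skewness of `B D⁻¹`. -/
theorem exists_cell_of_det {g : G} (hg : (blockD g).det ≠ 0) :
    ∃ ω : Matrix (Fin 6) (Fin 6) ℂ, ω.transpose = -ω ∧ g • base = cellElt ω • base := by
  have hu : IsUnit (blockD g).det := hg.isUnit
  set B := blockB g with hB
  set D := blockD g with hD
  have hiso : ∀ k l, (D.transpose * B) k l + (B.transpose * D) k l = 0 := by
    intro k l
    have h := polar_vectorRep g (0, e k) (0, e l)
    rw [polar_q, polar_q] at h
    have h1 : ∀ a b : Fin 6, (vectorRep g (0, e a)).1 (vectorRep g (0, e b)).2 =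
        (B.transpose * D) a b := by
      intro a b
      rw [← sum_smul_w (vectorRep g (0, e a)).1]
      simp only [LinearMap.sum_apply, LinearMap.smul_apply, smul_eq_mul, w_apply, Matrix.mul_apply,
        Matrix.transpose_apply]
      rfl
    rw [h1, h1] at h
    simp only [LinearMap.zero_apply, add_zero] at h
    have h3 : (B.transpose * D) l k = (D.transpose * B) k l := by
      simp only [Matrix.mul_apply, Matrix.transpose_apply, mul_comm]
    rw [← h3, add_comm]
    exact h
  have hiso' : D.transpose * B + B.transpose * D = 0 := by
    ext k l; exact hiso k l
  have hDt : IsUnit D.transpose.det := by rwa [Matrix.det_transpose]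
  have hω : (B * D⁻¹).transpose = -(B * D⁻¹) := by
    rw [Matrix.transpose_mul, Matrix.transpose_nonsing_inv]
    have h1 : B.transpose = -(D.transpose * B * D⁻¹) := by
      have := eq_neg_of_add_eq_zero_right hiso'
      rw [← Matrix.neg_mul, ← this, Matrix.mul_assoc, Matrix.mul_nonsing_inv _ hu, Matrix.mul_one]
    rw [h1, Matrix.mul_neg, Matrix.mul_assoc, ← Matrix.mul_assoc _ D.transpose,
      Matrix.nonsing_inv_mul _ hDt, Matrix.one_mul]
  refine ⟨B * D⁻¹, hω, OGplus.ext_space ?_⟩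
  have hmain : ∀ m, vectorRep g (0, m) = vectorRep (cellElt (B * D⁻¹)) (0, D.mulVec m) := by
    intro m
    rw [vectorRep_base, vectorRep_cellElt_base _ hω, Matrix.mulVec_mulVec, Matrix.mul_assoc,
      Matrix.nonsing_inv_mul _ hu, Matrix.mul_one]
  ext v
  rw [mem_smul_base, mem_smul_base]
  constructor
  · rintro ⟨m, rfl⟩
    exact ⟨_, (hmain m).symm⟩
  · rintro ⟨m, rfl⟩
    refine ⟨D⁻¹.mulVec m, ?_⟩
    rw [hmain, Matrix.mulVec_mulVec, Matrix.mul_nonsing_inv _ hu, Matrix.one_mulVec]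

/-- The big cell of `X`, the orbit of the base point under the opposite unipotent radical. -/
def cell : Set OGplus :=
  {x | ∃ ω : Matrix (Fin 6) (Fin 6) ℂ, ω.transpose = -ω ∧ x = cellElt ω • base}

theorem smul_base_mem_cell (g : G) : g • base ∈ cell ↔ (blockD g).det ≠ 0 :=
  ⟨fun ⟨_, hω, h⟩ => det_blockD_ne_zero hω h, exists_cell_of_det⟩

/-- The coordinates of a point of the big cell. -/
def cellCoord (x : cell) : Matrix (Fin 6) (Fin 6) ℂ := x.2.choose

theorem cellElt_cellCoord (x : cell) : cellElt (cellCoord x) • base = x.1 :=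
  x.2.choose_spec.2.symm

/-- The chosen `ω` is forced to be `B D⁻¹`. Writing the inverse through the adjugate exhibits its
entries as regular functions with denominator `det D`, which makes the section `cellElt ∘ cellCoord`
regular. -/
theorem cellCoord_eq (g : G) (hg : g • base ∈ cell) : cellCoord ⟨g • base, hg⟩ =
    (blockD g).det⁻¹ • (blockB g * (blockD g).adjugate) := by
  have h1 := blockB_eq (g := g) hg.choose_spec.1 hg.choose_spec.2
  have h2 := (smul_base_mem_cell g).1 hg
  rw [h1, Matrix.mul_assoc, Matrix.mul_adjugate, Matrix.mul_smul, smul_smul, inv_mul_cancel₀ h2,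
    one_smul, Matrix.mul_one]
  rfl

theorem isRegularCl_cellElt : IsRegularCl coordRing (orbitMap ⁻¹' cell)
    fun g => (cellElt (cellCoord ⟨orbitMap g.1, g.2⟩) : Cl) := by
  simp only [coe_cellElt]
  refine IsRegularCl.list_prod _ fun p _ => (IsRegularCl.const 1).add (IsRegularCl.smul ?_
    (IsRegularCl.const _))
  have h : (fun g : orbitMap ⁻¹' cell => cellCoord ⟨orbitMap g.1, g.2⟩ p.1 p.2 / 2) =
      fun g : orbitMap ⁻¹' cell => ((blockD g.1).det⁻¹ * ∑ k, blockB g.1 p.1 k *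
        (blockD g.1).adjugate k p.2) * (1 / 2) := by
    funext g
    have h1 := cellCoord_eq g.1 g.2
    have h2 : cellCoord ⟨orbitMap g.1, g.2⟩ = cellCoord ⟨g.1 • base, g.2⟩ := rfl
    rw [h2, h1, Matrix.smul_apply, Matrix.mul_apply, smul_eq_mul]
    ring
  rw [h]
  refine IsRegularFor.mul (IsRegularFor.mul (IsRegularFor.inv ?_ ?_) (IsRegularFor.sum _ ?_))
    (IsRegularFor.const _)
  · exact IsRegularFor.of_mem (a := fun g => (blockD g).det) (det_mem _ _ blockD_mem)
  · exact fun g => (smul_base_mem_cell g.1).1 g.2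
  · exact fun k _ => (IsRegularFor.of_mem (blockB_mem _ _)).mul
      (IsRegularFor.of_mem (a := fun g => (blockD g).adjugate k p.2)
        (adjugate_mem _ _ blockD_mem _ _))

/-- The translates of the big cell. -/
def cellTranslate (h : G) : Set OGplus := {x | h⁻¹ • x ∈ cell}

/-- The preimage in `G` is the nonvanishing locus of the regular function `det D(h⁻¹ g)`. -/
theorem isOpenX_cellTranslate (h : G) : IsOpenX (cellTranslate h) := by
  have hmem : ∀ g : G, g ∈ orbitMap ⁻¹' cellTranslate h ↔ (blockD (h⁻¹ * g)).det ≠ 0 := by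
    intro g
    have h1 : (h⁻¹ * g) • base = h⁻¹ • orbitMap g := mul_smul _ _ _
    rw [← smul_base_mem_cell, h1, Set.mem_preimage, cellTranslate, Set.mem_ofPred_eq]
  intro g hg
  have hd := left_mul_mem_coordRing h⁻¹ _ (det_mem coordRing blockD blockD_mem)
  rw [Function.comp_def] at hd
  exact ⟨_, hd, (hmem g).1 hg, fun z hz => (hmem z).2 hz⟩

/-- The section of the orbit map over a translate of the big cell. -/
def cellSection (h : G) (x : cellTranslate h) : G := h * cellElt (cellCoord ⟨h⁻¹ • x.1, x.2⟩)

theorem cellSection_smul (h : G) (x : cellTranslate h) : cellSection h x • base = x.1 := by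
  rw [cellSection, mul_smul, cellElt_cellCoord, smul_inv_smul]

theorem isRegularCl_cellSection (h : G) : IsRegularCl coordRing (orbitMap ⁻¹' cellTranslate h)
    fun g => (cellSection h ⟨orbitMap g.1, g.2⟩ : Cl) := by
  refine (IsRegularCl.const (h : Cl)).mul ?_
  have hm : ∀ g : G, orbitMap (h⁻¹ * g) = h⁻¹ • orbitMap g := fun g => by
    rw [orbitMap_eq, orbitMap_eq, mul_smul]
  have := isRegularCl_cellElt.comp (A := coordRing) (W := orbitMap ⁻¹' cellTranslate h)
    (fun g => h⁻¹ * g) (left_mul_mem_coordRing h⁻¹)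
    (fun g hg => by
      rw [Set.mem_preimage, hm]; exact hg)
  convert this using 6 with g
  exact Subtype.ext (hm g.1).symm

theorem mem_cellTranslate_self (h : G) : h • base ∈ cellTranslate h := by
  refine ⟨0, by simp, ?_⟩
  rw [inv_smul_smul]
  refine OGplus.ext_space ?_
  ext v
  rw [mem_smul_base]
  simp only [vectorRep_cellElt_base 0 (by simp), Matrix.zero_mulVec, Pi.zero_apply, zero_smul,
    Finset.sum_const_zero]
  exact Iff.rfl

section

/-! ### Vector bundles from algebraic representations of the stabilizer -/

namespace EquivFamily

variable {E F : EquivFamily}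

/-- The stabilizer of the base point acts algebraically on a finite-dimensional fibre. -/
def IsAlgebraic (E : EquivFamily) : Prop :=
  Module.Finite ℂ (E.fib base) ∧ ∀ (φ : Module.Dual ℂ (E.fib base)) (v : E.fib base),
    ∃ a ∈ coordRing, ∀ (g : G) (h : g • base = base), φ (E.act g h v) = a g

theorem act_act {g g' : G} {x y z : OGplus} (h : g • x = y) (h' : g' • y = z) (v : E.fib x) :
    E.act g' h' (E.act g h v) = E.act (g' * g) (by rw [mul_smul, h, h']) v :=
  (E.act_mul g g' h h' _ v).symm

theorem act_congr {g g' : G} {x y : OGplus} (hg : g = g') (h : g • x = y) (v : E.fib x) :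
    E.act g h v = E.act g' (hg ▸ h) v := by
  subst hg; rfl

/-- The frame over a translate of the big cell. -/
def cellFrame {r : ℕ} (b : Module.Basis (Fin r) ℂ (E.fib base)) (h : G) : LocalFrame E r where
  dom := cellTranslate h
  isOpen := isOpenX_cellTranslate h
  basis x := b.map (E.actEquiv (cellSection h x) (cellSection_smul h x))

theorem smul_cellSection {g h h' : G} (x : cellTranslate h) (y : cellTranslate h')
    (hg : g • x.1 = y.1) : ((cellSection h' y)⁻¹ * (g * cellSection h x)) • base = base := by
  rw [mul_smul, mul_smul, cellSection_smul, hg, inv_smul_eq (cellSection_smul h' y)]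

/-- Both frames are a fixed basis of the base fibre moved by sections, so every matrix entry is a
matrix coefficient of the stabilizer element `s'(g x)⁻¹ g s(x)`. The transition functions are the
case `g = 1`. -/
theorem cellFrame_repr {r : ℕ} (b : Module.Basis (Fin r) ℂ (E.fib base)) {g h h' : G}
    (x : cellTranslate h) (y : cellTranslate h') (hg : g • x.1 = y.1) (i j : Fin r) :
    ((cellFrame b h').basis y).repr (E.act g hg ((cellFrame b h).basis x j)) i =
      b.coord i (E.act _ (smul_cellSection x y hg) (b j)) := by
  change b.repr (E.act _ _ (E.act g hg (E.act _ _ (b j)))) i = _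
  rw [act_act, act_act, E.act_congr (mul_assoc _ _ _)]
  rfl

/-- The matrix coefficients of the stabilizer extend to functions in `coordRing`, and these are
composed with stabilizer elements built regularly from the sections over translates of the big cell.
-/
theorem IsAlgebraic.isVectorBundle (hE : E.IsAlgebraic) : E.IsVectorBundle := by
  have := hE.1
  let b := Module.finBasis ℂ (E.fib base)
  refine ⟨{
    rank := _
    frames := Set.range (cellFrame b)
    cover := fun x => ?_
    transition := ?_
    action := ?_ }⟩
  · obtain ⟨g, rfl⟩ := exists_smul_base x
    exact ⟨_, ⟨g, rfl⟩, mem_cellTranslate_self g⟩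
  · rintro _ ⟨h, rfl⟩ _ ⟨h', rfl⟩ i j
    obtain ⟨a, ha, hag⟩ := hE.2 (b.coord i) (b j)
    have key : ∀ x : ((cellFrame b h).dom ∩ (cellFrame b h').dom : Set OGplus),
        ((cellFrame b h').basis ⟨x.1, x.2.2⟩).repr ((cellFrame b h).basis ⟨x.1, x.2.1⟩ j) i =
        a ((cellSection h' ⟨x.1, x.2.2⟩)⁻¹ * (1 * cellSection h ⟨x.1, x.2.1⟩)) := by
      intro x
      have h1 := cellFrame_repr b (g := 1) (h := h) (h' := h') ⟨x.1, x.2.1⟩ ⟨x.1, x.2.2⟩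
        (one_smul _ _) i j
      rw [hag, E.act_one] at h1
      exact h1
    simp only [key]
    refine IsRegularCl.coordRing_comp ?_ ha
    refine IsRegularCl.mul (IsRegularCl.map ?_ starCl) (IsRegularCl.mul (IsRegularCl.const 1) ?_)
    · exact (isRegularCl_cellSection h').comp id (fun b hb => hb) fun g hg => hg.2
    · exact (isRegularCl_cellSection h).comp id (fun b hb => hb) fun g hg => hg.1
  · rintro _ ⟨h, rfl⟩ _ ⟨h', rfl⟩ i j
    obtain ⟨a, ha, hag⟩ := hE.2 (b.coord i) (b j)
    have key : ∀ p : {p : G × OGplus | p.2 ∈ (cellFrame b h).dom ∧ p.1 • p.2 ∈ (cellFrame b h').dom},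
        ((cellFrame b h').basis ⟨p.1.1 • p.1.2, p.2.2⟩).repr
          (E.act p.1.1 rfl ((cellFrame b h).basis ⟨p.1.2, p.2.1⟩ j)) i =
        a ((cellSection h' ⟨p.1.1 • p.1.2, p.2.2⟩)⁻¹ *
          (p.1.1 * cellSection h ⟨p.1.2, p.2.1⟩)) := by
      intro p
      have h1 := cellFrame_repr b (g := p.1.1) (h := h) (h' := h') ⟨p.1.2, p.2.1⟩
        ⟨p.1.1 • p.1.2, p.2.2⟩ rfl i j
      rw [hag] at h1
      exact h1
    simp only [key]
    refine IsRegularCl.coordRing_comp ?_ ha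
    refine IsRegularCl.mul (IsRegularCl.map ?_ starCl) (IsRegularCl.mul ?_ ?_)
    · have hm : ∀ p : G × G, orbitMap (p.1 * p.2) = p.1 • orbitMap p.2 := fun p =>
        mul_smul p.1 p.2 base
      have h1 := (isRegularCl_cellSection h').comp (A := coordRingProd)
        (W := (fun p : G × G => (p.1, orbitMap p.2)) ⁻¹'
          {p | p.2 ∈ (cellFrame b h).dom ∧ p.1 • p.2 ∈ (cellFrame b h').dom})
        (fun p : G × G => p.1 * p.2) (coordRing_comp_prod mul_mem_coordRingProd)
        (fun p hp => by rw [Set.mem_preimage, hm]; exact hp.2)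
      convert h1 using 5 with p
      exact Subtype.ext (hm p.1).symm
    · exact fun φ => IsRegularFor.of_mem (fst_mem_coordRingProd φ)
    · exact (isRegularCl_cellSection h).comp (A := coordRingProd) (fun p : G × G => p.2)
        (coordRing_comp_prod snd_mem_coordRingProd) (fun p hp => hp.1)

/-- The quotient by a stable family of subspaces. -/
abbrev quot (E : EquivFamily) (N : ∀ x, Submodule ℂ (E.fib x))
    (hN : ∀ (g : G) {x y : OGplus} (h : g • x = y), ∀ v ∈ N x, E.act g h v ∈ N y) :
    EquivFamily where
  fib x := E.fib x ⧸ N x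
  act g x y h := (N x).mapQ (N y) (E.act g h) (hN g h)
  act_one h t := by
    obtain ⟨v, rfl⟩ := Submodule.mkQ_surjective _ t
    rw [Submodule.mkQ_apply, Submodule.mapQ_apply, E.act_one]
  act_mul g g' _ _ _ h h' h'' t := by
    obtain ⟨v, rfl⟩ := Submodule.mkQ_surjective _ t
    rw [Submodule.mkQ_apply, Submodule.mapQ_apply, Submodule.mapQ_apply, Submodule.mapQ_apply,
      E.act_mul g g' h h']

namespace IsAlgebraic

theorem trivial {W : Type} [AddCommGroup W] [Module ℂ W] [Module.Finite ℂ W]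
    {ρ : G →* Module.End ℂ W}
    (h : ∀ (φ : Module.Dual ℂ W) (v : W), (fun g => φ (ρ g v)) ∈ coordRing) :
    (EquivFamily.trivial ρ).IsAlgebraic :=
  ⟨inferInstance, fun φ v => ⟨_, h φ v, fun _ _ => rfl⟩⟩

theorem sub (hE : E.IsAlgebraic) {N : ∀ x, Submodule ℂ (E.fib x)}
    (hN : ∀ (g : G) {x y : OGplus} (h : g • x = y), ∀ v ∈ N x, E.act g h v ∈ N y) :
    (E.sub N hN).IsAlgebraic := by
  have := hE.1
  refine ⟨inferInstanceAs (Module.Finite ℂ (N base)), fun φ v => ?_⟩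
  obtain ⟨ψ, hψ⟩ := LinearMap.exists_extend (p := N base) φ
  obtain ⟨a, ha, hag⟩ := hE.2 ψ v.1
  refine ⟨a, ha, fun g h => ?_⟩
  rw [← hag g h, ← hψ]
  rfl

theorem quot (hE : E.IsAlgebraic) {N : ∀ x, Submodule ℂ (E.fib x)}
    (hN : ∀ (g : G) {x y : OGplus} (h : g • x = y), ∀ v ∈ N x, E.act g h v ∈ N y) :
    (E.quot N hN).IsAlgebraic := by
  have := hE.1
  refine ⟨inferInstanceAs (Module.Finite ℂ (E.fib base ⧸ N base)), fun φ v => ?_⟩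
  obtain ⟨v, rfl⟩ := Submodule.mkQ_surjective _ v
  obtain ⟨a, ha, hag⟩ := hE.2 (φ ∘ₗ (N base).mkQ) v
  exact ⟨a, ha, fun g h => hag g h⟩

theorem dual (hE : E.IsAlgebraic) : E.dual.IsAlgebraic := by
  have := hE.1
  refine ⟨inferInstanceAs (Module.Finite ℂ (Module.Dual ℂ (E.fib base))), fun φ f => ?_⟩
  obtain ⟨v, rfl⟩ := (Module.evalEquiv ℂ (E.fib base)).surjective φ
  obtain ⟨a, ha, hag⟩ := hE.2 f v
  exact ⟨_, coordRing_comp_inv ha, fun g h => hag _ _⟩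

theorem of_span {s : Set (E.fib base)} (hfin : Module.Finite ℂ (E.fib base))
    (hs : Submodule.span ℂ s = ⊤)
    (h : ∀ (φ : Module.Dual ℂ (E.fib base)), ∀ v ∈ s,
      ∃ a ∈ coordRing, ∀ (g : G) (h : g • base = base), φ (E.act g h v) = a g) :
    E.IsAlgebraic := by
  refine ⟨hfin, fun φ v => ?_⟩
  have hv : v ∈ Submodule.span ℂ s := hs ▸ Submodule.mem_top
  induction hv using Submodule.span_induction with
  | mem v hv => exact h φ v hv
  | zero => exact ⟨0, zero_mem _, fun g hg => by rw [map_zero, map_zero, Pi.zero_apply]⟩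
  | add v w _ _ hv hw =>
    obtain ⟨a, ha, hag⟩ := hv
    obtain ⟨b, hb, hbg⟩ := hw
    exact ⟨a + b, add_mem ha hb, fun g hg => by
      rw [map_add, map_add, hag, hbg, Pi.add_apply]⟩
  | smul c v _ hv =>
    obtain ⟨a, ha, hag⟩ := hv
    exact ⟨c • a, Subalgebra.smul_mem _ ha c, fun g hg => by
      rw [map_smul, map_smul, hag, Pi.smul_apply]⟩

theorem tensor (hE : E.IsAlgebraic) (hF : F.IsAlgebraic) : (E.tensor F).IsAlgebraic := by
  have := hE.1
  have := hF.1
  refine of_span (inferInstanceAs (Module.Finite ℂ (E.fib base ⊗[ℂ] F.fib base)))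
    (TensorProduct.span_tmul_eq_top ℂ (E.fib base) (F.fib base)) ?_
  rintro φ _ ⟨v, u, rfl⟩
  let b := Module.finBasis ℂ (E.fib base)
  let c := Module.finBasis ℂ (F.fib base)
  choose α hα hαg using fun k => hE.2 (b.coord k) v
  choose β hβ hβg using fun l => hF.2 (c.coord l) u
  refine ⟨∑ k, ∑ l, φ (b k ⊗ₜ c l) • (α k * β l), sum_mem fun k _ => sum_mem fun l _ =>
    Subalgebra.smul_mem _ (mul_mem (hα k) (hβ l)) _, fun g h => ?_⟩
  change φ (E.act g h v ⊗ₜ F.act g h u) = _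
  rw [← b.sum_repr (E.act g h v), ← c.sum_repr (F.act g h u), TensorProduct.sum_tmul, map_sum,
    Finset.sum_apply]
  refine Finset.sum_congr rfl fun k _ => ?_
  rw [TensorProduct.tmul_sum, map_sum, Finset.sum_apply]
  refine Finset.sum_congr rfl fun l _ => ?_
  rw [TensorProduct.smul_tmul_smul, map_smul, Pi.smul_apply, Pi.mul_apply, ← hαg k g h,
    ← hβg l g h, smul_eq_mul, smul_eq_mul, mul_comm]
  rfl

theorem ext (hE : E.IsAlgebraic) (n : ℕ) : (EquivFamily.ext n E).IsAlgebraic := by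
  have := hE.1
  refine of_span (inferInstanceAs (Module.Finite ℂ (⋀[ℂ]^n (E.fib base))))
    (exteriorPower.ιMulti_span ℂ n (E.fib base)) ?_
  rintro φ _ ⟨v, rfl⟩
  let b := Module.finBasis ℂ (E.fib base)
  choose α hα hαg using fun i k => hE.2 (b.coord k) (v i)
  refine ⟨∑ r : Fin n → Fin _, φ (exteriorPower.ιMulti ℂ n (fun i => b (r i))) • ∏ i, α i (r i),
    sum_mem fun r _ => Subalgebra.smul_mem _ (prod_mem fun i _ => hα _ _) _, fun g h => ?_⟩
  change φ (exteriorPower.map n (E.act g h) (exteriorPower.ιMulti ℂ n v)) = _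
  rw [exteriorPower.map_apply_ιMulti]
  have h1 : (⇑(E.act g h) ∘ v) = fun i => ∑ k, α i k g • b k := by
    funext i
    rw [← b.sum_repr ((⇑(E.act g h) ∘ v) i)]
    exact Finset.sum_congr rfl fun k _ => by rw [← hαg i k g h]; rfl
  rw [h1, ← AlternatingMap.coe_multilinearMap, MultilinearMap.map_sum, map_sum, Finset.sum_apply]
  refine Finset.sum_congr rfl fun r _ => ?_
  rw [MultilinearMap.map_smul_univ, map_smul, Pi.smul_apply, Finset.prod_apply, smul_eq_mul,
    smul_eq_mul, mul_comm]

end IsAlgebraic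

end EquivFamily

open EquivFamily

theorem isAlgebraic_trivialV : trivialV.IsAlgebraic :=
  IsAlgebraic.trivial vectorRep_coeff_mem

theorem isAlgebraic_tautDual : tautDual.IsAlgebraic := (isAlgebraic_trivialV.sub _).dual

theorem isAlgebraic_spinLine : spinLine.IsAlgebraic :=
  (IsAlgebraic.trivial spinRep_coeff_mem).sub _

theorem isAlgebraic_trivialHalf (i : ZMod 2) : (trivialHalf i).IsAlgebraic :=
  IsAlgebraic.trivial fun φ v => by
    obtain ⟨ψ, hψ⟩ := LinearMap.exists_extend (p := half i) φ
    convert spinRep_coeff_mem ψ v.1 using 2 with g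
    rw [← hψ]
    rfl

theorem isAlgebraic_schurDual : schurDual.IsAlgebraic :=
  (isAlgebraic_tautDual.tensor (isAlgebraic_tautDual.ext 2)).sub _

theorem IsAlgebraic.twistNeg {E : EquivFamily} (hE : E.IsAlgebraic) (n : ℕ) :
    (twistNeg E n).IsAlgebraic := by
  induction n with
  | zero => exact hE
  | succ n ih => exact ih.tensor isAlgebraic_spinLine

end

/-! ### The algebra of spinors -/

/-- Contraction of spinors with a vector of `M`. -/
def ctr : M →ₗ[ℂ] Module.End ℂ S :=
  CliffordAlgebra.contractLeft (Q := (0 : QuadraticForm ℂ (Module.Dual ℂ M))) ∘ₗ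
    Module.Dual.eval ℂ M

/-- The generators of the algebra of spinors. -/
abbrev ext1 : Module.Dual ℂ M →ₗ[ℂ] S := ExteriorAlgebra.ι ℂ

theorem cliffordMul_eq (v : V) (s : S) : cliffordMul v s = ext1 v.1 * s + ctr v.2 s := rfl

theorem cliffordMul_inl (f : Module.Dual ℂ M) (s : S) : cliffordMul (f, 0) s = ext1 f * s := by
  rw [cliffordMul_eq, map_zero, LinearMap.zero_apply, add_zero]

theorem cliffordMul_inr (m : M) (s : S) : cliffordMul (0, m) s = ctr m s := by
  rw [cliffordMul_eq, map_zero, zero_mul, zero_add]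

theorem ctr_ext1_mul (u : M) (f : Module.Dual ℂ M) (s : S) :
    ctr u (ext1 f * s) = f u • s - ext1 f * ctr u s :=
  CliffordAlgebra.contractLeft_ι_mul (Q := (0 : QuadraticForm ℂ (Module.Dual ℂ M)))
    (Module.Dual.eval ℂ M u) f s

theorem ctr_algebraMap (u : M) (c : ℂ) : ctr u (algebraMap ℂ S c) = 0 :=
  CliffordAlgebra.contractLeft_algebraMap (Q := (0 : QuadraticForm ℂ (Module.Dual ℂ M)))
    (Module.Dual.eval ℂ M u) c

theorem ctr_one (u : M) : ctr u (1 : S) = 0 :=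
  CliffordAlgebra.contractLeft_one (Q := (0 : QuadraticForm ℂ (Module.Dual ℂ M)))
    (Module.Dual.eval ℂ M u)

theorem ctr_ext1 (u : M) (f : Module.Dual ℂ M) : ctr u (ext1 f) = algebraMap ℂ S (f u) :=
  CliffordAlgebra.contractLeft_ι (Q := (0 : QuadraticForm ℂ (Module.Dual ℂ M)))
    (Module.Dual.eval ℂ M u) f

theorem ext1_swap (f g : Module.Dual ℂ M) (s : S) :
    ext1 f * (ext1 g * s) = -(ext1 g * (ext1 f * s)) := by
  rw [← mul_assoc, ← mul_assoc, ← neg_mul, eq_neg_of_add_eq_zero_left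
    (ExteriorAlgebra.ι_add_mul_swap f g)]

/-- The homogeneous spinors of degree `k`. -/
abbrev Λ (k : ℕ) : Submodule ℂ S := ⋀[ℂ]^k (Module.Dual ℂ M)

theorem ext1_mul_mem {k : ℕ} (f : Module.Dual ℂ M) {s : S} (hs : s ∈ Λ k) :
    ext1 f * s ∈ Λ (k + 1) := by
  rw [Λ, ExteriorAlgebra.exteriorPower, pow_succ']
  exact Submodule.mul_mem_mul ⟨f, rfl⟩ hs

theorem Λ_zero_eq {s : S} (hs : s ∈ Λ 0) : ∃ c : ℂ, algebraMap ℂ S c = s := by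
  rw [Λ, ExteriorAlgebra.exteriorPower, pow_zero] at hs
  exact Submodule.mem_one.1 hs

theorem one_mem_Λ : (1 : S) ∈ Λ 0 := by
  rw [Λ, ExteriorAlgebra.exteriorPower, pow_zero]
  exact Submodule.one_le.1 le_rfl

theorem Λ_succ_induction {k : ℕ} {p : S → Prop} (hadd : ∀ x y, p x → p y → p (x + y))
    (hmul : ∀ (f : Module.Dual ℂ M), ∀ s ∈ Λ k, p (ext1 f * s)) {s : S} (hs : s ∈ Λ (k + 1)) :
    p s := by
  rw [Λ, ExteriorAlgebra.exteriorPower, pow_succ'] at hs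
  refine Submodule.mul_induction_on hs ?_ hadd
  rintro _ ⟨f, rfl⟩ s hs
  exact hmul f s hs

theorem ctr_eq_zero_of_mem {s : S} (hs : s ∈ Λ 0) (u : M) : ctr u s = 0 := by
  obtain ⟨c, rfl⟩ := Λ_zero_eq hs
  exact ctr_algebraMap u c

theorem ctr_mem {k : ℕ} (u : M) {s : S} (hs : s ∈ Λ (k + 1)) : ctr u s ∈ Λ k := by
  induction k generalizing s with
  | zero =>
    refine Λ_succ_induction (p := fun s => ctr u s ∈ Λ 0)
      (fun x y hx hy => by rw [map_add]; exact add_mem hx hy) (fun f s hs => ?_) hs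
    rw [ctr_ext1_mul, ctr_eq_zero_of_mem hs, mul_zero, sub_zero]
    exact Submodule.smul_mem _ _ hs
  | succ k ih =>
    refine Λ_succ_induction (p := fun s => ctr u s ∈ Λ (k + 1))
      (fun x y hx hy => by rw [map_add]; exact add_mem hx hy) (fun f s hs => ?_) hs
    rw [ctr_ext1_mul]
    exact sub_mem (Submodule.smul_mem _ _ hs) (ext1_mul_mem f (ih hs))

theorem sum_ext1_mul (f : Module.Dual ℂ M) (s : S) :
    ∑ i, f (e i) • (ext1 (w i) * s) = ext1 f * s := by
  conv_rhs => rw [← sum_smul_w f]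
  rw [map_sum, Finset.sum_mul]
  exact Finset.sum_congr rfl fun i _ => by rw [map_smul, smul_mul_assoc]

/-- The number operator. -/
theorem sum_ext1_mul_ctr {k : ℕ} {s : S} (hs : s ∈ Λ k) :
    ∑ i, ext1 (w i) * ctr (e i) s = (k : ℂ) • s := by
  induction k generalizing s with
  | zero => simp [ctr_eq_zero_of_mem hs]
  | succ k ih =>
    refine Λ_succ_induction
      (p := fun s => ∑ i, ext1 (w i) * ctr (e i) s = ((k + 1 : ℕ) : ℂ) • s)
      (fun x y hx hy => ?_) (fun f s hs => ?_) hs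
    · simp only [map_add, mul_add, Finset.sum_add_distrib, hx, hy, smul_add]
    · have h1 : ∀ i, ext1 (w i) * ctr (e i) (ext1 f * s) =
          f (e i) • (ext1 (w i) * s) + ext1 f * (ext1 (w i) * ctr (e i) s) := fun i => by
        rw [ctr_ext1_mul, mul_sub, mul_smul_comm, ext1_swap (w i) f, sub_neg_eq_add]
      simp only [h1, Finset.sum_add_distrib, sum_ext1_mul, ← Finset.mul_sum, ih hs]
      rw [mul_smul_comm, Nat.cast_succ, add_smul, one_smul, add_comm]

/-- Contraction with `eᵢ` and multiplication by `wᵢ` anticommute to `1`, so the sum is `6` minus the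
number operator. -/
theorem sum_ctr_ext1_mul {k : ℕ} {s : S} (hs : s ∈ Λ k) :
    ∑ i, ctr (e i) (ext1 (w i) * s) = (6 - k : ℂ) • s := by
  simp only [ctr_ext1_mul, w_e, if_true, one_smul, Finset.sum_sub_distrib, sum_ext1_mul_ctr hs]
  rw [Finset.sum_const, Finset.card_univ, Fintype.card_fin, sub_smul, ← Nat.cast_smul_eq_nsmul ℂ]
  norm_num

theorem Λ_eq_bot {k : ℕ} (hk : 6 < k) : Λ k = ⊥ := by
  have h : Module.finrank ℂ (Λ k) = 0 := by
    rw [exteriorPower.finrank_eq, Subspace.dual_finrank_eq, Module.finrank_fin_fun]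
    exact Nat.choose_eq_zero_of_lt hk
  exact Submodule.finrank_eq_zero.1 h

/-! ### The invariant bilinear form -/

/-- The basis of `M^∨` formed by the coordinate functionals. -/
def wBasis : Module.Basis (Fin 6) ℂ (Module.Dual ℂ M) := (Pi.basisFun ℂ (Fin 6)).dualBasis

/-- The coefficient of the volume form. -/
def top : S →ₗ[ℂ] ℂ := ExteriorAlgebra.liftAlternating fun i =>
  match i with
  | 6 => wBasis.det
  | _ => 0

theorem top_eq_zero {k : ℕ} (hk : k ≠ 6) {s : S} (hs : s ∈ Λ k) : top s = 0 := by
  rw [Λ, ← ExteriorAlgebra.ιMulti_span_fixedDegree] at hs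
  induction hs using Submodule.span_induction with
  | mem x hx =>
    obtain ⟨v, rfl⟩ := hx
    rw [top, ExteriorAlgebra.liftAlternating_apply_ιMulti]
    split
    · exact absurd rfl hk
    · rfl
  | zero => exact map_zero _
  | add x y _ _ hx hy => rw [map_add, hx, hy, add_zero]
  | smul c x _ hx => rw [map_smul, hx, smul_zero]

theorem exists_top_eq_one : ∃ s ∈ Λ 6, top s = 1 := by
  refine ⟨ExteriorAlgebra.ιMulti ℂ 6 wBasis, ExteriorAlgebra.ιMulti_range ℂ 6 ⟨_, rfl⟩, ?_⟩
  rw [top, ExteriorAlgebra.liftAlternating_apply_ιMulti]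
  exact wBasis.det_self

/-- Linear properties of spinors can be checked on homogeneous spinors. -/
theorem S_induction {p : S → Prop} (h : ∀ k, ∀ s ∈ Λ k, p s) (h0 : p 0)
    (hadd : ∀ x y, p x → p y → p (x + y)) (s : S) : p s :=
  DirectSum.Decomposition.inductionOn (fun n => ⋀[ℂ]^n (Module.Dual ℂ M)) h0
    (fun {i} m => h i m.1 m.2) hadd s

/-- Contraction lowers the degree by one, so a term of degree six would have to come from degree
seven, where there is nothing. -/
theorem top_ctr (u : M) (s : S) : top (ctr u s) = 0 := by
  refine S_induction (p := fun s => top (ctr u s) = 0) (fun k s hs => ?_) (by simp)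
    (fun x y hx hy => by rw [map_add, map_add, hx, hy, add_zero]) s
  cases k with
  | zero => rw [ctr_eq_zero_of_mem hs, map_zero]
  | succ k =>
    by_cases hk : k = 6
    · subst hk
      rw [Λ_eq_bot (by norm_num), Submodule.mem_bot] at hs
      rw [hs, map_zero, map_zero]
    · exact top_eq_zero hk (ctr_mem u hs)

/-- The bilinear form `(s, t) ↦ top (sᵀ ∧ t)` on spinors. -/
def spinForm : S →ₗ[ℂ] S →ₗ[ℂ] ℂ :=
  (LinearMap.mul ℂ S).compr₂ top ∘ₗ
    CliffordAlgebra.reverse (Q := (0 : QuadraticForm ℂ (Module.Dual ℂ M)))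

/-- The main anti-involution of the algebra of spinors. -/
abbrev rev : S →ₗ[ℂ] S := CliffordAlgebra.reverse (Q := (0 : QuadraticForm ℂ (Module.Dual ℂ M)))

theorem spinForm_apply (s t : S) : spinForm s t = top (rev s * t) := rfl

theorem rev_ext1_mul (f : Module.Dual ℂ M) (s : S) : rev (ext1 f * s) = rev s * ext1 f := by
  change CliffordAlgebra.reverse (CliffordAlgebra.ι _ f * s) = _
  rw [CliffordAlgebra.reverse.map_mul, CliffordAlgebra.reverse_ι]

theorem rev_algebraMap (c : ℂ) : rev (algebraMap ℂ S c) = algebraMap ℂ S c :=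
  CliffordAlgebra.reverse.commutes c

theorem spinForm_ext1 (f : Module.Dual ℂ M) (s t : S) :
    spinForm (ext1 f * s) t = spinForm s (ext1 f * t) := by
  rw [spinForm_apply, spinForm_apply, rev_ext1_mul, mul_assoc]

/-- Induction on the number of covectors in `s`: moving one across the form produces the same
Leibniz terms on both sides, and for scalar `s` both sides vanish because `top` kills contractions.
-/
theorem spinForm_ctr (u : M) (s t : S) : spinForm (ctr u s) t = spinForm s (ctr u t) := by
  induction s using CliffordAlgebra.left_induction generalizing t with
  | algebraMap c =>
    have h1 : ctr u (algebraMap ℂ S c) = 0 := ctr_algebraMap u c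
    have h2 : spinForm (algebraMap ℂ S c) (ctr u t) = 0 := by
      rw [spinForm_apply, rev_algebraMap, ← Algebra.smul_def, map_smul, top_ctr, smul_zero]
    exact (congrArg (fun x => spinForm x t) h1).trans
      ((LinearMap.map_zero₂ _ _).trans h2.symm)
  | add x y hx hy => rw [map_add, map_add, map_add, LinearMap.add_apply, LinearMap.add_apply, hx, hy]
  | ι_mul x f hx =>
    change spinForm (ctr u (ext1 f * x)) t = spinForm (ext1 f * x) (ctr u t)
    rw [ctr_ext1_mul, map_sub, map_smul, LinearMap.sub_apply, LinearMap.smul_apply,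
      spinForm_ext1, spinForm_ext1, hx, ctr_ext1_mul, map_sub, map_smul, sub_sub_cancel]

theorem spinForm_cliffordMul (v : V) (s t : S) :
    spinForm (cliffordMul v s) t = spinForm s (cliffordMul v t) := by
  rw [cliffordMul_eq, cliffordMul_eq, map_add, map_add, LinearMap.add_apply, spinForm_ext1,
    spinForm_ctr]

theorem spinForm_spinAction (x : Cl) (s t : S) :
    spinForm (spinAction x s) t = spinForm s (spinAction (CliffordAlgebra.reverse x) t) := by
  induction x using CliffordAlgebra.left_induction generalizing s t with
  | algebraMap c =>
    rw [CliffordAlgebra.reverse.commutes, AlgHom.commutes, Module.algebraMap_end_apply,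
      Module.algebraMap_end_apply, map_smul, map_smul, LinearMap.smul_apply]
  | add x y hx hy =>
    simp only [map_add, LinearMap.add_apply, hx, hy]
  | ι_mul x v hx =>
    rw [CliffordAlgebra.reverse.map_mul, CliffordAlgebra.reverse_ι, map_mul, map_mul,
      Module.End.mul_apply, Module.End.mul_apply, spinAction_ι, spinForm_cliffordMul, hx]

/-- Vectors are self-adjoint for `spinForm`, so the adjoint of `g` is its reverse. For even elements
the reverse is `star`, the inverse of `g`. -/
theorem spinForm_spinRep (g : G) (s t : S) :
    spinForm (spinRep g s) (spinRep g t) = spinForm s t := by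
  change spinForm (spinAction (g : Cl) s) (spinAction (g : Cl) t) = _
  rw [spinForm_spinAction, ← Module.End.mul_apply, ← map_mul]
  have h1 : CliffordAlgebra.reverse (g : Cl) = star (g : Cl) := by
    rw [CliffordAlgebra.star_def, spinGroup.involute_eq g.2]
  rw [h1, spinGroup.star_mul_self_of_mem g.2, map_one, Module.End.one_apply]

theorem rev_rev (s : S) : rev (rev s) = s := CliffordAlgebra.reverse_reverse s

theorem mul_mem_Λ {j k : ℕ} {s t : S} (hs : s ∈ Λ j) (ht : t ∈ Λ k) : s * t ∈ Λ (j + k) :=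
  SetLike.mul_mem_graded (A := fun n => ⋀[ℂ]^n (Module.Dual ℂ M)) hs ht

/-- Contractions of an element of the radical stay in the radical, so by induction on the degree
they vanish; the number operator then gives `(k + 1) • s = 0`. Scalars are detected by the volume
form. -/
theorem eq_zero_of_spinForm_mem {k : ℕ} {s : S} (hs : s ∈ Λ k)
    (h : ∀ t, spinForm t s = 0) : s = 0 := by
  induction k generalizing s with
  | zero =>
    obtain ⟨c, rfl⟩ := Λ_zero_eq hs
    obtain ⟨t, -, ht⟩ := exists_top_eq_one
    have h1 := h (rev t)
    rw [spinForm_apply, rev_rev, ← Algebra.commutes, ← Algebra.smul_def, map_smul, ht, smul_eq_mul,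
      mul_one] at h1
    rw [h1, map_zero]
  | succ k ih =>
    have h1 : ∀ u, ctr u s = 0 := fun u =>
      ih (ctr_mem u hs) fun t => by rw [← spinForm_ctr, h]
    have h2 := sum_ext1_mul_ctr hs
    simp only [h1, mul_zero, Finset.sum_const_zero] at h2
    exact (smul_eq_zero.1 h2.symm).resolve_left (Nat.cast_ne_zero.2 (Nat.succ_ne_zero k))

/-- Non-degeneracy of the wedge pairing between complementary degrees. -/
theorem eq_zero_of_top_mul {j k : ℕ} (hjk : j + k = 6) {s : S} (hs : s ∈ Λ k)
    (h : ∀ t ∈ Λ j, top (t * s) = 0) : s = 0 := by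
  refine eq_zero_of_spinForm_mem hs fun t => ?_
  rw [spinForm_apply]
  refine S_induction (p := fun t => top (t * s) = 0) (fun i t ht => ?_) (by simp)
    (fun x y hx hy => by rw [add_mul, map_add, hx, hy, add_zero]) (rev t)
  by_cases hi : i = j
  · subst hi; exact h t ht
  · exact top_eq_zero (by omega) (mul_mem_Λ ht hs)

/-- The homogeneous components of a spinor. -/
def cmp (k : ℕ) : S →ₗ[ℂ] S := GradedAlgebra.proj (fun n => ⋀[ℂ]^n (Module.Dual ℂ M)) k

theorem cmp_mem (k : ℕ) (s : S) : cmp k s ∈ Λ k := by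
  rw [cmp, GradedAlgebra.proj_apply]
  exact SetLike.coe_mem _

theorem cmp_of_mem {k : ℕ} {s : S} (hs : s ∈ Λ k) : cmp k s = s :=
  DirectSum.decompose_of_mem_same _ hs

theorem cmp_of_mem_ne {j k : ℕ} (hjk : j ≠ k) {s : S} (hs : s ∈ Λ j) : cmp k s = 0 :=
  DirectSum.decompose_of_mem_ne _ hs hjk

theorem sum_cmp (s : S) : ∑ k ∈ Finset.range 7, cmp k s = s := by
  refine S_induction (p := fun s => ∑ k ∈ Finset.range 7, cmp k s = s) (fun k s hs => ?_) (by simp)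
    (fun x y hx hy => by simp only [map_add, Finset.sum_add_distrib, hx, hy]) s
  by_cases hk : k < 7
  · rw [Finset.sum_eq_single_of_mem k (Finset.mem_range.2 hk)
      fun j _ hj => cmp_of_mem_ne (Ne.symm hj) hs, cmp_of_mem hs]
  · rw [Λ_eq_bot (by omega), Submodule.mem_bot] at hs
    simp [hs]

theorem ctr_cmp_succ (u : M) (k : ℕ) (s : S) : ctr u (cmp (k + 1) s) = cmp k (ctr u s) := by
  refine S_induction (p := fun s => ctr u (cmp (k + 1) s) = cmp k (ctr u s)) (fun j s hs => ?_)
    (by simp) (fun x y hx hy => by simp only [map_add, hx, hy]) s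
  cases j with
  | zero => rw [ctr_eq_zero_of_mem hs, cmp_of_mem_ne (by omega) hs, map_zero, map_zero]
  | succ j =>
    by_cases h : j = k
    · subst h; rw [cmp_of_mem hs, cmp_of_mem (ctr_mem u hs)]
    · rw [cmp_of_mem_ne (by omega) hs, cmp_of_mem_ne h (ctr_mem u hs), map_zero]

/-- Spinors killed by all contractions are scalars. -/
theorem mem_Λ_zero_of_ctr {s : S} (h : ∀ u, ctr u s = 0) : s ∈ Λ 0 := by
  have h1 : ∀ k, cmp (k + 1) s = 0 := fun k => by
    have h2 := sum_ext1_mul_ctr (cmp_mem (k + 1) s)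
    simp only [ctr_cmp_succ, h, map_zero, mul_zero, Finset.sum_const_zero] at h2
    exact (smul_eq_zero.1 h2.symm).resolve_left (Nat.cast_ne_zero.2 (Nat.succ_ne_zero k))
  rw [← sum_cmp s, Finset.sum_range_succ', Finset.sum_eq_zero fun k _ => h1 k, zero_add]
  exact cmp_mem 0 s

theorem top_mul_cmp {j k : ℕ} (hjk : j + k = 6) {t : S} (ht : t ∈ Λ j) (s : S) :
    top (t * cmp k s) = top (t * s) := by
  refine S_induction (p := fun s => top (t * cmp k s) = top (t * s)) (fun i s hs => ?_)
    (by simp) (fun x y hx hy => by simp only [map_add, mul_add, hx, hy]) s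
  by_cases h : i = k
  · subst h; rw [cmp_of_mem hs]
  · rw [cmp_of_mem_ne h hs, mul_zero, map_zero, top_eq_zero (by omega) (mul_mem_Λ ht hs)]

theorem cmp_eq_zero_of_top_mul {j k : ℕ} (hjk : j + k = 6) {s : S}
    (h : ∀ t ∈ Λ j, top (t * s) = 0) : cmp k s = 0 :=
  eq_zero_of_top_mul hjk (cmp_mem k s) fun t ht => by rw [top_mul_cmp hjk ht, h t ht]

/-! ### Half-spinors -/

theorem Λ_le_half (k : ℕ) {s : S} (hs : s ∈ Λ k) : s ∈ half k :=
  (le_iSup (fun j : {n : ℕ // (n : ZMod 2) = k} => LinearMap.range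
    (CliffordAlgebra.ι (0 : QuadraticForm ℂ (Module.Dual ℂ M))) ^ (j : ℕ)) ⟨k, rfl⟩) hs

theorem cmp_eq_zero_of_half {i : ZMod 2} {k : ℕ} (hk : (k : ZMod 2) ≠ i) {s : S}
    (hs : s ∈ half i) : cmp k s = 0 := by
  induction hs using Submodule.iSup_induction' with
  | mem j x hx => exact cmp_of_mem_ne (fun h => hk (by rw [← h]; exact j.2)) hx
  | zero => exact map_zero _
  | add x y _ _ hx hy => rw [map_add, hx, hy, add_zero]

theorem eq_of_half_zero {s : S} (hs : s ∈ half 0) : s = cmp 0 s + cmp 2 s + cmp 4 s + cmp 6 s := by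
  have h : ∀ k : ℕ, (k : ZMod 2) ≠ 0 → cmp k s = 0 := fun k hk => cmp_eq_zero_of_half hk hs
  conv_lhs => rw [← sum_cmp s]
  simp only [Finset.sum_range_succ, Finset.sum_range_zero, h 1 (by decide), h 3 (by decide),
    h 5 (by decide)]
  simp only [zero_add, add_zero]

theorem rev_mem_half {i : ZMod 2} {s : S} (hs : s ∈ half i) : rev s ∈ half i :=
  (CliffordAlgebra.reverse_mem_evenOdd_iff _).2 hs

/-- The invariant form on `S⁺`. -/
def halfForm : LinearMap.BilinForm ℂ (half 0) :=
  spinForm.compl₁₂ (half 0).subtype (half 0).subtype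

theorem halfForm_apply (s t : half 0) : halfForm s t = spinForm s t := rfl

theorem eq_zero_of_halfForm {s : half 0} (h : ∀ t, halfForm t s = 0) : s = 0 := by
  have h1 : ∀ j k : ℕ, j + k = 6 → (j : ZMod 2) = 0 → cmp k (s : S) = 0 := by
    intro j k hjk hj
    refine cmp_eq_zero_of_top_mul hjk fun t ht => ?_
    have ht0 : t ∈ half 0 := by have := Λ_le_half j ht; rwa [hj] at this
    have h2 := h ⟨rev t, rev_mem_half ht0⟩
    rw [halfForm_apply, spinForm_apply, rev_rev] at h2
    exact h2
  refine Subtype.ext ?_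
  rw [eq_of_half_zero s.2, h1 6 0 rfl (by decide), h1 4 2 rfl (by decide), h1 2 4 rfl (by decide),
    h1 0 6 rfl (by decide)]
  simp

theorem isInvariantForm_halfForm : IsInvariantForm halfForm := by
  refine ⟨?_, fun g s t => spinForm_spinRep g s t⟩
  -- `eq_zero_of_halfForm` concerns the second argument of the form, so the kernel criterion is
  -- applied to the flipped form.
  have h1 : LinearMap.ker (LinearMap.flip halfForm) = ⊥ := by
    rw [LinearMap.ker_eq_bot']
    intro s hs
    exact eq_zero_of_halfForm fun t => LinearMap.congr_fun hs t
  have h2 := (LinearMap.BilinForm.nondegenerate_iff_ker_eq_bot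
    (B := (LinearMap.flip halfForm : LinearMap.BilinForm ℂ (half 0)))).2 h1
  exact ⟨LinearMap.flip_separatingRight.1 h2.2, LinearMap.flip_separatingLeft.1 h2.1⟩

/-! ### Pure spinors of the base point -/

/-- Vectors of `0 ⊕ M` act on spinors by contraction, and only scalars are killed by all
contractions. -/
theorem mem_pureSpinors_base (s : S) : s ∈ pureSpinors base.space ↔ s ∈ Λ 0 := by
  constructor
  · intro h
    refine mem_Λ_zero_of_ctr fun u => ?_
    rw [← cliffordMul_inr]
    exact h (0, u) ⟨u, rfl⟩
  · rintro hs _ ⟨u, rfl⟩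
    exact (cliffordMul_inr u s).trans (ctr_eq_zero_of_mem hs u)

theorem pureSpinors_le_half (x : OGplus) {s : S} (hs : s ∈ pureSpinors x.space) : s ∈ half 0 := by
  obtain ⟨g, hg⟩ := exists_smul_base x
  have h1 : spinRep g⁻¹ s ∈ pureSpinors base.space :=
    (spinLine.act g⁻¹ (EquivFamily.inv_smul_eq hg) ⟨s, hs⟩).2
  have h2 : spinRep g (spinRep g⁻¹ s) = s := by
    rw [← Module.End.mul_apply, ← map_mul, mul_inv_cancel, map_one, Module.End.one_apply]
  rw [← h2]
  have h3 := Λ_le_half 0 ((mem_pureSpinors_base _).1 h1)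
  rw [Nat.cast_zero] at h3
  exact spinAction_mem_half g.2.2 0 h3

section

open EquivFamily

/-! ### Multilinear algebra in degrees two and three -/

section Multilinear

variable {E F H : Type} [AddCommGroup E] [Module ℂ E] [AddCommGroup F] [Module ℂ F]
  [AddCommGroup H] [Module ℂ H]

theorem sum_perm_fin_three {F : Type} [AddCommGroup F] (f : Fin 3 → Fin 3 → Fin 3 → F) :
    ∑ σ : Equiv.Perm (Fin 3), (Equiv.Perm.sign σ : ℤ) • f (σ 0) (σ 1) (σ 2) =
      f 0 1 2 - f 0 2 1 - f 1 0 2 + f 1 2 0 + f 2 0 1 - f 2 1 0 := by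
  have h : (Finset.univ : Finset (Equiv.Perm (Fin 3))) =
      {1, Equiv.swap 1 2, Equiv.swap 0 1, Equiv.swap 0 1 * Equiv.swap 1 2,
        Equiv.swap 1 2 * Equiv.swap 0 1, Equiv.swap 0 2} := by decide
  rw [h]
  iterate 5 rw [Finset.sum_insert (by decide)]
  rw [Finset.sum_singleton]
  have s1 : (Equiv.Perm.sign (Equiv.swap (1 : Fin 3) 2) : ℤ) = -1 := by decide
  have s2 : (Equiv.Perm.sign (Equiv.swap (0 : Fin 3) 1) : ℤ) = -1 := by decide
  have s3 : (Equiv.Perm.sign (Equiv.swap (0 : Fin 3) 1 * Equiv.swap 1 2) : ℤ) = 1 := by decide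
  have s4 : (Equiv.Perm.sign (Equiv.swap (1 : Fin 3) 2 * Equiv.swap 0 1) : ℤ) = 1 := by decide
  have s5 : (Equiv.Perm.sign (Equiv.swap (0 : Fin 3) 2) : ℤ) = -1 := by decide
  have s0 : (Equiv.Perm.sign (1 : Equiv.Perm (Fin 3)) : ℤ) = 1 := by decide
  rw [s0, s1, s2, s3, s4, s5]
  simp only [one_smul, neg_smul]
  change f 0 1 2 + (-f 0 2 1 + (-f 1 0 2 + (f 1 2 0 + (f 2 0 1 + -f 2 1 0)))) = _
  abel

/-- The multilinear map of a trilinear map. -/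
def multilin3 (f : E →ₗ[ℂ] E →ₗ[ℂ] E →ₗ[ℂ] F) : MultilinearMap ℂ (fun _ : Fin 3 => E) F where
  toFun v := f (v 0) (v 1) (v 2)
  map_update_add' := @fun inst v i x y => by
    obtain rfl : inst = instDecidableEqFin 3 := Subsingleton.elim _ _
    obtain rfl | rfl | rfl := (by decide : ∀ i : Fin 3, i = 0 ∨ i = 1 ∨ i = 2) i <;> simp
  map_update_smul' := @fun inst v i c x => by
    obtain rfl : inst = instDecidableEqFin 3 := Subsingleton.elim _ _
    obtain rfl | rfl | rfl := (by decide : ∀ i : Fin 3, i = 0 ∨ i = 1 ∨ i = 2) i <;> simp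

/-- The antisymmetrization of a trilinear map, as a linear map on trivectors. -/
def alt3 (f : E →ₗ[ℂ] E →ₗ[ℂ] E →ₗ[ℂ] F) : ⋀[ℂ]^3 E →ₗ[ℂ] F :=
  exteriorPower.alternatingMapLinearEquiv (MultilinearMap.alternatization (multilin3 f))

theorem alt3_ιMulti (f : E →ₗ[ℂ] E →ₗ[ℂ] E →ₗ[ℂ] F) (v : Fin 3 → E) :
    alt3 f (exteriorPower.ιMulti ℂ 3 v) =
      f (v 0) (v 1) (v 2) - f (v 0) (v 2) (v 1) - f (v 1) (v 0) (v 2) + f (v 1) (v 2) (v 0) +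
        f (v 2) (v 0) (v 1) - f (v 2) (v 1) (v 0) := by
  rw [alt3, exteriorPower.alternatingMapLinearEquiv_apply_ιMulti,
    MultilinearMap.alternatization_apply]
  exact sum_perm_fin_three fun i j k => f (v i) (v j) (v k)

theorem update_pair {E : Type} (a b c : E) : Function.update ![a, b] 1 c = ![a, c] := by
  ext i
  fin_cases i <;> rfl

/-- The exterior product of two vectors. -/
def wedge2 : E →ₗ[ℂ] E →ₗ[ℂ] ⋀[ℂ]^2 E :=
  LinearMap.mk₂ ℂ (fun a b => exteriorPower.ιMulti ℂ 2 ![a, b])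
    (fun a a' b => (exteriorPower.ιMulti ℂ 2).map_vecCons_add ![b] a a')
    (fun c a b => (exteriorPower.ιMulti ℂ 2).map_vecCons_smul ![b] c a)
    (fun a b b' => by
      have h := (exteriorPower.ιMulti ℂ 2).map_update_add ![a, 0] 1 b b'
      rwa [update_pair, update_pair, update_pair] at h)
    (fun c a b => by
      have h := (exteriorPower.ιMulti ℂ 2).map_update_smul ![a, 0] 1 c b
      rwa [update_pair, update_pair] at h)

theorem wedge2_apply (a b : E) : wedge2 a b = exteriorPower.ιMulti ℂ 2 ![a, b] := rfl

theorem wedge2_swap (a b : E) : wedge2 a b = -wedge2 b a := by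
  have h := (exteriorPower.ιMulti ℂ 2).map_swap ![b, a] (i := 0) (j := 1) (by decide)
  rw [wedge2_apply, wedge2_apply, ← h]
  congr 1
  ext i
  fin_cases i <;> rfl

theorem wedge2_self (a : E) : wedge2 a a = 0 :=
  (exteriorPower.ιMulti ℂ 2).map_eq_zero_of_eq ![a, a] (i := 0) (j := 1) rfl (by decide)

theorem map_wedge2 (f : E →ₗ[ℂ] F) (a b : E) :
    exteriorPower.map 2 f (wedge2 a b) = wedge2 (f a) (f b) := by
  rw [wedge2_apply, exteriorPower.map_apply_ιMulti, wedge2_apply]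
  congr 1
  ext i
  fin_cases i <;> rfl

theorem bivector_induction {p : ⋀[ℂ]^2 E → Prop} (h0 : p 0) (hadd : ∀ x y, p x → p y → p (x + y))
    (h : ∀ a b, p (wedge2 a b)) (t : ⋀[ℂ]^2 E) : p t := by
  have ht : t ∈ Submodule.span ℂ (Set.range (exteriorPower.ιMulti ℂ 2 (M := E))) := by
    rw [exteriorPower.ιMulti_span]; trivial
  induction ht using Submodule.closure_induction with
  | zero => exact h0
  | add x y _ _ hx hy => exact hadd x y hx hy
  | smul_mem c x hx =>
    obtain ⟨v, rfl⟩ := hx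
    have h1 : c • exteriorPower.ιMulti ℂ 2 v = wedge2 (c • v 0) (v 1) := by
      rw [map_smul, LinearMap.smul_apply, wedge2_apply]
      congr 2
      ext i
      fin_cases i <;> rfl
    rw [h1]
    exact h _ _

/-- The exterior product of three vectors. -/
abbrev wedge3 (a b c : E) : ⋀[ℂ]^3 E := exteriorPower.ιMulti ℂ 3 ![a, b, c]

theorem trivector_induction {p : ⋀[ℂ]^3 E → Prop} (h0 : p 0)
    (hadd : ∀ x y, p x → p y → p (x + y)) (h : ∀ a b c, p (wedge3 a b c)) (t : ⋀[ℂ]^3 E) : p t := by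
  have ht : t ∈ Submodule.span ℂ (Set.range (exteriorPower.ιMulti ℂ 3 (M := E))) := by
    rw [exteriorPower.ιMulti_span]; trivial
  induction ht using Submodule.closure_induction with
  | zero => exact h0
  | add x y _ _ hx hy => exact hadd x y hx hy
  | smul_mem c x hx =>
    obtain ⟨v, rfl⟩ := hx
    have h1 : c • exteriorPower.ιMulti ℂ 3 v = wedge3 (c • v 0) (v 1) (v 2) := by
      rw [wedge3, AlternatingMap.map_vecCons_smul]
      congr 2
      ext i
      fin_cases i <;> rfl
    rw [h1]
    exact h _ _ _

theorem map_wedge3 (f : E →ₗ[ℂ] F) (a b c : E) :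
    exteriorPower.map 3 f (wedge3 a b c) = wedge3 (f a) (f b) (f c) := by
  rw [wedge3, exteriorPower.map_apply_ιMulti]
  congr 1
  ext i
  fin_cases i <;> rfl

theorem coe_wedge2 (a b : E) : ((wedge2 a b : ⋀[ℂ]^2 E) : ExteriorAlgebra ℂ E) =
    ExteriorAlgebra.ι ℂ a * ExteriorAlgebra.ι ℂ b := by
  rw [wedge2_apply, exteriorPower.ιMulti_apply_coe, ExteriorAlgebra.ιMulti_apply]
  simp

theorem coe_wedge3 (a b c : E) : ((wedge3 a b c : ⋀[ℂ]^3 E) : ExteriorAlgebra ℂ E) =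
    ExteriorAlgebra.ι ℂ a * (ExteriorAlgebra.ι ℂ b * ExteriorAlgebra.ι ℂ c) := by
  rw [wedge3, exteriorPower.ιMulti_apply_coe, ExteriorAlgebra.ιMulti_apply]
  simp

/-- The exterior product `E ⊗ ∧²E → ∧³E`. -/
def wedgeMul : E ⊗[ℂ] (⋀[ℂ]^2 E) →ₗ[ℂ] ⋀[ℂ]^3 E :=
  (wedge E).codRestrict (⋀[ℂ]^3 E) fun t => by
    induction t with
    | zero => rw [map_zero]; exact zero_mem _
    | add x y hx hy => rw [map_add]; exact add_mem hx hy
    | tmul a b =>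
      rw [ExteriorAlgebra.exteriorPower, pow_succ']
      exact Submodule.mul_mem_mul (LinearMap.mem_range_self _ a) b.2

theorem coe_wedgeMul (t : E ⊗[ℂ] (⋀[ℂ]^2 E)) :
    (wedgeMul t : ExteriorAlgebra ℂ E) = wedge E t := rfl

theorem wedgeMul_tmul_wedge2 (a b c : E) : wedgeMul (a ⊗ₜ[ℂ] wedge2 b c) = wedge3 a b c := by
  refine Subtype.ext ?_
  rw [coe_wedgeMul, coe_wedge3, ← coe_wedge2]
  rfl

theorem wedgeMul_eq_zero_iff (t : E ⊗[ℂ] (⋀[ℂ]^2 E)) : wedgeMul t = 0 ↔ wedge E t = 0 := by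
  rw [← coe_wedgeMul, Submodule.coe_eq_zero]

/-- The polarization `∧³E → E ⊗ ∧²E`. -/
def polarize : ⋀[ℂ]^3 E →ₗ[ℂ] E ⊗[ℂ] (⋀[ℂ]^2 E) :=
  (1 / 2 : ℂ) • alt3 (LinearMap.mk₂ ℂ (fun a b => TensorProduct.mk ℂ E (⋀[ℂ]^2 E) a ∘ₗ wedge2 b)
    (fun a a' b => by ext; simp)
    (fun c a b => by ext; simp [TensorProduct.smul_tmul'])
    (fun a b b' => by ext; simp [TensorProduct.tmul_add])
    (fun c a b => by ext; simp))

/-- The six terms of the antisymmetrization coincide in pairs by skewness of `wedge2`; the `1/2` in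
`polarize` leaves one of each cyclic pair. -/
theorem polarize_wedge3 (a b c : E) : polarize (wedge3 a b c) =
    a ⊗ₜ[ℂ] wedge2 b c + b ⊗ₜ[ℂ] wedge2 c a + c ⊗ₜ[ℂ] wedge2 a b := by
  rw [polarize, LinearMap.smul_apply, alt3_ιMulti]
  simp only [LinearMap.mk₂_apply, LinearMap.comp_apply, TensorProduct.mk_apply]
  change (1 / 2 : ℂ) • (a ⊗ₜ[ℂ] wedge2 b c - a ⊗ₜ[ℂ] wedge2 c b - b ⊗ₜ[ℂ] wedge2 a c +
    b ⊗ₜ[ℂ] wedge2 c a + c ⊗ₜ[ℂ] wedge2 a b - c ⊗ₜ[ℂ] wedge2 b a) = _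
  rw [wedge2_swap c b, wedge2_swap a c, wedge2_swap b a]
  simp only [TensorProduct.tmul_neg]
  module

theorem polarize_map (f : E →ₗ[ℂ] F) (t : ⋀[ℂ]^3 E) : polarize (exteriorPower.map 3 f t) =
    TensorProduct.map f (exteriorPower.map 2 f) (polarize t) := by
  refine trivector_induction (p := fun t => polarize (exteriorPower.map 3 f t) =
    TensorProduct.map f (exteriorPower.map 2 f) (polarize t)) (by simp)
    (fun x y hx hy => by simp only [map_add, hx, hy]) (fun a b c => ?_) t
  simp only [map_wedge3, polarize_wedge3, map_add, TensorProduct.map_tmul, map_wedge2]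

theorem tensor_wedge_induction {p : F ⊗[ℂ] (⋀[ℂ]^2 E) → Prop} (h0 : p 0)
    (hadd : ∀ x y, p x → p y → p (x + y)) (h : ∀ f a b, p (f ⊗ₜ wedge2 a b))
    (t : F ⊗[ℂ] (⋀[ℂ]^2 E)) : p t := by
  induction t with
  | zero => exact h0
  | add x y hx hy => exact hadd x y hx hy
  | tmul f t =>
    exact bivector_induction (p := fun t => p (f ⊗ₜ t)) (by rwa [TensorProduct.tmul_zero])
      (fun x y hx hy => by rw [TensorProduct.tmul_add]; exact hadd _ _ hx hy) (h f) t

theorem wedgeMul_map (f : E →ₗ[ℂ] F) (t : E ⊗[ℂ] (⋀[ℂ]^2 E)) :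
    wedgeMul (TensorProduct.map f (exteriorPower.map 2 f) t) =
      exteriorPower.map 3 f (wedgeMul t) := by
  refine tensor_wedge_induction (p := fun t => wedgeMul (TensorProduct.map f (exteriorPower.map 2 f) t) =
      exteriorPower.map 3 f (wedgeMul t)) (by simp)
    (fun x y hx hy => by simp only [map_add, hx, hy]) (fun a b c => ?_) t
  rw [TensorProduct.map_tmul, map_wedge2, wedgeMul_tmul_wedge2, wedgeMul_tmul_wedge2, map_wedge3]

theorem wedge3_rotate (a b c : E) : wedge3 b c a = wedge3 a b c := by
  rw [← wedgeMul_tmul_wedge2 b, wedge2_swap, TensorProduct.tmul_neg, map_neg,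
    wedgeMul_tmul_wedge2]
  have h := (exteriorPower.ιMulti ℂ 3).map_swap ![a, b, c] (i := 0) (j := 1) (by decide)
  rw [wedge3, wedge3, neg_eq_iff_eq_neg, ← h]
  congr 1
  ext i
  fin_cases i <;> rfl

/-- The three cyclic terms have the same product. This constant is the origin of the `1/3` in
`proj21`. -/
theorem wedgeMul_polarize (t : ⋀[ℂ]^3 E) : wedgeMul (polarize t) = (3 : ℂ) • t := by
  refine trivector_induction (p := fun t => wedgeMul (polarize t) = (3 : ℂ) • t) (by simp)
    (fun x y hx hy => by simp only [map_add, hx, hy, smul_add]) (fun a b c => ?_) t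
  rw [polarize_wedge3, map_add, map_add, wedgeMul_tmul_wedge2, wedgeMul_tmul_wedge2,
    wedgeMul_tmul_wedge2, wedge3_rotate b c a, wedge3_rotate a b c]
  module

/-- The projection of `E ⊗ ∧²E` onto `Σ²¹E`. -/
def proj21 : E ⊗[ℂ] (⋀[ℂ]^2 E) →ₗ[ℂ] LinearMap.ker (wedge E) :=
  LinearMap.codRestrict _ (LinearMap.id - (1 / 3 : ℂ) • polarize ∘ₗ wedgeMul) fun t => by
    rw [LinearMap.mem_ker, ← wedgeMul_eq_zero_iff]
    simp [wedgeMul_polarize, smul_smul]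

theorem coe_proj21 (t : E ⊗[ℂ] (⋀[ℂ]^2 E)) :
    (proj21 t : E ⊗[ℂ] (⋀[ℂ]^2 E)) = t - (1 / 3 : ℂ) • polarize (wedgeMul t) := rfl

theorem proj21_of_mem (t : LinearMap.ker (wedge E)) : proj21 (t : E ⊗[ℂ] (⋀[ℂ]^2 E)) = t := by
  refine Subtype.ext ?_
  rw [coe_proj21, (wedgeMul_eq_zero_iff _).2 t.2, map_zero, smul_zero, sub_zero]

theorem proj21_polarize (t : ⋀[ℂ]^3 E) : proj21 (polarize t) = 0 := by
  refine Subtype.ext ?_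
  rw [coe_proj21, wedgeMul_polarize, map_smul, smul_smul]
  simp

theorem eq_polarize_of_proj21 {t : E ⊗[ℂ] (⋀[ℂ]^2 E)} (h : proj21 t = 0) :
    t = polarize ((1 / 3 : ℂ) • wedgeMul t) := by
  have h1 := coe_proj21 t
  rw [h, Submodule.coe_zero] at h1
  rw [map_smul]
  exact (sub_eq_zero.1 h1.symm)

/-- Descent of linear maps along a surjection. -/
def descend (r : E →ₗ[ℂ] F) (hr : Function.Surjective r) (f : E →ₗ[ℂ] H)
    (h : ∀ x, r x = 0 → f x = 0) : F →ₗ[ℂ] H :=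
  (LinearMap.ker r).liftQ f (fun x hx => h x hx) ∘ₗ (r.quotKerEquivOfSurjective hr).symm.toLinearMap

theorem descend_apply (r : E →ₗ[ℂ] F) (hr : Function.Surjective r) (f : E →ₗ[ℂ] H)
    (h : ∀ x, r x = 0 → f x = 0) (x : E) : descend r hr f h (r x) = f x := by
  have h1 : (r.quotKerEquivOfSurjective hr).symm (r x) = (LinearMap.ker r).mkQ x := by
    rw [LinearEquiv.symm_apply_eq]
    rfl
  rw [descend, LinearMap.comp_apply, LinearEquiv.coe_coe, h1]
  rfl

/-- The canonical element of `E ⊗ E^∨` does not depend on the basis. -/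
theorem sum_basis_coord {ι κ : Type} [Fintype ι] [Fintype κ] (b : Module.Basis ι ℂ E)
    (c : Module.Basis κ ℂ E) (f : E →ₗ[ℂ] Module.Dual ℂ E →ₗ[ℂ] F) :
    ∑ k, f (b k) (b.coord k) = ∑ l, f (c l) (c.coord l) := by
  have h1 : ∀ k, f (b k) (b.coord k) = ∑ l, c.coord l (b k) • f (c l) (b.coord k) := fun k => by
    conv_lhs => rw [← c.sum_repr (b k)]
    rw [map_sum, LinearMap.sum_apply]
    exact Finset.sum_congr rfl fun l _ => by rw [map_smul]; rfl
  have h2 : ∀ l, f (c l) (c.coord l) = ∑ k, c.coord l (b k) • f (c l) (b.coord k) := fun l => by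
    have : c.coord l = ∑ k, c.coord l (b k) • b.coord k := by
      refine b.ext fun k => ?_
      classical
      simp [LinearMap.sum_apply, Finsupp.single_apply]
    conv_lhs => rw [this]
    simp
  simp only [h1, h2]
  exact Finset.sum_comm

/-- Evaluation of a `2`-form on two vectors. -/
def ev2 (u v : E) : ⋀[ℂ]^2 (Module.Dual ℂ E) →ₗ[ℂ] ℂ :=
  LinearMap.applyₗ (wedge2 u v) ∘ₗ exteriorPower.pairingDual ℂ E 2

theorem ev2_wedge2 (u v : E) (f g : Module.Dual ℂ E) :
    ev2 u v (wedge2 f g) = f u * g v - g u * f v := by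
  rw [ev2, LinearMap.comp_apply, LinearMap.applyₗ_apply_apply, wedge2_apply, wedge2_apply,
    exteriorPower.pairingDual_ιMulti_ιMulti, Matrix.det_fin_two]
  rfl

/-- The bilinear map `(u, φ) ↦ i(u) ⊗ (φ ∧ f)`. -/
def insertionAux (i : E →ₗ[ℂ] F) (f : Module.Dual ℂ E) :
    E →ₗ[ℂ] Module.Dual ℂ E →ₗ[ℂ] F ⊗[ℂ] (⋀[ℂ]^2 (Module.Dual ℂ E)) :=
  (TensorProduct.mk ℂ F (⋀[ℂ]^2 (Module.Dual ℂ E))).compl₁₂ i (wedge2.flip f)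

theorem insertionAux_apply (i : E →ₗ[ℂ] F) (f φ : Module.Dual ℂ E) (u : E) :
    insertionAux i f u φ = i u ⊗ₜ wedge2 φ f := rfl

/-- The map `f ↦ ∑ₖ i(bₖ) ⊗ (bₖ^∨ ∧ f)`. -/
def insertion (i : E →ₗ[ℂ] F) (b : Module.Basis (Fin 6) ℂ E) :
    Module.Dual ℂ E →ₗ[ℂ] F ⊗[ℂ] (⋀[ℂ]^2 (Module.Dual ℂ E)) :=
  ∑ k, TensorProduct.mk ℂ F (⋀[ℂ]^2 (Module.Dual ℂ E)) (i (b k)) ∘ₗ wedge2 (b.coord k)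

theorem insertion_apply (i : E →ₗ[ℂ] F) (b : Module.Basis (Fin 6) ℂ E) (f : Module.Dual ℂ E) :
    insertion i b f = ∑ k, i (b k) ⊗ₜ[ℂ] wedge2 (b.coord k) f := by
  rw [insertion, LinearMap.sum_apply]
  rfl

theorem insertion_basis (i : E →ₗ[ℂ] F) (b c : Module.Basis (Fin 6) ℂ E) :
    insertion i b = insertion i c := by
  refine LinearMap.ext fun f => ?_
  have h := sum_basis_coord b c (insertionAux i f)
  simp only [insertionAux_apply] at h
  rw [insertion_apply, insertion_apply, h]

theorem insertion_map {E' F' : Type} [AddCommGroup E'] [Module ℂ E'] [AddCommGroup F']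
    [Module ℂ F'] (i : E →ₗ[ℂ] F) (i' : E' →ₗ[ℂ] F') (g : E ≃ₗ[ℂ] E') (f : F →ₗ[ℂ] F')
    (hf : ∀ u, f (i u) = i' (g u)) (k : Module.Dual ℂ E →ₗ[ℂ] Module.Dual ℂ E')
    (hk : ∀ φ, k φ = φ ∘ₗ g.symm.toLinearMap) (b : Module.Basis (Fin 6) ℂ E)
    (b' : Module.Basis (Fin 6) ℂ E') (φ : Module.Dual ℂ E) :
    insertion i' b' (k φ) =
      TensorProduct.map f (exteriorPower.map 2 k) (insertion i b φ) := by
  rw [insertion_basis i' b' (b.map g), insertion_apply, insertion_apply, map_sum]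
  refine Finset.sum_congr rfl fun l _ => ?_
  rw [TensorProduct.map_tmul, map_wedge2, hf, hk (b.coord l)]
  rfl

theorem insertion_injective (i : E →ₗ[ℂ] F) (hi : Function.Injective i)
    (b : Module.Basis (Fin 6) ℂ E) : Function.Injective (insertion i b) := by
  refine (injective_iff_map_eq_zero _).2 fun f hf => ?_
  refine b.ext fun m => ?_
  obtain ⟨l, hl⟩ : ∃ l, l ≠ m := exists_ne m
  obtain ⟨j, hj⟩ := LinearMap.exists_leftInverse_of_injective i (LinearMap.ker_eq_bot.2 hi)
  have hj' : ∀ u, j (i u) = u := LinearMap.congr_fun hj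
  -- Pairing with `b_l^∨` on the first factor keeps only the summand `k = l`; evaluating `b_l^∨ ∧ f`
  -- on `(b_l, b_m)` with `l ≠ m` then returns `f (b_m)`.
  have h1 := congrArg (LinearMap.mul' ℂ ℂ ∘ₗ
    TensorProduct.map (b.coord l ∘ₗ j) (ev2 (b l) (b m))) hf
  rw [insertion_apply, map_sum, map_zero] at h1
  rw [Finset.sum_eq_single l] at h1
  · simpa [ev2_wedge2, hj', Finsupp.single_apply, hl] using h1
  · intro k _ hk
    simp [hj', hk]
  · simp

/-! ### Polarized restriction and projection to the Schur functor -/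

/-- The map `∧³E → E ⊗ ∧²F` induced by a linear map `r : E → F`. -/
def comul (r : E →ₗ[ℂ] F) : ⋀[ℂ]^3 E →ₗ[ℂ] E ⊗[ℂ] (⋀[ℂ]^2 F) :=
  TensorProduct.map LinearMap.id (exteriorPower.map 2 r) ∘ₗ polarize

theorem comul_wedge3 (r : E →ₗ[ℂ] F) (a b c : E) : comul r (wedge3 a b c) =
    a ⊗ₜ wedge2 (r b) (r c) + b ⊗ₜ wedge2 (r c) (r a) + c ⊗ₜ wedge2 (r a) (r b) := by
  rw [comul, LinearMap.comp_apply, polarize_wedge3]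
  simp only [map_add, TensorProduct.map_tmul, map_wedge2, LinearMap.id_apply]

theorem map_comul (r : E →ₗ[ℂ] F) (t : ⋀[ℂ]^3 E) :
    TensorProduct.map r LinearMap.id (comul r t) = polarize (exteriorPower.map 3 r t) := by
  rw [comul, LinearMap.comp_apply, ← LinearMap.comp_apply (TensorProduct.map _ _),
    ← TensorProduct.map_comp, LinearMap.comp_id, LinearMap.id_comp, ← polarize_map]

theorem comul_natural {E' F' : Type} [AddCommGroup E'] [Module ℂ E'] [AddCommGroup F']
    [Module ℂ F'] (r : E →ₗ[ℂ] F) (r' : E' →ₗ[ℂ] F') (f : E →ₗ[ℂ] E') (k : F →ₗ[ℂ] F')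
    (h : ∀ v, r' (f v) = k (r v)) (t : ⋀[ℂ]^3 E) :
    comul r' (exteriorPower.map 3 f t) =
      TensorProduct.map f (exteriorPower.map 2 k) (comul r t) := by
  refine trivector_induction (p := fun t => comul r' (exteriorPower.map 3 f t) =
      TensorProduct.map f (exteriorPower.map 2 k) (comul r t)) (by simp)
    (fun a b ha hb => by simp only [map_add, ha, hb]) (fun a b c => ?_) t
  rw [map_wedge3, comul_wedge3, comul_wedge3]
  simp only [map_add, TensorProduct.map_tmul, map_wedge2, h]

/-- The map `E ⊗ ∧²F → Σ²¹F` induced by a linear map `r : E → F`. -/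
def toSchur21 (r : E →ₗ[ℂ] F) : E ⊗[ℂ] (⋀[ℂ]^2 F) →ₗ[ℂ] LinearMap.ker (wedge F) :=
  proj21 ∘ₗ TensorProduct.map r LinearMap.id

theorem coe_toSchur21_natural {E' F' : Type} [AddCommGroup E'] [Module ℂ E'] [AddCommGroup F']
    [Module ℂ F'] (r : E →ₗ[ℂ] F) (r' : E' →ₗ[ℂ] F') (f : E →ₗ[ℂ] E') (k : F →ₗ[ℂ] F')
    (h : ∀ v, r' (f v) = k (r v)) (t : E ⊗[ℂ] (⋀[ℂ]^2 F)) :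
    (toSchur21 r' (TensorProduct.map f (exteriorPower.map 2 k) t) : F' ⊗[ℂ] (⋀[ℂ]^2 F')) =
      TensorProduct.map k (exteriorPower.map 2 k) (toSchur21 r t : F ⊗[ℂ] (⋀[ℂ]^2 F)) := by
  have h1 : TensorProduct.map r' LinearMap.id (TensorProduct.map f (exteriorPower.map 2 k) t) =
      TensorProduct.map k (exteriorPower.map 2 k) (TensorProduct.map r LinearMap.id t) := by
    induction t with
    | zero => simp
    | add a b ha hb => simp only [map_add, ha, hb]
    | tmul v b => simp only [TensorProduct.map_tmul, LinearMap.id_apply, h]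
  rw [toSchur21, toSchur21, LinearMap.comp_apply, LinearMap.comp_apply, h1, coe_proj21, coe_proj21,
    wedgeMul_map, polarize_map, map_sub, map_smul]

/-- Once `r` is applied to the remaining factor as well, `comul` becomes the polarization of a
trivector of `F`, and `proj21` kills polarizations. -/
theorem toSchur21_comul (r : E →ₗ[ℂ] F) (t : ⋀[ℂ]^3 E) : toSchur21 r (comul r t) = 0 := by
  rw [toSchur21, LinearMap.comp_apply, map_comul, proj21_polarize]

theorem toSchur21_insertion (i : H →ₗ[ℂ] E) (r : E →ₗ[ℂ] Module.Dual ℂ H)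
    (hri : ∀ u, r (i u) = 0) (b : Module.Basis (Fin 6) ℂ H) (f : Module.Dual ℂ H) :
    toSchur21 r (insertion i b f) = 0 := by
  rw [insertion_apply, toSchur21, LinearMap.comp_apply, map_sum]
  simp only [TensorProduct.map_tmul, hri, TensorProduct.zero_tmul, Finset.sum_const_zero, map_zero]

/-- Over `F`, an element killed by the projection is a polarization; lifting the underlying
trivector to `E` corrects `t` to an element of the image of `H ⊗ ∧²F`. Such an element `u ⊗ (f ∧
f')` is `comul` of `u ∧ v ∧ v'` for lifts `v, v'` of `f, f'`, since `r` kills `u` and with it the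
other two terms. -/
theorem exists_comul_of_toSchur21 (i : H →ₗ[ℂ] E) (r : E →ₗ[ℂ] F) (hr : Function.Surjective r)
    (hi : Function.Exact i r) (t : E ⊗[ℂ] (⋀[ℂ]^2 F)) (ht : toSchur21 r t = 0) :
    ∃ a, comul r a = t := by
  have h1 := eq_polarize_of_proj21 ht
  obtain ⟨a, ha⟩ := exteriorPower.map_surjective (n := 3) hr
    ((1 / 3 : ℂ) • wedgeMul (TensorProduct.map r LinearMap.id t))
  rw [← ha, ← map_comul] at h1
  have h2 : LinearMap.rTensor (⋀[ℂ]^2 F) r (t - comul r a) = 0 := by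
    rw [map_sub, sub_eq_zero]
    exact h1
  obtain ⟨c, hc⟩ := (rTensor_exact (⋀[ℂ]^2 F) hi hr _).1 h2
  have h4 : ∀ c : H ⊗[ℂ] (⋀[ℂ]^2 F), ∃ d, comul r d = LinearMap.rTensor _ i c := by
    refine tensor_wedge_induction ⟨0, by simp⟩ ?_ ?_
    · rintro c c' ⟨d, hd⟩ ⟨d', hd'⟩
      exact ⟨d + d', by rw [map_add, map_add, hd, hd']⟩
    · intro u f f'
      obtain ⟨v, rfl⟩ := hr f
      obtain ⟨v', rfl⟩ := hr f'
      refine ⟨wedge3 (i u) v v', ?_⟩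
      rw [comul_wedge3, hi.apply_apply_eq_zero]
      simp
  obtain ⟨d, hd⟩ := h4 c
  exact ⟨d + a, by rw [map_add, hd, hc, sub_add_cancel]⟩

theorem toSchur21_surjective (r : E →ₗ[ℂ] F) (hr : Function.Surjective r) :
    Function.Surjective (toSchur21 r) := by
  intro t
  obtain ⟨s, hs⟩ := LinearMap.rTensor_surjective (⋀[ℂ]^2 F) hr (t : F ⊗[ℂ] (⋀[ℂ]^2 F))
  refine ⟨s, ?_⟩
  have h : toSchur21 r s = proj21 (LinearMap.rTensor (⋀[ℂ]^2 F) r s) := rfl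
  rw [h, hs, proj21_of_mem]

end Multilinear

end

/-! ### Morphisms induced on quotients and on Schur functors -/

section

open EquivFamily

/-- The morphism induced on a quotient bundle. -/
def Hom.quotLift {E F : EquivFamily} {N : ∀ x, Submodule ℂ (E.fib x)}
    {hN : ∀ (g : G) {x y : OGplus} (h : g • x = y), ∀ v ∈ N x, E.act g h v ∈ N y} (φ : Hom E F)
    (hφ : ∀ x, N x ≤ LinearMap.ker (φ.app x)) : Hom (E.quot N hN) F :=
  Hom.ofEquivariant (fun x => (N x).liftQ (φ.app x) (hφ x)) fun g x y h t => by
    obtain ⟨t, rfl⟩ := Submodule.mkQ_surjective _ t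
    exact φ.equivariant g h t

/-- The morphism `E ⊗ ∧²F → Σ²¹F` induced by a morphism `E → F`. -/
def Hom.toSchur {E F : EquivFamily} (φ : Hom E F) :
    Hom (E.tensor (EquivFamily.ext 2 F)) F.schur21 :=
  Hom.ofEquivariant (fun x => toSchur21 (φ.app x)) fun g x y h t => Subtype.ext
    (coe_toSchur21_natural (φ.app x) (φ.app y) (E.act g h) (F.act g h) (φ.equivariant g h) t)

/-! ### The quotient map `V ⊗ 𝒪 → 𝒰^∨` -/

/-- The restriction `v ↦ b(v, -)|_U`. -/
def rho (x : OGplus) : V →ₗ[ℂ] Module.Dual ℂ x.space :=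
  x.space.subtype.dualMap ∘ₗ QuadraticMap.polarBilin q

theorem rho_apply (x : OGplus) (v : V) (u : x.space) :
    rho x v u = QuadraticMap.polar q v u := rfl

theorem vectorRep_inv_apply (g : G) (v : V) : vectorRep g (vectorRep g⁻¹ v) = v := by
  rw [← Module.End.mul_apply, ← map_mul, mul_inv_cancel, map_one, Module.End.one_apply]

theorem vectorRep_apply_inv (g : G) (v : V) : vectorRep g⁻¹ (vectorRep g v) = v := by
  rw [← Module.End.mul_apply, ← map_mul, inv_mul_cancel, map_one, Module.End.one_apply]

theorem rho_equivariant (g : G) {x y : OGplus} (h : g • x = y) (v : V) :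
    rho y (vectorRep g v) = tautDual.act g h (rho x v) := by
  refine LinearMap.ext fun u => ?_
  change QuadraticMap.polar q (vectorRep g v) (u : V) =
    QuadraticMap.polar q v (vectorRep g⁻¹ (u : V))
  rw [← polar_vectorRep g v, vectorRep_inv_apply]

/-- The surjection `V ⊗ 𝒪 → 𝒰^∨`. -/
def rhoHom : Hom trivialV tautDual := Hom.ofEquivariant rho rho_equivariant

/-- The isomorphism `M ≃ 0 ⊕ M`. -/
def baseIncl : M ≃ₗ[ℂ] base.space :=
  LinearEquiv.ofInjective (LinearMap.inr ℂ (Module.Dual ℂ M) M) LinearMap.inr_injective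

theorem coe_baseIncl (m : M) : (baseIncl m : V) = (0, m) := rfl

theorem rho_base_apply (v : V) (m : M) : rho base v (baseIncl m) = v.1 m := by
  rw [rho_apply, coe_baseIncl, polar_q, LinearMap.zero_apply, add_zero]

theorem rho_base_comp (f : Module.Dual ℂ base.space) (m : M) :
    rho base (f ∘ₗ baseIncl.toLinearMap, m) = f := by
  refine LinearMap.ext fun u => ?_
  obtain ⟨m', rfl⟩ := baseIncl.surjective u
  rw [rho_base_apply]
  rfl

theorem rho_surjective (x : OGplus) : Function.Surjective (rho x) :=
  rhoHom.surjective_of_base (fun f => ⟨_, rho_base_comp f 0⟩) x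

theorem rho_base_eq_zero_iff (v : V) : rho base v = 0 ↔ v.1 = 0 := by
  constructor
  · intro h
    refine LinearMap.ext fun m => ?_
    rw [← rho_base_apply, h]
    rfl
  · intro h
    refine LinearMap.ext fun u => ?_
    obtain ⟨m', rfl⟩ := baseIncl.surjective u
    rw [rho_base_apply, h]
    rfl

theorem rho_eq_zero_iff (x : OGplus) (v : V) : rho x v = 0 ↔ v ∈ x.space := by
  obtain ⟨g, rfl⟩ := exists_smul_base x
  have h1 : rho (g • base) v = tautDual.act g rfl (rho base (vectorRep g⁻¹ v)) := by
    rw [← rho_equivariant, vectorRep_inv_apply]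
  have h2 : rho (g • base) v = 0 ↔ rho base (vectorRep g⁻¹ v) = 0 := by
    rw [h1]
    exact (tautDual.actEquiv g rfl).map_eq_zero_iff
  rw [h2, rho_base_eq_zero_iff, mem_smul_base]
  constructor
  · intro h
    exact ⟨(vectorRep g⁻¹ v).2, by rw [← h, Prod.mk.eta, vectorRep_inv_apply]⟩
  · rintro ⟨m, rfl⟩
    rw [vectorRep_apply_inv]

/-! ### The Clifford inclusion -/

/-- Clifford multiplication of vectors and pure spinors. -/
def spinMul (x : OGplus) : V →ₗ[ℂ] pureSpinors x.space →ₗ[ℂ] half 1 :=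
  LinearMap.mk₂ ℂ (fun v s => ⟨cliffordMul v s, by
      have h := cliffordMul_mem_half v 0 (pureSpinors_le_half x s.2)
      rwa [zero_add] at h⟩)
    (fun v v' s => Subtype.ext (by simp))
    (fun c v s => Subtype.ext (by simp))
    (fun v s s' => Subtype.ext (by simp))
    (fun c v s => Subtype.ext (by simp))

theorem coe_spinMul (x : OGplus) (v : V) (s : pureSpinors x.space) :
    (spinMul x v s : S) = cliffordMul v s := rfl

/-- The map `𝒰^∨(-1) → S⁻ ⊗ 𝒪` on fibres. -/
def cliffordInclusion (x : OGplus) :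
    Module.Dual ℂ x.space ⊗[ℂ] pureSpinors x.space →ₗ[ℂ] half 1 :=
  TensorProduct.lift (descend (H := pureSpinors x.space →ₗ[ℂ] half 1) (rho x) (rho_surjective x)
    (spinMul x) fun v hv => LinearMap.ext fun s => Subtype.ext
      (s.2 v ((rho_eq_zero_iff x v).1 hv)))

theorem cliffordInclusion_tmul (x : OGplus) (v : V) (s : pureSpinors x.space) :
    cliffordInclusion x (rho x v ⊗ₜ s) = spinMul x v s := by
  rw [cliffordInclusion, TensorProduct.lift.tmul, descend_apply]

theorem cliffordInclusion_equivariant (g : G) {x y : OGplus} (h : g • x = y)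
    (t : Module.Dual ℂ x.space ⊗[ℂ] pureSpinors x.space) :
    cliffordInclusion y (TensorProduct.map (tautDual.act g h) (spinLine.act g h) t) =
      halfSpinRep 1 g (cliffordInclusion x t) := by
  induction t with
  | zero => simp
  | add a b ha hb => rw [map_add, map_add, ha, hb, map_add, map_add]
  | tmul f s =>
    obtain ⟨v, rfl⟩ := rho_surjective x f
    rw [cliffordInclusion_tmul, TensorProduct.map_tmul, ← rho_equivariant, cliffordInclusion_tmul]
    exact Subtype.ext (cliffordMul_vectorRep g v s)

/-- The Clifford inclusion `𝒰^∨(-1) → S⁻ ⊗ 𝒪`. -/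
def cliffordHom : Hom (tautDual.tensor spinLine) (trivialHalf 1) :=
  Hom.ofEquivariant cliffordInclusion cliffordInclusion_equivariant

theorem isCliffordInclusion_cliffordHom : IsCliffordInclusion cliffordHom := fun x v s =>
  congrArg Subtype.val (cliffordInclusion_tmul x v s)

/-- The vacuum, a generator of the pure spinors of the base point. -/
def vac : pureSpinors base.space := ⟨1, (mem_pureSpinors_base 1).2 one_mem_Λ⟩

theorem coe_vac : (vac : S) = 1 := rfl

theorem exists_smul_vac (s : pureSpinors base.space) : ∃ c : ℂ, s = c • vac := by
  obtain ⟨c, hc⟩ := Λ_zero_eq ((mem_pureSpinors_base _).1 s.2)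
  exact ⟨c, Subtype.ext (by rw [← hc, Algebra.algebraMap_eq_smul_one]; rfl)⟩

theorem exists_tmul_vac {A : Type} [AddCommGroup A] [Module ℂ A]
    (t : A ⊗[ℂ] pureSpinors base.space) : ∃ a : A, t = a ⊗ₜ vac := by
  induction t with
  | zero => exact ⟨0, by simp⟩
  | add x y hx hy =>
    obtain ⟨a, rfl⟩ := hx
    obtain ⟨b, rfl⟩ := hy
    exact ⟨a + b, by rw [TensorProduct.add_tmul]⟩
  | tmul a s =>
    obtain ⟨c, rfl⟩ := exists_smul_vac s
    exact ⟨c • a, by rw [TensorProduct.tmul_smul, TensorProduct.smul_tmul']⟩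

theorem ext1_injective {f : Module.Dual ℂ M} (h : ext1 f = 0) : f = 0 :=
  ExteriorAlgebra.ι_leftInverse (R := ℂ) |>.injective (h.trans (map_zero _).symm)

theorem cliffordInclusion_vac (f : Module.Dual ℂ M) (m : M) :
    (cliffordInclusion base (rho base (f, m) ⊗ₜ vac) : S) = ext1 f := by
  rw [cliffordInclusion_tmul, coe_spinMul, cliffordMul_eq, coe_vac, mul_one, ctr_one, add_zero]

theorem cliffordHom_injective : cliffordHom.Injective := by
  refine cliffordHom.injective_of_base ?_
  refine (injective_iff_map_eq_zero _).2 fun t ht => ?_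
  obtain ⟨f, rfl⟩ := exists_tmul_vac t
  obtain ⟨v, rfl⟩ := rho_surjective base f
  have h1 : ext1 v.1 = 0 := by
    rw [← cliffordInclusion_vac v.1 v.2]
    exact congrArg Subtype.val ht
  rw [(rho_base_eq_zero_iff v).2 (ext1_injective h1), TensorProduct.zero_tmul]

/-! ### The contraction inclusion and the bundle `T` -/

theorem nonempty_basis (x : OGplus) : Nonempty (Module.Basis (Fin 6) ℂ x.space) := by
  obtain ⟨g, hg⟩ := exists_smul_base x
  exact ⟨((Pi.basisFun ℂ (Fin 6)).map baseIncl).map (taut.actEquiv g hg)⟩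

/-- A basis of the subspace corresponding to a point of `X`. -/
def spaceBasis (x : OGplus) : Module.Basis (Fin 6) ℂ x.space := (nonempty_basis x).some

/-- The map `𝒰^∨ → V ⊗ ∧²𝒰^∨` on fibres. -/
def contraction (x : OGplus) :
    Module.Dual ℂ x.space →ₗ[ℂ] V ⊗[ℂ] (⋀[ℂ]^2 (Module.Dual ℂ x.space)) :=
  insertion x.space.subtype (spaceBasis x)

theorem contraction_equivariant (g : G) {x y : OGplus} (h : g • x = y)
    (f : Module.Dual ℂ x.space) :
    contraction y (tautDual.act g h f) = TensorProduct.map (vectorRep g)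
      (exteriorPower.map 2 (tautDual.act g h)) (contraction x f) :=
  insertion_map x.space.subtype y.space.subtype (taut.actEquiv g h) (vectorRep g) (fun _ => rfl)
    (tautDual.act g h) (fun _ => rfl) _ _ f

/-- The contraction inclusion `𝒰^∨ → V ⊗ ∧²𝒰^∨`. -/
def contractionHom : Hom tautDual (trivialV.tensor (EquivFamily.ext 2 tautDual)) :=
  Hom.ofEquivariant contraction contraction_equivariant

theorem isContractionInclusion_contractionHom : IsContractionInclusion contractionHom :=
  fun x b f => by
    have h := LinearMap.congr_fun (insertion_basis x.space.subtype (spaceBasis x) b) f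
    rw [insertion_apply _ b] at h
    exact h

theorem contraction_injective (x : OGplus) : Function.Injective (contraction x) :=
  insertion_injective _ x.space.injective_subtype _

/-- The bundle `T`, the cokernel of the contraction inclusion. -/
abbrev bundleT : EquivFamily :=
  (trivialV.tensor (EquivFamily.ext 2 tautDual)).quot (fun x => LinearMap.range (contraction x))
    fun g x y h v hv => by
      obtain ⟨f, rfl⟩ := hv
      exact ⟨tautDual.act g h f, contraction_equivariant g h f⟩

theorem isAlgebraic_bundleT : bundleT.IsAlgebraic :=
  (isAlgebraic_trivialV.tensor (isAlgebraic_tautDual.ext 2)).quot _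

/-- The projection onto `T`. -/
def projT : Hom (trivialV.tensor (EquivFamily.ext 2 tautDual)) bundleT :=
  Hom.ofEquivariant (fun x => (LinearMap.range (contraction x)).mkQ) fun _ _ _ _ _ => rfl

theorem contractionHom_shortExact : contractionHom.ShortExact projT :=
  ⟨contraction_injective, fun x => LinearMap.exact_map_mkQ_range (contraction x),
    fun _ => Submodule.mkQ_surjective _⟩

/-! ### The last two maps of the complex -/

/-- The map `∧³V ⊗ 𝒪 → T`. -/
def homD3 : Hom (EquivFamily.ext 3 trivialV) bundleT :=
  Hom.ofEquivariant (fun x => (LinearMap.range (contraction x)).mkQ ∘ₗ comul (rho x))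
    fun g x y h t => congrArg (LinearMap.range (contraction y)).mkQ
      (comul_natural (rho x) (rho y) (vectorRep g) (tautDual.act g h) (rho_equivariant g h) t)

/-- The map `V ⊗ ∧²𝒰^∨ → 𝒰_{ω₁+ω₂}`. -/
def schurHom : Hom (trivialV.tensor (EquivFamily.ext 2 tautDual)) schurDual := rhoHom.toSchur

theorem schurHom_contraction (x : OGplus) : LinearMap.range (contraction x) ≤
    LinearMap.ker (schurHom.app x) := by
  rintro _ ⟨f, rfl⟩
  exact toSchur21_insertion _ _ (fun u => (rho_eq_zero_iff x _).2 u.2) _ f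

/-- The map `T → 𝒰_{ω₁+ω₂}`. -/
def homD4 : Hom bundleT schurDual := schurHom.quotLift schurHom_contraction

theorem exact_subtype_rho (x : OGplus) : Function.Exact x.space.subtype (rho x) := fun v => by
  rw [rho_eq_zero_iff]
  simp

theorem exact_mkQ_comp_liftQ {A B C : Type} [AddCommGroup A] [Module ℂ A] [AddCommGroup B]
    [Module ℂ B] [AddCommGroup C] [Module ℂ C] (f : A →ₗ[ℂ] B) (r : B →ₗ[ℂ] C)
    (N : Submodule ℂ B) (hN : N ≤ LinearMap.ker r) (h1 : ∀ a, r (f a) = 0)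
    (h2 : ∀ t, r t = 0 → ∃ a, N.mkQ (f a) = N.mkQ t) :
    Function.Exact (N.mkQ ∘ₗ f) (N.liftQ r hN) := by
  intro t
  obtain ⟨t, rfl⟩ := Submodule.mkQ_surjective N t
  constructor
  · intro ht
    exact h2 t ht
  · rintro ⟨a, ha⟩
    rw [← ha]
    exact h1 a

theorem homD3_app (x : OGplus) :
    homD3.app x = (LinearMap.range (contraction x)).mkQ ∘ₗ comul (rho x) := rfl

theorem homD4_app (x : OGplus) : homD4.app x =
    (LinearMap.range (contraction x)).liftQ (schurHom.app x) (schurHom_contraction x) := rfl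

theorem exact_mkQ_comul {E F H : Type} [AddCommGroup E] [Module ℂ E] [AddCommGroup F] [Module ℂ F]
    [AddCommGroup H] [Module ℂ H] (i : H →ₗ[ℂ] E) (r : E →ₗ[ℂ] F) (hr : Function.Surjective r)
    (hi : Function.Exact i r) (N : Submodule ℂ (E ⊗[ℂ] (⋀[ℂ]^2 F)))
    (hN : N ≤ LinearMap.ker (toSchur21 r)) :
    Function.Exact (N.mkQ ∘ₗ comul r) (N.liftQ (toSchur21 r) hN) :=
  exact_mkQ_comp_liftQ (comul r) (toSchur21 r) N hN (toSchur21_comul r) fun t ht =>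
      (exists_comul_of_toSchur21 i r hr hi t ht).imp fun _ ha => congrArg N.mkQ ha

theorem homD3_exact_homD4 : homD3.Exact homD4 := by
  intro x
  rw [homD3_app, homD4_app]
  exact exact_mkQ_comul x.space.subtype (rho x) (rho_surjective x) (exact_subtype_rho x) _ _

theorem homD4_surjective : homD4.Surjective := by
  intro x t
  obtain ⟨s, hs⟩ := toSchur21_surjective (rho x) (rho_surjective x) t
  exact ⟨(LinearMap.range (contraction x)).mkQ s, hs⟩

end

section

open EquivFamily

/-! ### Duality of exterior powers -/

section Pairing

variable {E F : Type} [AddCommGroup E] [Module ℂ E] [AddCommGroup F] [Module ℂ F]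

/-- Evaluation of an element of `F ⊗ ∧²E^∨` on a linear form and two vectors. -/
def ev12 (φ : Module.Dual ℂ F) (u v : E) : F ⊗[ℂ] (⋀[ℂ]^2 (Module.Dual ℂ E)) →ₗ[ℂ] ℂ :=
  LinearMap.mul' ℂ ℂ ∘ₗ TensorProduct.map φ (ev2 u v)

theorem ev12_tmul (φ : Module.Dual ℂ F) (u v : E) (x : F) (f g : Module.Dual ℂ E) :
    ev12 φ u v (x ⊗ₜ wedge2 f g) = φ x * (f u * g v - g u * f v) := by
  rw [ev12, LinearMap.comp_apply, TensorProduct.map_tmul, LinearMap.mul'_apply, ev2_wedge2]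

/-- The three terms of `comul_wedge3` are the cofactor expansion of the `3 × 3` determinant with
respect to `x`. Thus restriction to `U` in two slots is dual to the inclusion of the trivectors `x ∧
u ∧ v` with `u, v` in `U`. -/
theorem ev12_comul (B : F →ₗ[ℂ] F →ₗ[ℂ] ℂ) (i : E →ₗ[ℂ] F) (x : F) (u v : E) (t : ⋀[ℂ]^3 F) :
    ev12 (B.flip x) u v (comul (i.dualMap ∘ₗ B) t) =
      exteriorPower.pairingDual ℂ F 3 (exteriorPower.map 3 B t) (wedge3 x (i u) (i v)) := by
  refine trivector_induction (p := fun t => ev12 (B.flip x) u v (comul (i.dualMap ∘ₗ B) t) =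
      exteriorPower.pairingDual ℂ F 3 (exteriorPower.map 3 B t) (wedge3 x (i u) (i v))) (by simp)
    (fun a b ha hb => by simp only [map_add, LinearMap.add_apply, ha, hb]) (fun a b c => ?_) t
  rw [map_wedge3, comul_wedge3, exteriorPower.pairingDual_ιMulti_ιMulti, Matrix.det_fin_three]
  simp only [map_add, ev12_tmul]
  simp only [LinearMap.flip_apply, LinearMap.comp_apply, LinearMap.dualMap_apply,
    Matrix.of_apply, Matrix.cons_val]
  ring

variable [Module.Finite ℂ E]

theorem pairingDual_bijective (n : ℕ) : Function.Bijective (exteriorPower.pairingDual ℂ E n) := by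
  have hs : Function.Surjective (exteriorPower.pairingDual ℂ E n) := by
    rw [← LinearMap.range_eq_top, eq_top_iff]
    have b := Module.finBasis ℂ E
    intro φ _
    rw [← (b.exteriorPower n).sum_dual_apply_smul_coord φ]
    refine Submodule.sum_mem _ fun s _ => Submodule.smul_mem _ _ ?_
    rw [exteriorPower.basis_coord]
    exact LinearMap.mem_range_self _ _
  refine ⟨?_, hs⟩
  refine (LinearMap.injective_iff_surjective_of_finrank_eq_finrank ?_).2 hs
  rw [Subspace.dual_finrank_eq, exteriorPower.finrank_eq, exteriorPower.finrank_eq,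
    Subspace.dual_finrank_eq]

theorem eq_zero_of_ev2 {t : ⋀[ℂ]^2 (Module.Dual ℂ E)} (h : ∀ u v, ev2 u v t = 0) : t = 0 := by
  refine (pairingDual_bijective 2).1.eq_iff.1 ?_
  rw [map_zero]
  refine LinearMap.ext fun y => ?_
  exact bivector_induction (p := fun y => exteriorPower.pairingDual ℂ E 2 t y = 0) (by simp)
    (fun x y hx hy => by rw [map_add, hx, hy, add_zero]) h y

theorem eq_zero_of_ev12 [Module.Finite ℂ F] {t : F ⊗[ℂ] (⋀[ℂ]^2 (Module.Dual ℂ E))}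
    (h : ∀ φ u v, ev12 φ u v t = 0) : t = 0 := by
  let b := Module.finBasis ℂ F
  have key : ∀ k u v t, ev2 u v (TensorProduct.equivFinsuppOfBasisLeft
      (N := ⋀[ℂ]^2 (Module.Dual ℂ E)) b t k) = ev12 (b.coord k) u v t := fun k u v t => by
    induction t with
    | zero => simp
    | add x y hx hy => rw [map_add, map_add, Finsupp.add_apply, map_add, hx, hy]
    | tmul x y => simp [ev12]
  refine (TensorProduct.equivFinsuppOfBasisLeft (N := ⋀[ℂ]^2 (Module.Dual ℂ E)) b).map_eq_zero_iff.1
    (Finsupp.ext fun k => eq_zero_of_ev2 fun u v => ?_)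
  rw [key, h]

end Pairing

/-! ### Clifford multiplication by trivectors -/

/-- The trilinear map `(a, b, c) ↦ (s ↦ a · (b · (c · s)))`. -/
def cliffordMul₃ : V →ₗ[ℂ] V →ₗ[ℂ] V →ₗ[ℂ] Module.End ℂ S :=
  LinearMap.mk₂ ℂ (fun a b => LinearMap.mulLeft ℂ (cliffordMul a * cliffordMul b) ∘ₗ cliffordMul)
    (fun a a' b => LinearMap.ext fun x => by simp [add_mul, mul_assoc])
    (fun c a b => LinearMap.ext fun x => by simp [mul_assoc])
    (fun a b b' => LinearMap.ext fun x => by simp [mul_add, add_mul, mul_assoc])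
    (fun c a b => LinearMap.ext fun x => by simp [mul_assoc])

/-- Clifford multiplication of spinors by trivectors. -/
def trivMul : ⋀[ℂ]^3 V →ₗ[ℂ] Module.End ℂ S := (1 / 6 : ℂ) • alt3 cliffordMul₃

theorem trivMul_ιMulti (v : Fin 3 → V) : trivMul (exteriorPower.ιMulti ℂ 3 v) =
    (1 / 6 : ℂ) • ∑ σ : Equiv.Perm (Fin 3), (Equiv.Perm.sign σ : ℤ) •
      (cliffordMul (v (σ 0)) * cliffordMul (v (σ 1)) * cliffordMul (v (σ 2))) := by
  rw [trivMul, LinearMap.smul_apply, alt3_ιMulti,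
    sum_perm_fin_three fun i j k => cliffordMul (v i) * cliffordMul (v j) * cliffordMul (v k)]
  rfl

theorem trivMul_wedge3 (a b c : V) (s : S) : trivMul (wedge3 a b c) s =
    (1 / 6 : ℂ) • (cliffordMul a (cliffordMul b (cliffordMul c s)) -
      cliffordMul a (cliffordMul c (cliffordMul b s)) -
      cliffordMul b (cliffordMul a (cliffordMul c s)) +
      cliffordMul b (cliffordMul c (cliffordMul a s)) +
      cliffordMul c (cliffordMul a (cliffordMul b s)) -
      cliffordMul c (cliffordMul b (cliffordMul a s))) := by
  rw [trivMul, LinearMap.smul_apply, alt3_ιMulti]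
  rfl

theorem trivMul_mem_half (ω : ⋀[ℂ]^3 V) {s : S} (hs : s ∈ half 1) : trivMul ω s ∈ half 0 :=
  trivector_induction (p := fun ω => trivMul ω s ∈ half 0) (by simp)
    (fun a b ha hb => by rw [map_add, LinearMap.add_apply]; exact add_mem ha hb)
    (fun a b c => by rw [trivMul_ιMulti]; exact cliffordMul_triple_mem ![a, b, c] s hs) ω

theorem coe_trivectorMul (v : Fin 3 → V) (s : half 1) :
    (trivectorMul v s : S) = trivMul (exteriorPower.ιMulti ℂ 3 v) s := by
  rw [trivMul_ιMulti]
  rfl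

theorem trivMul_map (g : G) (ω : ⋀[ℂ]^3 V) (s : S) :
    trivMul (exteriorPower.map 3 (vectorRep g) ω) (spinRep g s) = spinRep g (trivMul ω s) := by
  refine trivector_induction (p := fun ω => trivMul (exteriorPower.map 3 (vectorRep g) ω)
      (spinRep g s) = spinRep g (trivMul ω s)) (by simp)
    (fun a b ha hb => by simp only [map_add, LinearMap.add_apply, ha, hb]) (fun a b c => ?_) ω
  rw [map_wedge3, trivMul_wedge3, trivMul_wedge3]
  simp only [cliffordMul_vectorRep, map_smul, map_add, map_sub]

/-! ### The map `ξ : S⁻ ⊗ S⁺ → ∧³V` -/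

/-- The isomorphism `V ≃ V^∨` given by the polar form. -/
theorem polarBilin_bijective : Function.Bijective (QuadraticMap.polarBilin q) := by
  have hi : Function.Injective (QuadraticMap.polarBilin q) := by
    refine (injective_iff_map_eq_zero _).2 fun v hv => ?_
    have h : ∀ u, QuadraticMap.polar q v u = 0 := fun u => LinearMap.congr_fun hv u
    refine Prod.ext (LinearMap.ext fun m => ?_) ?_
    · have := h (0, m)
      rw [polar_q] at this
      simpa using this
    · refine (Module.forall_dual_apply_eq_zero_iff ℂ v.2).1 fun f => ?_
      have := h (f, 0)
      rw [polar_q] at this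
      simpa using this
  exact ⟨hi, (LinearMap.injective_iff_surjective_of_finrank_eq_finrank
    Subspace.dual_finrank_eq.symm).1 hi⟩

theorem trivectorPairing_bijective : Function.Bijective trivectorPairing := by
  refine (pairingDual_bijective 3).comp ⟨?_, ?_⟩
  · exact exteriorPower.map_injective_field polarBilin_bijective.1
  · exact exteriorPower.map_surjective polarBilin_bijective.2

/-- The isomorphism `∧³V ≃ (∧³V)^∨`. -/
def trivectorEquiv : ⋀[ℂ]^3 V ≃ₗ[ℂ] Module.Dual ℂ (⋀[ℂ]^3 V) :=
  LinearEquiv.ofBijective trivectorPairing trivectorPairing_bijective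

theorem trivectorPairing_map (g : G) (t ω : ⋀[ℂ]^3 V) :
    trivectorPairing (exteriorPower.map 3 (vectorRep g) t)
      (exteriorPower.map 3 (vectorRep g) ω) = trivectorPairing t ω := by
  refine trivector_induction (p := fun t => trivectorPairing (exteriorPower.map 3 (vectorRep g) t)
      (exteriorPower.map 3 (vectorRep g) ω) = trivectorPairing t ω) (by simp)
    (fun a b ha hb => by simp only [map_add, LinearMap.add_apply, ha, hb]) (fun a b c => ?_) t
  refine trivector_induction (p := fun ω => trivectorPairing (exteriorPower.map 3 (vectorRep g)
      (wedge3 a b c)) (exteriorPower.map 3 (vectorRep g) ω) = trivectorPairing (wedge3 a b c) ω)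
    (by simp) (fun a b ha hb => by simp only [map_add, ha, hb]) (fun a' b' c' => ?_) ω
  simp only [map_wedge3, trivectorPairing, LinearMap.comp_apply,
    exteriorPower.pairingDual_ιMulti_ιMulti]
  congr 1
  ext i j
  fin_cases i <;> fin_cases j <;> exact polar_vectorRep g _ _

/-- The map `S⁻ ⊗ S⁺ → ∧³V`. -/
def xi : half 1 →ₗ[ℂ] half 0 →ₗ[ℂ] ⋀[ℂ]^3 V :=
  LinearMap.mk₂ ℂ (fun s t => trivectorEquiv.symm ((spinForm.flip t) ∘ₗ (trivMul.flip s)))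
    (fun s s' t => by rw [← map_add]; congr 1; exact LinearMap.ext fun ω => by simp)
    (fun c s t => by rw [← map_smul]; congr 1; exact LinearMap.ext fun ω => by simp)
    (fun s t t' => by rw [← map_add]; congr 1; exact LinearMap.ext fun ω => by simp)
    (fun c s t => by rw [← map_smul]; congr 1; exact LinearMap.ext fun ω => by simp)

theorem trivectorPairing_xi (s : half 1) (t : half 0) (ω : ⋀[ℂ]^3 V) :
    trivectorPairing (xi s t) ω = spinForm (trivMul ω s) t :=
  LinearMap.congr_fun (trivectorEquiv.apply_symm_apply
    ((spinForm.flip t) ∘ₗ (trivMul.flip (s : S)))) ω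

theorem isTransposeOfTrivectorMul_xi : IsTransposeOfTrivectorMul halfForm xi := fun s t v => by
  rw [trivectorPairing_xi, halfForm_apply, coe_trivectorMul]

theorem xi_equivariant (g : G) (s : half 1) (t : half 0) :
    xi (halfSpinRep 1 g s) (halfSpinRep 0 g t) = exteriorPower.map 3 (vectorRep g) (xi s t) := by
  refine trivectorPairing_bijective.1 (LinearMap.ext fun ω => ?_)
  have h1 : exteriorPower.map 3 (vectorRep g) (exteriorPower.map 3 (vectorRep g⁻¹) ω) = ω := by
    rw [← LinearMap.comp_apply, ← exteriorPower.map_comp, ← Module.End.mul_eq_comp, ← map_mul,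
      mul_inv_cancel, map_one, Module.End.one_eq_id, exteriorPower.map_id, LinearMap.id_apply]
  rw [← h1, trivectorPairing_map, trivectorPairing_xi, trivectorPairing_xi]
  change spinForm (trivMul _ (spinRep g s)) (spinRep g t) = _
  rw [trivMul_map, spinForm_spinRep]

/-- The map `𝒰^∨(-1) ⊗ S⁺ → ∧³V ⊗ 𝒪`. -/
def homD2 : Hom ((tautDual.tensor spinLine).tensor (trivialHalf 0)) (EquivFamily.ext 3 trivialV) :=
  Hom.ofEquivariant (fun x => TensorProduct.lift (xi ∘ₗ cliffordInclusion x)) fun g x y h z => by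
    refine TensorProduct.induction_on z (by simp only [map_zero]) (fun z s => ?_)
      fun a b ha hb => by simp only [map_add, ha, hb]
    change TensorProduct.lift (xi ∘ₗ cliffordInclusion y) (TensorProduct.map
      (TensorProduct.map (tautDual.act g h) (spinLine.act g h)) (halfSpinRep 0 g) (z ⊗ₜ s)) = _
    rw [TensorProduct.map_tmul, TensorProduct.lift.tmul, TensorProduct.lift.tmul,
      LinearMap.comp_apply, LinearMap.comp_apply, cliffordInclusion_equivariant]
    exact xi_equivariant g _ _

theorem homD2_tmul (x : OGplus) (z : (tautDual.tensor spinLine).fib x) (s : half 0) :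
    homD2.app x (z ⊗ₜ[ℂ] s) = xi (cliffordHom.app x z) s := rfl

end

section

open EquivFamily

/-! ### Clifford multiplication of covectors by trivectors -/

theorem mul_ext1 {k : ℕ} (f : Module.Dual ℂ M) {s : S} (hs : s ∈ Λ k) :
    s * ext1 f = (-1 : ℂ) ^ k • (ext1 f * s) := by
  induction k generalizing s with
  | zero =>
    obtain ⟨c, rfl⟩ := Λ_zero_eq hs
    rw [pow_zero, one_smul, Algebra.commutes]
  | succ k ih =>
    refine Λ_succ_induction (p := fun s => s * ext1 f = (-1 : ℂ) ^ (k + 1) • (ext1 f * s))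
      (fun x y hx hy => by rw [add_mul, hx, hy, mul_add, smul_add]) (fun g s hs => ?_) hs
    rw [mul_assoc, ih hs, mul_smul_comm, ext1_swap, pow_succ]
    simp

/-- The trivectors of `M^∨` as trivectors of `V`. -/
def triA : ⋀[ℂ]^3 (Module.Dual ℂ M) →ₗ[ℂ] ⋀[ℂ]^3 V :=
  exteriorPower.map 3 (LinearMap.inl ℂ (Module.Dual ℂ M) M)

/-- The trivectors `u ∧ β` with `u ∈ M`, `β ∈ ∧²M^∨`. -/
def triB : M →ₗ[ℂ] ⋀[ℂ]^2 (Module.Dual ℂ M) →ₗ[ℂ] ⋀[ℂ]^3 V :=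
  ((TensorProduct.mk ℂ V (⋀[ℂ]^2 V)).compl₁₂ (LinearMap.inr ℂ (Module.Dual ℂ M) M)
    (exteriorPower.map 2 (LinearMap.inl ℂ (Module.Dual ℂ M) M))).compr₂ wedgeMul

/-- The span of the trivectors `v ∧ u ∧ u'` with `u, u' ∈ M`. -/
def triC : Submodule ℂ (⋀[ℂ]^3 V) :=
  Submodule.span ℂ {t | ∃ (v : V) (u u' : M), wedge3 v (0, u) (0, u') = t}

theorem triA_wedge3 (a b c : Module.Dual ℂ M) :
    triA (wedge3 a b c) = wedge3 (a, 0) (b, 0) (c, 0) := map_wedge3 _ a b c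

theorem triB_wedge2 (u : M) (a b : Module.Dual ℂ M) :
    triB u (wedge2 a b) = wedge3 (0, u) (a, 0) (b, 0) := by
  change wedgeMul ((0, u) ⊗ₜ exteriorPower.map 2 _ (wedge2 a b)) = _
  rw [map_wedge2, wedgeMul_tmul_wedge2]
  rfl

theorem wedge3_mem_triC (v : V) (u u' : M) : wedge3 v (0, u) (0, u') ∈ triC :=
  Submodule.subset_span ⟨v, u, u', rfl⟩

/-- Expansion of `∧³(M^∨ ⊕ M)` by the number of factors from `M`: none, exactly one, or at least
two. -/
theorem exists_trivector_decomposition (ω : ⋀[ℂ]^3 V) :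
    ∃ (α : ⋀[ℂ]^3 (Module.Dual ℂ M)) (β : Fin 6 → ⋀[ℂ]^2 (Module.Dual ℂ M)), ∃ ν ∈ triC,
      ω = triA α + ∑ k, triB (e k) (β k) + ν := by
  refine trivector_induction (p := fun ω => ∃ (α : ⋀[ℂ]^3 (Module.Dual ℂ M))
    (β : Fin 6 → ⋀[ℂ]^2 (Module.Dual ℂ M)), ∃ ν ∈ triC,
      ω = triA α + ∑ k, triB (e k) (β k) + ν) ⟨0, 0, 0, zero_mem _, by simp⟩ ?_ ?_ ω
  · rintro _ _ ⟨α, β, ν, hν, rfl⟩ ⟨α', β', ν', hν', rfl⟩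
    refine ⟨α + α', β + β', ν + ν', add_mem hν hν', ?_⟩
    simp only [map_add, Pi.add_apply, Finset.sum_add_distrib]
    abel
  · rintro ⟨a, u⟩ ⟨b, v⟩ ⟨c, x⟩
    have hB : ∀ (m : M) (β : ⋀[ℂ]^2 (Module.Dual ℂ M)), ∑ k, triB (e k) (m k • β) = triB m β :=
      fun m β => by
        conv_rhs => rw [← sum_smul_e m]
        simp only [map_sum, map_smul, LinearMap.sum_apply, LinearMap.smul_apply]
    -- `β k` collects the coefficients of `eₖ` when exactly one of the three vectors contributes its
    -- `M`-component, in cyclic order so that all signs are positive.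
    refine ⟨wedge3 a b c, fun k => u k • wedge2 b c + v k • wedge2 c a + x k • wedge2 a b,
      wedge3 (a, 0) (0, v) (0, x) + wedge3 (b, 0) (0, x) (0, u) + wedge3 (c, 0) (0, u) (0, v) +
        wedge3 (0, u) (0, v) (0, x), ?_, ?_⟩
    · exact add_mem (add_mem (add_mem (wedge3_mem_triC _ _ _) (wedge3_mem_triC _ _ _))
        (wedge3_mem_triC _ _ _)) (wedge3_mem_triC _ _ _)
    · have hsplit : ∀ (f : Module.Dual ℂ M) (m : M), ((f, m) : V) = (f, 0) + (0, m) := by simp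
      simp only [map_add, Finset.sum_add_distrib, hB, triA_wedge3, triB_wedge2]
      rw [hsplit a u, hsplit b v, hsplit c x, ← wedge3_rotate (b, 0) (0, x) (0, u),
        ← wedge3_rotate (0, x) (0, u) (b, 0), ← wedge3_rotate (c, 0) (0, u) (0, v),
        ← wedge3_rotate (0, v) (c, 0) (a, 0), ← wedge3_rotate (c, 0) (a, 0) (0, v),
        ← wedge3_rotate (0, x) (a, 0) (b, 0)]
      simp only [← wedgeMul_tmul_wedge2, map_add, LinearMap.add_apply, TensorProduct.add_tmul,
        TensorProduct.tmul_add]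
      abel

/-- Covectors anticommute in the Clifford action, so the six signed products agree and the factor
`1/6` cancels them. -/
theorem trivMul_triA (α : ⋀[ℂ]^3 (Module.Dual ℂ M)) (s : S) : trivMul (triA α) s = α * s := by
  refine trivector_induction (p := fun α => trivMul (triA α) s = α * s) (by simp)
    (fun a b ha hb => by simp only [map_add, LinearMap.add_apply, ha, hb, Submodule.coe_add,
      add_mul]) (fun a b c => ?_) α
  rw [triA_wedge3, trivMul_wedge3, coe_wedge3]
  simp only [cliffordMul_inl, mul_assoc]
  rw [ext1_swap c b, ext1_swap b a, ext1_swap c a, ext1_swap c a, ext1_swap b a]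
  simp only [mul_neg]
  rw [ext1_swap b a, ext1_swap c a, ext1_swap c b]
  simp only [mul_neg]
  module

/-- Antisymmetrization averages over the positions of `u` before, between and after the two
covectors. Moving `u` to the right creates the contraction of `β` with weights `1`, `1/2`, `0`,
whose mean is the coefficient `1/2`. -/
theorem trivMul_triB (u : M) (β : ⋀[ℂ]^2 (Module.Dual ℂ M)) (f : Module.Dual ℂ M) :
    trivMul (triB u β) (ext1 f) = f u • (β : S) + (1 / 2 : ℂ) • (ctr u β * ext1 f) := by
  refine bivector_induction (p := fun β => trivMul (triB u β) (ext1 f) =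
      f u • (β : S) + (1 / 2 : ℂ) • (ctr u β * ext1 f)) (by simp)
    (fun a b ha hb => by
      simp only [map_add, LinearMap.add_apply, ha, hb, Submodule.coe_add, add_mul, smul_add]
      abel) (fun a b => ?_) β
  have h1 : ext1 b * ext1 a = -(ext1 a * ext1 b) := by
    have := ext1_swap b a 1
    rwa [mul_one, mul_one] at this
  rw [triB_wedge2, trivMul_wedge3, coe_wedge2]
  simp only [cliffordMul_inl, cliffordMul_inr, ctr_ext1_mul, ctr_ext1,
    Algebra.algebraMap_eq_smul_one, mul_smul_comm, mul_sub, mul_one, h1, sub_mul, smul_mul_assoc]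
  module

/-- Two contractions can leave only a scalar from a covector. This scalar is, up to a constant, a
value of the contraction inclusion, which is what links `d₂` with `T` in `comul_xi`. -/
theorem trivMul_triC (v : V) (u u' : M) (f : Module.Dual ℂ M) :
    trivMul (wedge3 v (0, u) (0, u')) (ext1 f) =
      (1 / 2 * (v.1 u' * f u - v.1 u * f u') : ℂ) • (1 : S) := by
  rw [trivMul_wedge3]
  simp only [cliffordMul_inr, cliffordMul_eq v, ctr_ext1_mul, ctr_ext1, map_add, map_smul, map_sub,
    Algebra.algebraMap_eq_smul_one, mul_smul_comm, mul_one, ctr_one, smul_zero, mul_zero]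
  module

/-- In degree three, `∑ᵢ ctr eᵢ (wᵢ ∧ s)` is `(6 - 3) • s`, and every summand vanishes. -/
theorem eq_zero_of_mul_ext1 {s : S} (hs : s ∈ Λ 3) (h : ∀ f, s * ext1 f = 0) : s = 0 := by
  have h1 := sum_ctr_ext1_mul hs
  have h2 : ∀ f, ext1 f * s = 0 := fun f => by
    have := h f
    rw [mul_ext1 f hs] at this
    simpa using this
  simp only [h2, map_zero, Finset.sum_const_zero] at h1
  exact (smul_eq_zero.1 h1.symm).resolve_left (by norm_num)

/-- The trivectors killing all covectors. -/
theorem mem_triC_of_trivMul {ω : ⋀[ℂ]^3 V} (h : ∀ f, trivMul ω (ext1 f) = 0) : ω ∈ triC := by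
  obtain ⟨α, β, ν, hν, rfl⟩ := exists_trivector_decomposition ω
  have hν0 : ∀ f, trivMul ν (ext1 f) ∈ Λ 0 := fun f => by
    clear h
    induction hν using Submodule.span_induction with
    | mem t ht =>
      obtain ⟨v, u, u', rfl⟩ := ht
      rw [trivMul_triC]
      exact Submodule.smul_mem _ _ one_mem_Λ
    | zero => simp
    | add a b _ _ ha hb => rw [map_add, LinearMap.add_apply]; exact add_mem ha hb
    | smul c a _ ha => rw [map_smul, LinearMap.smul_apply]; exact Submodule.smul_mem _ _ ha
  set θ : S := ∑ k, ctr (e k) (β k) with hθ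
  have hθ1 : θ ∈ Λ 1 := Submodule.sum_mem _ fun k _ => ctr_mem (e k) (β k).2
  have h4 : ∀ f, (α : S) * ext1 f ∈ Λ 4 := fun f => mul_mem_Λ α.2 (by
    have := ext1_mul_mem f one_mem_Λ
    rwa [mul_one] at this)
  have h2 : ∀ f : Module.Dual ℂ M, ∑ k, f (e k) • (β k : S) + (1 / 2 : ℂ) • (θ * ext1 f) ∈ Λ 2 :=
    fun f => by
      refine add_mem (Submodule.sum_mem _ fun k _ => Submodule.smul_mem _ _ (β k).2)
        (Submodule.smul_mem _ _ ?_)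
      rw [mul_ext1 f hθ1]
      exact Submodule.smul_mem _ _ (ext1_mul_mem f hθ1)
  -- The three kinds of trivectors send a covector to degrees four, two and zero respectively, so
  -- the three contributions vanish separately.
  have key : ∀ f : Module.Dual ℂ M, (α : S) * ext1 f +
      (∑ k, f (e k) • (β k : S) + (1 / 2 : ℂ) • (θ * ext1 f)) + trivMul ν (ext1 f) = 0 := fun f => by
    rw [← h f]
    simp only [map_add, map_sum, LinearMap.add_apply, LinearMap.sum_apply, trivMul_triA,
      trivMul_triB, Finset.sum_add_distrib, ← Finset.smul_sum, ← Finset.sum_mul, hθ]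
  have hα : α = 0 := by
    refine Subtype.ext (eq_zero_of_mul_ext1 α.2 fun f => ?_)
    have := congrArg (cmp 4) (key f)
    rwa [map_add, map_add, cmp_of_mem (h4 f), cmp_of_mem_ne (by decide) (h2 f),
      cmp_of_mem_ne (by decide) (hν0 f), add_zero, add_zero, map_zero] at this
  have hβ : ∀ k, (β k : S) = (1 / 2 : ℂ) • (ext1 (w k) * θ) := fun k => by
    have := congrArg (cmp 2) (key (w k))
    rw [map_add, map_add, cmp_of_mem_ne (by decide) (h4 _), cmp_of_mem (h2 _),
      cmp_of_mem_ne (by decide) (hν0 _), add_zero, zero_add, map_zero, mul_ext1 _ hθ1] at this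
    simp only [w_e, ite_smul, one_smul, zero_smul, Finset.sum_ite_eq, Finset.mem_univ, if_true,
      pow_one] at this
    rw [eq_neg_of_add_eq_zero_left this]
    module
  -- Contracting `β k = ½ wₖ ∧ θ` with `eₖ` and summing gives `θ = ½ (6 - 1) θ`.
  have hθ0 : θ = 0 := by
    have h5 := sum_ctr_ext1_mul hθ1
    have h6 : θ = (1 / 2 : ℂ) • ∑ k, ctr (e k) (ext1 (w k) * θ) := by
      conv_lhs => rw [hθ]
      simp only [hβ, map_smul, Finset.smul_sum]
    rw [h5, smul_smul] at h6
    have h7 : (1 - 1 / 2 * (6 - (1 : ℕ)) : ℂ) • θ = 0 := by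
      rw [sub_smul, one_smul, ← h6, sub_self]
    exact (smul_eq_zero.1 h7).resolve_left (by norm_num)
  have hβ0 : ∀ k, β k = 0 := fun k => Subtype.ext (by rw [hβ, hθ0, mul_zero, smul_zero]; rfl)
  simpa [hα, hβ0] using hν

end

section

open EquivFamily

/-! ### Exactness at `∧³V ⊗ 𝒪` -/

theorem smul_eq_of_eq_one {E : Type} [AddCommGroup E] [Module ℂ E] {c : ℂ} (hc : c = 1) (x : E) :
    c • x = x := by
  rw [hc, one_smul]

theorem ev12_insertion {E F : Type} [AddCommGroup E] [Module ℂ E] [AddCommGroup F] [Module ℂ F]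
    (φ : Module.Dual ℂ F) (i : E →ₗ[ℂ] F) (b : Module.Basis (Fin 6) ℂ E) (f : Module.Dual ℂ E)
    (u v : E) : ev12 φ u v (insertion i b f) = φ (i u) * f v - f u * φ (i v) := by
  have h : ∀ x, φ (i x) = ∑ k, φ (i (b k)) * b.coord k x := fun x => by
    conv_lhs => rw [← b.sum_repr x]
    simp only [map_sum, map_smul, smul_eq_mul]
    exact Finset.sum_congr rfl fun k _ => mul_comm _ _
  rw [insertion_apply, map_sum, h u, h v, Finset.sum_mul, Finset.mul_sum,
    ← Finset.sum_sub_distrib]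
  refine Finset.sum_congr rfl fun k _ => ?_
  rw [ev12_tmul]
  ring

theorem eq_smul_insertion {E F : Type} [AddCommGroup E] [Module ℂ E] [Module.Finite ℂ E]
    [AddCommGroup F] [Module ℂ F] [Module.Finite ℂ F] (i : E →ₗ[ℂ] F)
    (b : Module.Basis (Fin 6) ℂ E) (f : Module.Dual ℂ E) (c : ℂ)
    {t : F ⊗[ℂ] (⋀[ℂ]^2 (Module.Dual ℂ E))}
    (h : ∀ φ u v, ev12 φ u v t = c * (φ (i u) * f v - f u * φ (i v))) :
    t = insertion i b (c • f) := by
  refine sub_eq_zero.1 (eq_zero_of_ev12 fun φ u v => ?_)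
  rw [map_sub, map_smul, map_smul, h, ev12_insertion, smul_eq_mul, sub_self]

theorem ev12_comul_xi (x : V) (u u' : base.space) (s : half 1) (t : half 0) :
    ev12 (QuadraticMap.polarBilin q x) u u' (comul (rho base) (xi s t)) =
      spinForm (trivMul (wedge3 x u u') s) t := by
  have hflip : QuadraticMap.polarBilin q = (QuadraticMap.polarBilin q).flip :=
    LinearMap.ext fun a => LinearMap.ext fun b => QuadraticMap.polar_comm _ _ _
  have h1 : ev12 ((QuadraticMap.polarBilin q).flip x) u u'
      (comul (rho base) (xi s t)) = trivectorPairing (xi s t) (wedge3 x u u') :=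
    ev12_comul (QuadraticMap.polarBilin q) base.space.subtype x _ _ _
  rw [← hflip] at h1
  rw [h1, trivectorPairing_xi]

theorem spinForm_trivMul_wedge3 (x v : V) (u u' : base.space) (t : S) :
    spinForm (trivMul (wedge3 x u u') (ext1 v.1)) t = (-(1 / 2) * spinForm 1 t : ℂ) *
      (QuadraticMap.polarBilin q x u * rho base v u' -
        rho base v u * QuadraticMap.polarBilin q x u') := by
  obtain ⟨m, hm⟩ := baseIncl.surjective u
  obtain ⟨m', hm'⟩ := baseIncl.surjective u'
  have h : ∀ (y : V) (k : M), QuadraticMap.polar q y (0, k) = y.1 k := fun y k => by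
    rw [polar_q]
    simp
  have hu : (u : V) = (0, m) := by rw [← hm, coe_baseIncl]
  have hu' : (u' : V) = (0, m') := by rw [← hm', coe_baseIncl]
  rw [rho_apply, rho_apply, QuadraticMap.polarBilin_apply_apply,
    QuadraticMap.polarBilin_apply_apply, hu, hu', h, h, h, h, trivMul_triC, map_smul,
    LinearMap.smul_apply, smul_eq_mul]
  ring

/-- By transposition, the value of the left side at `(x, u, u')` is the pairing of `(x ∧ u ∧ u') ·
v.1` with `t`. The Clifford product is a scalar, so only the pairing of `1` with `t` matters, and
its dependence on `(x, u, u')` is that of the contraction inclusion. -/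
theorem comul_xi (v : V) {s : half 1} (hs : (s : S) = ext1 v.1) (t : half 0) :
    comul (rho base) (xi s t) =
      contraction base ((-(1 / 2) * spinForm 1 t : ℂ) • rho base v) :=
  eq_smul_insertion base.space.subtype (spaceBasis base) (rho base v) _ fun φ u u' => by
    obtain ⟨x, rfl⟩ := polarBilin_bijective.2 φ
    have h := ev12_comul_xi x u u' s t
    rw [hs] at h
    exact h.trans (spinForm_trivMul_wedge3 x v u u' t)

/-- The covector `f`, as an odd spinor. -/
def oddSpinor (f : Module.Dual ℂ M) : half 1 :=
  cliffordInclusion base (rho base (f, 0) ⊗ₜ vac)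

theorem coe_oddSpinor (f : Module.Dual ℂ M) : (oddSpinor f : S) = ext1 f :=
  cliffordInclusion_vac f 0

theorem exists_rho_tmul_vac (z : Module.Dual ℂ base.space ⊗[ℂ] pureSpinors base.space) :
    ∃ f, z = rho base (f, 0) ⊗ₜ vac := by
  obtain ⟨g, rfl⟩ := exists_tmul_vac z
  exact ⟨_, by rw [rho_base_comp]⟩

/-- The map `𝒰^∨(-1) ⊗ S⁺ → ∧³V ⊗ 𝒪` on the fibre at the base point. -/
def baseD2 : (Module.Dual ℂ base.space ⊗[ℂ] pureSpinors base.space) ⊗[ℂ] half 0 →ₗ[ℂ] ⋀[ℂ]^3 V :=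
  TensorProduct.lift (xi ∘ₗ cliffordInclusion base)

theorem baseD2_tmul (f : Module.Dual ℂ M) (s : half 0) :
    baseD2 ((rho base (f, 0) ⊗ₜ vac) ⊗ₜ s) = xi (oddSpinor f) s := rfl

theorem comul_baseD2 (z : (Module.Dual ℂ base.space ⊗[ℂ] pureSpinors base.space) ⊗[ℂ] half 0) :
    comul (rho base) (baseD2 z) ∈ LinearMap.range (contraction base) := by
  refine TensorProduct.induction_on z (by simp only [map_zero, zero_mem]) (fun z s => ?_)
    fun a b ha hb => by rw [map_add, map_add]; exact add_mem ha hb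
  obtain ⟨f, rfl⟩ := exists_rho_tmul_vac z
  exact ⟨_, (comul_xi (f, 0) (coe_oddSpinor f) s).symm⟩

theorem exists_spinForm_one : ∃ t : half 0, spinForm 1 t = 1 := by
  obtain ⟨s, hs, h⟩ := exists_top_eq_one
  refine ⟨⟨s, Λ_le_half 6 hs⟩, ?_⟩
  have h1 : rev (1 : S) = 1 := by simp
  rw [spinForm_apply, h1, one_mul, h]

/-- A functional vanishing on the range of `baseD2` is the pairing with some `ω`. Vanishing against
all `xi f t` says that `ω · f` is orthogonal to `S⁺`, hence zero, for every covector `f`; so `ω`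
lies in `triC`, and its pairing with `η` is a sum of values of `comul η = 0`. -/
theorem mem_range_of_comul_eq_zero {η : ⋀[ℂ]^3 V} (h : comul (rho base) η = 0) :
    η ∈ LinearMap.range baseD2 := by
  by_contra hη
  obtain ⟨φ, hφ, hle⟩ := Submodule.exists_le_ker_of_notMem hη
  obtain ⟨ω, hω⟩ := (Module.evalEquiv ℂ (⋀[ℂ]^3 V)).surjective
    (φ ∘ₗ trivectorEquiv.symm.toLinearMap)
  have hpair : ∀ t, trivectorPairing t ω = φ t := fun t => by
    have h1 := LinearMap.congr_fun hω (trivectorEquiv t)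
    rw [LinearMap.comp_apply, LinearEquiv.coe_coe, LinearEquiv.symm_apply_apply] at h1
    exact h1
  have hω0 : ω ∈ triC := mem_triC_of_trivMul fun f => by
    have hmem : trivMul ω (ext1 f) ∈ half 0 := trivMul_mem_half ω (Λ_le_half 1 (by
      have := ext1_mul_mem f one_mem_Λ
      rwa [mul_one] at this))
    refine congrArg Subtype.val (isInvariantForm_halfForm.1.1 ⟨_, hmem⟩ fun t => ?_)
    rw [halfForm_apply]
    change spinForm (trivMul ω (ext1 f)) t = 0
    rw [← coe_oddSpinor, ← trivectorPairing_xi, hpair]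
    exact hle ⟨_, baseD2_tmul f t⟩
  refine hφ ?_
  rw [← hpair]
  clear hpair hω
  induction hω0 using Submodule.span_induction with
  | mem t ht =>
    obtain ⟨v, u, u', rfl⟩ := ht
    have h2 := ev12_comul (QuadraticMap.polarBilin q) base.space.subtype v (baseIncl u)
      (baseIncl u') η
    have h3 : comul (base.space.subtype.dualMap ∘ₗ QuadraticMap.polarBilin q) η = 0 := h
    rw [h3, map_zero] at h2
    exact h2.symm
  | zero => exact map_zero _
  | add a b _ _ ha hb => rw [map_add, ha, hb, add_zero]
  | smul c a _ ha => rw [map_smul, ha, smul_zero]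

theorem exists_comul_xi (f : Module.Dual ℂ base.space) :
    ∃ z, comul (rho base) (baseD2 z) = contraction base f := by
  obtain ⟨v, rfl⟩ := rho_surjective base f
  obtain ⟨t, ht⟩ := exists_spinForm_one
  -- The factor `-2` cancels the `-1/2` of `comul_xi`, `t` having pairing `1` with the vacuum.
  have h3 : (-(1 / 2) * spinForm 1 (((-2 : ℂ) • t : half 0) : S) : ℂ) = 1 := by
    rw [Submodule.coe_smul, map_smul, ht]
    norm_num
  exact ⟨(rho base (v.1, 0) ⊗ₜ vac) ⊗ₜ ((-2 : ℂ) • t),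
    (comul_xi v (coe_oddSpinor v.1) ((-2 : ℂ) • t)).trans
      (congrArg (contraction base) (smul_eq_of_eq_one h3 _))⟩

/-- Since every element of the contraction image is hit by `comul ∘ baseD2`, an element of the
kernel modulo that image can be corrected to one with `comul = 0`. -/
theorem exact_baseD2 : Function.Exact baseD2
    ((LinearMap.range (contraction base)).mkQ ∘ₗ comul (rho base)) := by
  intro η
  constructor
  · intro hη
    obtain ⟨f, hf⟩ := (Submodule.Quotient.mk_eq_zero (LinearMap.range (contraction base))).1 hη
    obtain ⟨z, hz⟩ := exists_comul_xi f
    obtain ⟨z', hz'⟩ := mem_range_of_comul_eq_zero (η := η - baseD2 z)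
      (((comul (rho base)).map_sub _ _).trans (sub_eq_zero.2 (hf.symm.trans hz.symm)))
    exact ⟨z' + z, (baseD2.map_add z' z).trans (by rw [hz', sub_add_cancel])⟩
  · rintro ⟨z, rfl⟩
    exact (Submodule.Quotient.mk_eq_zero (LinearMap.range (contraction base))).2 (comul_baseD2 z)

theorem homD2_exact_homD3 : homD2.Exact homD3 := homD2.exact_of_base homD3 exact_baseD2

end

section

open EquivFamily

/-! ### The kernel of the second map at the base point -/

theorem cmp_ext1_mul (f : Module.Dual ℂ M) (k : ℕ) (s : S) :
    cmp (k + 1) (ext1 f * s) = ext1 f * cmp k s := by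
  refine S_induction (p := fun s => cmp (k + 1) (ext1 f * s) = ext1 f * cmp k s) (fun j s hs => ?_)
    (by simp) (fun x y hx hy => by simp only [mul_add, map_add, hx, hy]) s
  by_cases h : j = k
  · subst h; rw [cmp_of_mem hs, cmp_of_mem (ext1_mul_mem f hs)]
  · rw [cmp_of_mem_ne h hs, cmp_of_mem_ne (by omega) (ext1_mul_mem f hs), mul_zero]

theorem rev_mem_Λ {k : ℕ} {s : S} (hs : s ∈ Λ k) : rev s ∈ Λ k := by
  induction k generalizing s with
  | zero =>
    obtain ⟨c, rfl⟩ := Λ_zero_eq hs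
    rwa [rev_algebraMap]
  | succ k ih =>
    refine Λ_succ_induction (p := fun s => rev s ∈ Λ (k + 1))
      (fun x y hx hy => by rw [map_add]; exact add_mem hx hy) (fun f s hs => ?_) hs
    rw [rev_ext1_mul, mul_ext1 f (ih hs)]
    exact Submodule.smul_mem _ _ (ext1_mul_mem f (ih hs))

theorem cmp_eq_zero_of_spinForm {j k : ℕ} (hjk : j + k = 6) {s : S}
    (h : ∀ t ∈ Λ j, spinForm t s = 0) : cmp k s = 0 :=
  cmp_eq_zero_of_top_mul hjk fun t ht => by
    have := h (rev t) (rev_mem_Λ ht)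
    rwa [spinForm_apply, rev_rev] at this

theorem spinForm_eq_zero {j k : ℕ} (hjk : j + k ≠ 6) {s t : S} (hs : s ∈ Λ j) (ht : t ∈ Λ k) :
    spinForm s t = 0 :=
  top_eq_zero hjk (mul_mem_Λ (rev_mem_Λ hs) ht)

theorem ext1_mem (f : Module.Dual ℂ M) : ext1 f ∈ Λ 1 := by
  have := ext1_mul_mem f one_mem_Λ
  rwa [mul_one] at this

section Kernel

variable (s : Fin 6 → S)

/-- Self-adjointness of covectors moves them onto the `sᵢ`; the sign is `(-1)³`, from commuting `wᵢ`
past the trivector `α`. -/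
theorem sum_spinForm_triA (α : ⋀[ℂ]^3 (Module.Dual ℂ M)) :
    ∑ i, spinForm (trivMul (triA α) (ext1 (w i))) (s i) =
      -spinForm α (∑ i, ext1 (w i) * s i) := by
  rw [map_sum, ← Finset.sum_neg_distrib]
  refine Finset.sum_congr rfl fun i _ => ?_
  rw [trivMul_triA, mul_ext1 _ α.2, map_smul, LinearMap.smul_apply, spinForm_ext1]
  norm_num

theorem sum_spinForm_triB (u : M) (β : ⋀[ℂ]^2 (Module.Dual ℂ M)) :
    ∑ i, spinForm (trivMul (triB u β) (ext1 (w i))) (s i) =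
      spinForm β (∑ i, w i u • s i - (1 / 2 : ℂ) • ctr u (∑ i, ext1 (w i) * s i)) := by
  rw [map_sub, map_smul, ← spinForm_ctr, map_sum, map_sum, Finset.smul_sum,
    ← Finset.sum_sub_distrib]
  refine Finset.sum_congr rfl fun i _ => ?_
  rw [trivMul_triB, mul_ext1 _ (ctr_mem u β.2), ← spinForm_ext1]
  simp only [map_add, map_smul, LinearMap.add_apply, LinearMap.smul_apply, smul_eq_mul]
  ring

theorem sum_spinForm_triC (v : V) (u u' : M) :
    ∑ i, spinForm (trivMul (wedge3 v (0, u) (0, u')) (ext1 (w i))) (s i) =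
      ∑ i, (1 / 2 * (v.1 u' * w i u - v.1 u * w i u') : ℂ) * spinForm 1 (s i) :=
  Finset.sum_congr rfl fun i _ => by
    rw [trivMul_triC, map_smul, LinearMap.smul_apply, smul_eq_mul]

/-- The family is tested separately on the three types of trivectors; nondegeneracy of the wedge
pairing in complementary degrees turns each test into a condition on homogeneous components. -/
theorem cmp_of_sum_spinForm (h : ∀ ω, ∑ i, spinForm (trivMul ω (ext1 (w i))) (s i) = 0) :
    (∀ i, cmp 4 (s i) = 0) ∧ (∀ i, cmp 6 (s i) = 0) ∧ ∑ i, ext1 (w i) * cmp 2 (s i) = 0 := by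
  set Y := ∑ i, ext1 (w i) * s i with hY
  have hcY : ∀ k, cmp (k + 1) Y = ∑ i, ext1 (w i) * cmp k (s i) := fun k => by
    simp only [hY, map_sum, cmp_ext1_mul]
  refine ⟨?_, fun i => ?_, ?_⟩
  -- The test trivectors are `eₖ ∧ β`, with `β` of degree two, the degree complementary to four.
  · have h1 : ∀ k, cmp 4 (s k) = (1 / 2 : ℂ) • ctr (e k) (cmp 5 Y) := fun k => by
      have h2 : cmp 4 (∑ i, w i (e k) • s i - (1 / 2 : ℂ) • ctr (e k) Y) = 0 :=
        cmp_eq_zero_of_spinForm (j := 2) rfl fun β hβ => by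
          rw [hY, ← sum_spinForm_triB s (e k) ⟨β, hβ⟩, h]
      simp only [w_e, ite_smul, one_smul, zero_smul, Finset.sum_ite_eq', Finset.mem_univ,
        if_true, map_sub, map_smul] at h2
      rw [ctr_cmp_succ, sub_eq_zero.1 h2]
    -- Multiplying the previous relation by `wₖ` and summing, the number operator contributes `5`,
    -- so `Y₅ = (5/2) Y₅`.
    have h3 : cmp 5 Y = (5 / 2 : ℂ) • cmp 5 Y := by
      conv_lhs => rw [hcY]
      simp only [h1, mul_smul_comm, ← Finset.smul_sum]
      rw [sum_ext1_mul_ctr (cmp_mem 5 Y), smul_smul]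
      norm_num
    have h4 : cmp 5 Y = 0 := by
      have : (1 - 5 / 2 : ℂ) • cmp 5 Y = 0 := by rw [sub_smul, one_smul, ← h3, sub_self]
      exact (smul_eq_zero.1 this).resolve_left (by norm_num)
    exact fun i => by rw [h1, h4, map_zero, smul_zero]
  · refine cmp_eq_zero_of_spinForm (j := 0) rfl fun t ht => ?_
    obtain ⟨c, rfl⟩ := Λ_zero_eq ht
    obtain ⟨j, hj, -⟩ := exists_ne_ne i i
    -- For `j ≠ i` this trivector sends `wₖ` to `½ δₖᵢ`, so it isolates the degree-six component of
    -- `sᵢ`.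
    have h1 := h (wedge3 (w j, 0) (0, e i) (0, e j))
    rw [sum_spinForm_triC] at h1
    simp only [w_e, if_neg hj, if_true] at h1
    rw [Finset.sum_eq_single i] at h1
    · rw [Algebra.algebraMap_eq_smul_one, map_smul, LinearMap.smul_apply]
      simpa using Or.inr h1
    · intro k _ hk
      simp [hk]
    · simp
  · rw [← hcY]
    refine cmp_eq_zero_of_spinForm (j := 3) rfl fun α hα => ?_
    have h1 := h (triA ⟨α, hα⟩)
    rw [sum_spinForm_triA] at h1
    exact neg_eq_zero.1 h1

/-- A degree count: the `sᵢ` live in degrees zero and two, and `∑ wᵢ sᵢ` in degree one. After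
adjunction, no type of trivector produces terms in complementary degrees. -/
theorem sum_spinForm_of_cmp (hs : ∀ i, s i ∈ half 0) (h4 : ∀ i, cmp 4 (s i) = 0)
    (h6 : ∀ i, cmp 6 (s i) = 0) (h2 : ∑ i, ext1 (w i) * cmp 2 (s i) = 0) (ω : ⋀[ℂ]^3 V) :
    ∑ i, spinForm (trivMul ω (ext1 (w i))) (s i) = 0 := by
  have hsi : ∀ i, s i = cmp 0 (s i) + cmp 2 (s i) := fun i => by
    conv_lhs => rw [eq_of_half_zero (hs i), h4, h6, add_zero, add_zero]
  have hY : ∑ i, ext1 (w i) * s i ∈ Λ 1 := by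
    have h1 : ∑ i, ext1 (w i) * s i = ∑ i, ext1 (w i) * cmp 0 (s i) := by
      rw [← add_zero (∑ i, ext1 (w i) * cmp 0 (s i)), ← h2, ← Finset.sum_add_distrib]
      exact Finset.sum_congr rfl fun i _ => by rw [← mul_add, ← hsi]
    rw [h1]
    exact Submodule.sum_mem _ fun i _ => ext1_mul_mem _ (cmp_mem 0 _)
  have hsp : ∀ {k : ℕ} {t : S}, t ∈ Λ k → k < 4 → ∀ i, spinForm t (s i) = 0 :=
    fun {k t} ht hk i => by
      rw [hsi, map_add, spinForm_eq_zero (by omega) ht (cmp_mem 0 _),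
        spinForm_eq_zero (by omega) ht (cmp_mem 2 _), add_zero]
  obtain ⟨α, β, ν, hν, rfl⟩ := exists_trivector_decomposition ω
  have hA := sum_spinForm_triA s α
  rw [spinForm_eq_zero (by decide) α.2 hY, neg_zero] at hA
  have hB : ∀ k, ∑ i, spinForm (trivMul (triB (e k) (β k)) (ext1 (w i))) (s i) = 0 := fun k => by
    rw [sum_spinForm_triB, map_sub, map_sum, map_smul,
      spinForm_eq_zero (by decide) (β k).2 (ctr_mem (e k) hY), smul_zero, sub_zero]
    exact Finset.sum_eq_zero fun i _ => by
      rw [map_smul, hsp (β k).2 (by decide), smul_zero]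
  have hC : ∑ i, spinForm (trivMul ν (ext1 (w i))) (s i) = 0 := by
    induction hν using Submodule.span_induction with
    | mem t ht =>
      obtain ⟨v, u, u', rfl⟩ := ht
      rw [sum_spinForm_triC]
      exact Finset.sum_eq_zero fun i _ => by rw [hsp one_mem_Λ (by decide), mul_zero]
    | zero => simp
    | add a b _ _ ha hb =>
      simp only [map_add, LinearMap.add_apply, Finset.sum_add_distrib, ha, hb, add_zero]
    | smul c a _ ha =>
      simp only [map_smul, LinearMap.smul_apply, ← Finset.smul_sum, ha, smul_zero]
  simp only [map_add, map_sum, LinearMap.add_apply, LinearMap.sum_apply, Finset.sum_add_distrib, hA,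
    hC, add_zero, zero_add]
  rw [Finset.sum_comm]
  exact Finset.sum_eq_zero fun k _ => hB k

end Kernel

/-- The element `∑ᵢ wᵢ ⊗ 1 ⊗ sᵢ` of the fibre of `𝒰^∨(-1) ⊗ S⁺` at the base point. -/
def baseElt : (Fin 6 → half 0) →ₗ[ℂ]
    (Module.Dual ℂ base.space ⊗[ℂ] pureSpinors base.space) ⊗[ℂ] half 0 :=
  ∑ i, TensorProduct.mk ℂ _ _ (rho base (w i, 0) ⊗ₜ[ℂ] vac) ∘ₗ LinearMap.proj i

theorem baseElt_apply (s : Fin 6 → half 0) :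
    baseElt s = ∑ i, (rho base (w i, 0) ⊗ₜ[ℂ] vac) ⊗ₜ[ℂ] s i := by
  rw [baseElt, LinearMap.sum_apply]
  rfl

theorem baseElt_surjective : Function.Surjective baseElt := by
  intro z
  refine TensorProduct.induction_on z ⟨0, map_zero _⟩ (fun z s => ?_) ?_
  · obtain ⟨f, rfl⟩ := exists_rho_tmul_vac z
    refine ⟨fun i => f (e i) • s, ?_⟩
    have h : rho base (f, 0) = ∑ i, f (e i) • rho base (w i, 0) := by
      conv_lhs => rw [← sum_smul_w f]
      have h1 : (∑ i, f (e i) • w i, (0 : M)) = ∑ i, f (e i) • ((w i, 0) : V) :=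
        Prod.ext (by simp [Prod.fst_sum]) (by simp [Prod.snd_sum])
      rw [h1, map_sum]
      simp only [map_smul]
    rw [baseElt_apply, h, TensorProduct.sum_tmul, TensorProduct.sum_tmul]
    refine Finset.sum_congr rfl fun i _ => ?_
    rw [TensorProduct.tmul_smul, TensorProduct.smul_tmul', TensorProduct.smul_tmul']
  · rintro _ _ ⟨a, rfl⟩ ⟨b, rfl⟩
    exact ⟨a + b, map_add _ _ _⟩

theorem baseD2_baseElt (s : Fin 6 → half 0) :
    baseD2 (baseElt s) = ∑ i, xi (oddSpinor (w i)) (s i) := by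
  rw [baseElt_apply, map_sum]
  rfl

theorem baseD2_baseElt_eq_zero_iff (s : Fin 6 → half 0) : baseD2 (baseElt s) = 0 ↔
    (∀ i, cmp 4 (s i : S) = 0) ∧ (∀ i, cmp 6 (s i : S) = 0) ∧
      ∑ i, ext1 (w i) * cmp 2 (s i : S) = 0 := by
  have h : ∀ ω, trivectorPairing (baseD2 (baseElt s)) ω =
      ∑ i, spinForm (trivMul ω (ext1 (w i))) (s i) := fun ω => by
    rw [baseD2_baseElt, map_sum, LinearMap.sum_apply]
    exact Finset.sum_congr rfl fun i _ => by rw [trivectorPairing_xi, coe_oddSpinor]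
  constructor
  · intro h0
    exact cmp_of_sum_spinForm (fun i => s i) fun ω => by
      rw [← h, h0, map_zero, LinearMap.zero_apply]
  · rintro ⟨h4, h6, h2⟩
    refine trivectorPairing_bijective.1 (LinearMap.ext fun ω => ?_)
    rw [h, map_zero, LinearMap.zero_apply]
    exact sum_spinForm_of_cmp (fun i => s i) (fun i => (s i).2) h4 h6 h2 ω

end

section

open EquivFamily

/-! ### Twists at the base point -/

/-- The coordinate of a pure spinor of the base point with respect to the vacuum. -/
def vacCoord : pureSpinors base.space →ₗ[ℂ] ℂ :=
  (ExteriorAlgebra.algebraMapInv (R := ℂ) (M := Module.Dual ℂ M)).toLinearMap ∘ₗ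
    (pureSpinors base.space).subtype

theorem vacCoord_vac : vacCoord vac = 1 := map_one ExteriorAlgebra.algebraMapInv

theorem exists_act_vac (g : G) (h : g • base = base) :
    ∃ c : ℂ, c ≠ 0 ∧ spinLine.act g h vac = c • vac := by
  obtain ⟨c, hc⟩ := exists_smul_vac (spinLine.act g h vac)
  refine ⟨c, fun h0 => ?_, hc⟩
  rw [h0, zero_smul] at hc
  have h1 : vac = 0 := (spinLine.actEquiv g h).map_eq_zero_iff.1 hc
  have h2 := vacCoord_vac
  rw [h1, map_zero] at h2
  exact zero_ne_one h2

section Twist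

variable {A : Type} [AddCommGroup A] [Module ℂ A]

/-- The isomorphism `A ≃ A ⊗ L ⊗ L` given by the vacuum of the line `L` of pure spinors. -/
def twistVac : A →ₗ[ℂ] (A ⊗[ℂ] pureSpinors base.space) ⊗[ℂ] pureSpinors base.space :=
  (TensorProduct.mk ℂ (A ⊗[ℂ] pureSpinors base.space) (pureSpinors base.space)).flip vac ∘ₗ
    (TensorProduct.mk ℂ A (pureSpinors base.space)).flip vac

theorem twistVac_apply (a : A) : twistVac a = (a ⊗ₜ[ℂ] vac) ⊗ₜ[ℂ] vac := rfl

theorem twistVac_surjective : Function.Surjective (twistVac (A := A)) := by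
  intro t
  obtain ⟨b, rfl⟩ := exists_tmul_vac t
  obtain ⟨a, rfl⟩ := exists_tmul_vac b
  exact ⟨a, rfl⟩

/-- The inverse of `twistVac`. -/
def untwistVac : (A ⊗[ℂ] pureSpinors base.space) ⊗[ℂ] pureSpinors base.space →ₗ[ℂ] A :=
  (TensorProduct.rid ℂ A).toLinearMap ∘ₗ TensorProduct.map
    ((TensorProduct.rid ℂ A).toLinearMap ∘ₗ TensorProduct.map LinearMap.id vacCoord) vacCoord

theorem untwistVac_twistVac (a : A) : untwistVac (twistVac a) = a := by
  rw [untwistVac, twistVac_apply]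
  simp [vacCoord_vac]

theorem twistVac_injective : Function.Injective (twistVac (A := A)) :=
  Function.LeftInverse.injective untwistVac_twistVac

/-- The stabilizer acts on the line of pure spinors by a scalar `c`, so twisting twice only
multiplies the action by `c²`. -/
theorem map_twistVac (f : A →ₗ[ℂ] A) (k : pureSpinors base.space →ₗ[ℂ] pureSpinors base.space)
    {c : ℂ} (hk : k vac = c • vac) (a : A) :
    TensorProduct.map (TensorProduct.map f k) k (twistVac a) = c ^ 2 • twistVac (f a) := by
  rw [twistVac_apply, TensorProduct.map_tmul, TensorProduct.map_tmul, hk, twistVac_apply]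
  simp only [TensorProduct.tmul_smul, ← TensorProduct.smul_tmul', smul_smul, sq]

end Twist

/-! ### The kernel of the second map -/

/-- The kernel of `𝒰^∨(-1) ⊗ S⁺ → ∧³V ⊗ 𝒪`. -/
abbrev bundleR : EquivFamily :=
  ((tautDual.tensor spinLine).tensor (trivialHalf 0)).sub
    (fun x => LinearMap.ker (homD2.app x)) fun g x y h v hv => by
      rw [LinearMap.mem_ker] at hv ⊢
      rw [homD2.equivariant g h, hv, map_zero]

/-- The inclusion of the kernel. -/
def homD1 : Hom bundleR ((tautDual.tensor spinLine).tensor (trivialHalf 0)) :=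
  Hom.ofEquivariant (fun x => (LinearMap.ker (homD2.app x)).subtype) fun _ _ _ _ _ => rfl

theorem homD1_injective : homD1.Injective := fun _ => Subtype.val_injective

theorem homD1_exact_homD2 : homD1.Exact homD2 := fun x =>
  LinearMap.exact_subtype_ker_map (homD2.app x)

theorem isAlgebraic_bundleR : bundleR.IsAlgebraic :=
  ((isAlgebraic_tautDual.tensor isAlgebraic_spinLine).tensor (isAlgebraic_trivialHalf 0)).sub _

/-- The inclusion of the pure spinors into the even spinors. -/
def spinIncl (x : OGplus) : pureSpinors x.space →ₗ[ℂ] half 0 :=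
  Submodule.inclusion fun _ hs => pureSpinors_le_half x hs

theorem spinIncl_injective (x : OGplus) : Function.Injective (spinIncl x) :=
  Submodule.inclusion_injective _

/-- The inclusion `𝒰^∨(-2) → 𝒰^∨(-1) ⊗ S⁺`. -/
def twistIncl : Hom (twistNeg tautDual 2) ((tautDual.tensor spinLine).tensor (trivialHalf 0)) :=
  Hom.ofEquivariant (E := (tautDual.tensor spinLine).tensor spinLine)
    (fun x => LinearMap.lTensor _ (spinIncl x)) fun g x y h z => by
      refine TensorProduct.induction_on z (by simp only [map_zero]) (fun z s => rfl)
        fun a b ha hb => by simp only [map_add, ha, hb]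

theorem twistIncl_injective : twistIncl.Injective := fun x =>
  Module.Flat.lTensor_preserves_injective_linearMap
    (M := Module.Dual ℂ x.space ⊗[ℂ] pureSpinors x.space) (spinIncl x) (spinIncl_injective x)

theorem baseElt_smul (f : Module.Dual ℂ M) (s : half 0) :
    baseElt (fun i => f (e i) • s) = (rho base (f, 0) ⊗ₜ[ℂ] vac) ⊗ₜ[ℂ] s := by
  have h : rho base (f, 0) = ∑ i, f (e i) • rho base (w i, 0) := by
    conv_lhs => rw [← sum_smul_w f]
    have h1 : (∑ i, f (e i) • w i, (0 : M)) = ∑ i, f (e i) • ((w i, 0) : V) :=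
      Prod.ext (by simp [Prod.fst_sum]) (by simp [Prod.snd_sum])
    rw [h1, map_sum]
    simp only [map_smul]
  rw [baseElt_apply, h, TensorProduct.sum_tmul, TensorProduct.sum_tmul]
  refine Finset.sum_congr rfl fun i _ => ?_
  rw [TensorProduct.tmul_smul, TensorProduct.smul_tmul', TensorProduct.smul_tmul']

theorem baseD2_baseElt_of_mem {s : Fin 6 → half 0} (hs : ∀ i, (s i : S) ∈ Λ 0) :
    baseD2 (baseElt s) = 0 := by
  rw [baseD2_baseElt_eq_zero_iff]
  exact ⟨fun i => cmp_of_mem_ne (by decide) (hs i), fun i => cmp_of_mem_ne (by decide) (hs i),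
    Finset.sum_eq_zero fun i _ => by rw [cmp_of_mem_ne (by decide) (hs i), mul_zero]⟩

/-- The vacuum as an even spinor. -/
def evenVac : half 0 := spinIncl base vac

theorem twistIncl_twistVac (f : Module.Dual ℂ M) :
    twistIncl.app base (twistVac (rho base (f, 0))) = baseElt fun i => f (e i) • evenVac :=
  (baseElt_smul f evenVac).symm

theorem exists_rho_eq (f : Module.Dual ℂ base.space) : ∃ k, rho base (k, 0) = f :=
  ⟨_, rho_base_comp f 0⟩

theorem homD2_twistIncl_base (z : (twistNeg tautDual 2).fib base) :
    homD2.app base (twistIncl.app base z) = 0 := by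
  obtain ⟨f, rfl⟩ := twistVac_surjective (A := Module.Dual ℂ base.space) z
  obtain ⟨k, rfl⟩ := exists_rho_eq f
  refine (congrArg baseD2 (twistIncl_twistVac k)).trans (baseD2_baseElt_of_mem fun i => ?_)
  exact Submodule.smul_mem _ _ one_mem_Λ

theorem homD2_twistIncl (x : OGplus) (z : (twistNeg tautDual 2).fib x) :
    homD2.app x (twistIncl.app x z) = 0 := by
  obtain ⟨g, hg⟩ := exists_smul_base x
  apply ((EquivFamily.ext 3 trivialV).actEquiv g hg).symm.map_eq_zero_iff.1
  change (EquivFamily.ext 3 trivialV).act g⁻¹ (EquivFamily.inv_smul_eq hg) _ = 0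
  rw [← homD2.app_act_inv g hg, ← twistIncl.app_act_inv g hg]
  exact homD2_twistIncl_base _

/-- The inclusion of `𝒰^∨(-2)` into the kernel. -/
def homIncl : Hom (twistNeg tautDual 2) bundleR :=
  Hom.ofEquivariant (fun x => (twistIncl.app x).codRestrict _ (homD2_twistIncl x))
    fun g _ _ h z => Subtype.ext (twistIncl.equivariant g h z)

theorem homIncl_injective : homIncl.Injective := fun x _ _ h =>
  twistIncl_injective x (congrArg Subtype.val h)

/-! ### The symbol of a spinor of degree at most two -/

/-- The isomorphism `M^∨ ≃ U^∨` at the base point. -/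
def baseRho : Module.Dual ℂ M →ₗ[ℂ] Module.Dual ℂ base.space :=
  rho base ∘ₗ LinearMap.inl ℂ (Module.Dual ℂ M) M

theorem baseRho_apply (f : Module.Dual ℂ M) : baseRho f = rho base (f, 0) := rfl

theorem rho_base_eq (v : V) : rho base v = baseRho v.1 := by
  rw [baseRho_apply, ← sub_eq_zero, ← map_sub, rho_base_eq_zero_iff]
  simp

theorem baseRho_injective : Function.Injective baseRho :=
  (injective_iff_map_eq_zero _).2 fun _ hf => (rho_base_eq_zero_iff _).1 hf

theorem baseRho_surjective : Function.Surjective baseRho := exists_rho_eq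

/-- The component of degree two. -/
def cmpTwo : half 0 →ₗ[ℂ] ⋀[ℂ]^2 (Module.Dual ℂ M) :=
  (cmp 2 ∘ₗ (half 0).subtype).codRestrict _ fun s => cmp_mem 2 s

theorem coe_cmpTwo (s : half 0) : (cmpTwo s : S) = cmp 2 s := rfl

/-- The component of degree two, as an element of `∧²U^∨`. -/
def symbol : half 0 →ₗ[ℂ] ⋀[ℂ]^2 (Module.Dual ℂ base.space) :=
  exteriorPower.map 2 baseRho ∘ₗ cmpTwo

theorem symbol_of_mem {s : half 0} (hs : (s : S) ∈ Λ 0) : symbol s = 0 := by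
  have h : cmpTwo s = 0 := Subtype.ext (cmp_of_mem_ne (by decide) hs)
  rw [symbol, LinearMap.comp_apply, h, map_zero]

/-- The even spinor `v · v' · 1`. -/
def pairSpinor (v v' : V) : half 0 :=
  ⟨cliffordMul v (cliffordMul v' 1),
    cliffordMul_mem_half v 1 (cliffordMul_mem_half v' 0 (Λ_le_half 0 one_mem_Λ))⟩

/-- Modulo scalars, `v · v' · 1` is the wedge of the covector parts; the contraction contributes
only in degree zero. -/
theorem symbol_pairSpinor (v v' : V) :
    symbol (pairSpinor v v') = wedge2 (rho base v) (rho base v') := by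
  have h : cmpTwo (pairSpinor v v') = wedge2 v.1 v'.1 := Subtype.ext <| by
    rw [coe_cmpTwo, coe_wedge2]
    change cmp 2 (cliffordMul v (cliffordMul v' 1)) = _
    rw [cliffordMul_eq, cliffordMul_eq, ctr_one, add_zero, mul_one, ctr_ext1, map_add,
      cmp_of_mem (ext1_mul_mem _ (ext1_mem _)),
      cmp_of_mem_ne (j := 0) (by decide) (by
        rw [Algebra.algebraMap_eq_smul_one]
        exact Submodule.smul_mem _ _ one_mem_Λ), add_zero]
  exact (congrArg (exteriorPower.map 2 baseRho) h).trans ((map_wedge2 baseRho _ _).trans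
    (congrArg₂ (fun a b => wedge2 a b) (rho_base_eq v).symm (rho_base_eq v').symm))

theorem map_symbol_pairSpinor (g : G) (h : g • base = base) (v v' : V) :
    exteriorPower.map 2 (tautDual.act g h) (symbol (pairSpinor v v')) =
      symbol (pairSpinor (vectorRep g v) (vectorRep g v')) :=
  (congrArg (exteriorPower.map 2 (tautDual.act g h)) (symbol_pairSpinor v v')).trans
    ((map_wedge2 (tautDual.act g h) _ _).trans ((congrArg₂ (fun a b => wedge2 a b)
      (rho_equivariant g h v).symm (rho_equivariant g h v').symm).trans
        (symbol_pairSpinor _ _).symm))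

/-- Clifford multiplication is equivariant and `g` scales the vacuum by `c`, so acting on `v · v' ·
1` amounts to moving the two vectors and multiplying by `c`. -/
theorem act_pairSpinor {g : G} {h : g • base = base} {c : ℂ}
    (hc : spinLine.act g h vac = c • vac) (v v' : V) :
    halfSpinRep 0 g (pairSpinor v v') = c • pairSpinor (vectorRep g v) (vectorRep g v') := by
  have h1 : spinRep g 1 = c • 1 := congrArg Subtype.val hc
  refine Subtype.ext ?_
  change spinRep g (cliffordMul v (cliffordMul v' 1)) =
    c • cliffordMul (vectorRep g v) (cliffordMul (vectorRep g v') 1)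
  rw [← cliffordMul_vectorRep, ← cliffordMul_vectorRep, h1, map_smul, map_smul]

/-- Spinors of degree at most two are sums of scalars and of `v · v' · 1`, so these generators
determine a linear map on them. -/
theorem eq_of_eq_pairSpinor {B : Type} [AddCommGroup B] [Module ℂ B] (f k : half 0 →ₗ[ℂ] B)
    (h0 : ∀ t : half 0, (t : S) ∈ Λ 0 → f t = k t)
    (h2 : ∀ v v', f (pairSpinor v v') = k (pairSpinor v v')) {s : half 0}
    (h4 : cmp 4 (s : S) = 0) (h6 : cmp 6 (s : S) = 0) : f s = k s := by
  have h3 : ∀ x : ⋀[ℂ]^2 (Module.Dual ℂ M), f ⟨x, Λ_le_half 2 x.2⟩ = k ⟨x, Λ_le_half 2 x.2⟩ := by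
    refine bivector_induction (h0 _ (zero_mem _)) (fun x y hx hy => ?_) fun a b => ?_
    · have hs : (⟨_, Λ_le_half 2 (x + y).2⟩ : half 0) =
        ⟨x, Λ_le_half 2 x.2⟩ + ⟨y, Λ_le_half 2 y.2⟩ := rfl
      rw [hs, map_add, map_add, hx, hy]
    · have hs : (⟨_, Λ_le_half 2 (wedge2 a b).2⟩ : half 0) = pairSpinor (a, 0) (b, 0) :=
        Subtype.ext <| by
          change (wedge2 a b : S) = cliffordMul (a, 0) (cliffordMul (b, 0) 1)
          rw [cliffordMul_inl, cliffordMul_inl, mul_one]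
          exact coe_wedge2 a b
      rw [hs, h2]
  have hs : s = ⟨cmp 0 s, Λ_le_half 0 (cmp_mem 0 _)⟩ + ⟨cmp 2 s, Λ_le_half 2 (cmp_mem 2 _)⟩ :=
    Subtype.ext <| by
      conv_lhs => rw [eq_of_half_zero s.2, h4, h6, add_zero, add_zero]
      rfl
  rw [hs, map_add, map_add, h0 _ (cmp_mem 0 _), h3 ⟨_, cmp_mem 2 _⟩]

/-- The stabilizer does not preserve the degree-two part, since its unipotent radical acts by double
contractions. It does preserve degree zero and permutes the `v · v' · 1` up to `c`, so the symbol of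
spinors of degree at most two is equivariant up to that character. -/
theorem symbol_act {g : G} {h : g • base = base} {c : ℂ}
    (hc : spinLine.act g h vac = c • vac) {s : half 0} (h4 : cmp 4 (s : S) = 0)
    (h6 : cmp 6 (s : S) = 0) :
    symbol (halfSpinRep 0 g s) = c • exteriorPower.map 2 (tautDual.act g h) (symbol s) := by
  refine eq_of_eq_pairSpinor (symbol ∘ₗ halfSpinRep 0 g)
    (c • exteriorPower.map 2 (tautDual.act g h) ∘ₗ symbol) (fun t ht => ?_) (fun v v' => ?_) h4 h6
  · have h1 : (halfSpinRep 0 g t : S) ∈ Λ 0 := by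
      rw [← mem_pureSpinors_base] at ht ⊢
      exact (spinLine.act g h ⟨t, ht⟩).2
    have h2 : c • exteriorPower.map 2 (tautDual.act g h) (symbol t) = 0 := by
      rw [symbol_of_mem ht, map_zero, smul_zero]
    exact (symbol_of_mem h1).trans h2.symm
  · exact (congrArg symbol (act_pairSpinor hc _ _)).trans ((symbol.map_smul _ _).trans
      (congrArg (c • ·) (map_symbol_pairSpinor g h _ _).symm))

end

section

open EquivFamily

/-! ### The quotient of the kernel by `𝒰^∨(-2)` -/

section Coordinates

variable {F : Type} [AddCommGroup F] [Module ℂ F]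

theorem exists_sum_w_tmul {A : Type} [AddCommGroup A] [Module ℂ A]
    (t : Module.Dual ℂ M ⊗[ℂ] A) : ∃ x : Fin 6 → A, t = ∑ i, w i ⊗ₜ x i := by
  induction t with
  | zero => exact ⟨0, by simp⟩
  | add a b ha hb =>
    obtain ⟨x, rfl⟩ := ha
    obtain ⟨y, rfl⟩ := hb
    exact ⟨x + y, by simp [TensorProduct.tmul_add, Finset.sum_add_distrib]⟩
  | tmul f a =>
    refine ⟨fun i => f (e i) • a, ?_⟩
    conv_lhs => rw [← sum_smul_w f]
    simp only [TensorProduct.sum_tmul, TensorProduct.tmul_smul, TensorProduct.smul_tmul']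

theorem eq_zero_of_sum_w_tmul {A : Type} [AddCommGroup A] [Module ℂ A] {x : Fin 6 → A}
    (h : ∑ i, w i ⊗ₜ[ℂ] x i = 0) (j : Fin 6) : x j = 0 := by
  have h1 := congrArg ((TensorProduct.lid ℂ A).toLinearMap ∘ₗ
    LinearMap.rTensor A (Module.Dual.eval ℂ M (e j))) h
  rw [map_sum, map_zero] at h1
  simpa [w_e] using h1

theorem map_injective_of_injective {r : Module.Dual ℂ M →ₗ[ℂ] F} (hr : Function.Injective r) :
    Function.Injective (TensorProduct.map r (exteriorPower.map 2 r)) := by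
  obtain ⟨k, hk⟩ := LinearMap.exists_leftInverse_of_injective r (LinearMap.ker_eq_bot.2 hr)
  refine Function.LeftInverse.injective (g := TensorProduct.map k (exteriorPower.map 2 k)) fun t => ?_
  rw [← LinearMap.comp_apply, ← TensorProduct.map_comp, ← exteriorPower.map_comp, hk,
    exteriorPower.map_id, TensorProduct.map_id, LinearMap.id_apply]

theorem wedge_sum_w_tmul (x : Fin 6 → ⋀[ℂ]^2 (Module.Dual ℂ M)) :
    wedge (Module.Dual ℂ M) (∑ i, w i ⊗ₜ[ℂ] x i) = ∑ i, ext1 (w i) * (x i : S) := by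
  rw [map_sum]
  rfl

theorem wedge_map_sum {r : Module.Dual ℂ M →ₗ[ℂ] F} (hr : Function.Injective r)
    (x : Fin 6 → ⋀[ℂ]^2 (Module.Dual ℂ M)) :
    wedge F (TensorProduct.map r (exteriorPower.map 2 r) (∑ i, w i ⊗ₜ[ℂ] x i)) = 0 ↔
      ∑ i, ext1 (w i) * (x i : S) = 0 := by
  rw [wedge_natural, wedge_sum_w_tmul]
  exact (ExteriorAlgebra.map_injective_field (LinearMap.ker_eq_bot.2 hr)).eq_iff' (map_zero _)

end Coordinates

section Symbol

variable {A B F : Type} [AddCommGroup A] [Module ℂ A] [AddCommGroup B] [Module ℂ B]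
  [AddCommGroup F] [Module ℂ F]

/-- The map `A ⊗ L ⊗ B → A ⊗ F` induced by `B → F` and the vacuum of the line `L`. -/
def vacMap (f : B →ₗ[ℂ] F) : (A ⊗[ℂ] pureSpinors base.space) ⊗[ℂ] B →ₗ[ℂ] A ⊗[ℂ] F :=
  TensorProduct.map ((TensorProduct.rid ℂ A).toLinearMap ∘ₗ
    TensorProduct.map LinearMap.id vacCoord) f

theorem vacMap_tmul (f : B →ₗ[ℂ] F) (a : A) (b : B) :
    vacMap f ((a ⊗ₜ[ℂ] vac) ⊗ₜ[ℂ] b) = a ⊗ₜ f b := by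
  rw [vacMap, TensorProduct.map_tmul]
  simp [vacCoord_vac]

theorem vacMap_map_tmul (f : B →ₗ[ℂ] F) (k : A →ₗ[ℂ] A)
    (l : pureSpinors base.space →ₗ[ℂ] pureSpinors base.space) (b : B →ₗ[ℂ] B) (d : F →ₗ[ℂ] F)
    {c : ℂ} (hl : l vac = c • vac) (x : A) (y : B) (h : f (b y) = c • d (f y)) :
    vacMap f (TensorProduct.map (TensorProduct.map k l) b ((x ⊗ₜ[ℂ] vac) ⊗ₜ[ℂ] y)) =
      c ^ 2 • TensorProduct.map k d (vacMap f ((x ⊗ₜ[ℂ] vac) ⊗ₜ[ℂ] y)) := by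
  rw [TensorProduct.map_tmul, TensorProduct.map_tmul, hl, TensorProduct.tmul_smul,
    ← TensorProduct.smul_tmul', map_smul, vacMap_tmul, vacMap_tmul, h, TensorProduct.map_tmul,
    TensorProduct.tmul_smul, smul_smul, sq]

/-- The map induced by a linear map on `Σ²¹`. -/
def mapSchur (k : A →ₗ[ℂ] A) : LinearMap.ker (wedge A) →ₗ[ℂ] LinearMap.ker (wedge A) :=
  (TensorProduct.map k (exteriorPower.map 2 k)).restrict fun t ht => by
    rw [LinearMap.mem_ker] at ht ⊢
    rw [wedge_natural, ht, map_zero]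

variable (r : Module.Dual ℂ M →ₗ[ℂ] A) (hr : Function.Bijective r)

/-- The element `∑ᵢ r(wᵢ) ⊗ 1 ⊗ sᵢ`. -/
def vacElt (s : Fin 6 → half 0) : (A ⊗[ℂ] pureSpinors base.space) ⊗[ℂ] half 0 :=
  ∑ i, (r (w i) ⊗ₜ[ℂ] vac) ⊗ₜ[ℂ] s i

theorem vacMap_vacElt (s : Fin 6 → half 0) : vacMap (exteriorPower.map 2 r ∘ₗ cmpTwo) (vacElt r s) =
    TensorProduct.map r (exteriorPower.map 2 r) (∑ i, w i ⊗ₜ[ℂ] cmpTwo (s i)) := by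
  rw [vacElt, map_sum, map_sum]
  simp only [vacMap_tmul, TensorProduct.map_tmul, LinearMap.comp_apply]

theorem vacMap_map_vacElt (f : half 0 →ₗ[ℂ] F) (k : A →ₗ[ℂ] A)
    (l : pureSpinors base.space →ₗ[ℂ] pureSpinors base.space) (b : half 0 →ₗ[ℂ] half 0)
    (d : F →ₗ[ℂ] F) {c : ℂ} (hl : l vac = c • vac) (s : Fin 6 → half 0)
    (h : ∀ i, f (b (s i)) = c • d (f (s i))) :
    vacMap f (TensorProduct.map (TensorProduct.map k l) b (vacElt r s)) =
      c ^ 2 • TensorProduct.map k d (vacMap f (vacElt r s)) := by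
  rw [vacElt, map_sum, map_sum, map_sum, map_sum, Finset.smul_sum]
  exact Finset.sum_congr rfl fun i _ => vacMap_map_tmul f k l b d hl _ _ (h i)

/-- The conditions on the coordinates of an element of the kernel. -/
def KerCond (s : Fin 6 → half 0) : Prop :=
  (∀ i, cmp 4 (s i : S) = 0) ∧ (∀ i, cmp 6 (s i : S) = 0) ∧ ∑ i, ext1 (w i) * cmp 2 (s i : S) = 0

variable {r} {K : Submodule ℂ ((A ⊗[ℂ] pureSpinors base.space) ⊗[ℂ] half 0)}
  (hK : ∀ z ∈ K, ∃ s, KerCond s ∧ vacElt r s = z)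

/-- The symbol of an element of the kernel. -/
def symbolKer : K →ₗ[ℂ] LinearMap.ker (wedge A) :=
  (vacMap (exteriorPower.map 2 r ∘ₗ cmpTwo) ∘ₗ K.subtype).codRestrict _ fun z => by
    obtain ⟨s, hs, h⟩ := hK z z.2
    rw [LinearMap.comp_apply, Submodule.subtype_apply, ← h, LinearMap.mem_ker, vacMap_vacElt,
      wedge_map_sum hr.1]
    exact hs.2.2

theorem symbolKer_surjective (hK' : ∀ s, KerCond s → vacElt r s ∈ K) :
    Function.Surjective (symbolKer hr hK) := by
  rintro ⟨y, hy⟩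
  obtain ⟨t, rfl⟩ := TensorProduct.map_surjective hr.2
    (exteriorPower.map_surjective (n := 2) hr.2) y
  obtain ⟨x, rfl⟩ := exists_sum_w_tmul t
  have hx := (wedge_map_sum hr.1 x).1 hy
  let s : Fin 6 → half 0 := fun i => ⟨x i, Λ_le_half 2 (x i).2⟩
  have hs : ∀ i, cmpTwo (s i) = x i := fun i => Subtype.ext (cmp_of_mem (x i).2)
  refine ⟨⟨vacElt r s, hK' s ⟨fun i => cmp_of_mem_ne (by decide) (x i).2,
    fun i => cmp_of_mem_ne (by decide) (x i).2, ?_⟩⟩, Subtype.ext ?_⟩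
  · rw [← hx]
    exact Finset.sum_congr rfl fun i _ => congrArg (ext1 (w i) * ·) (congrArg Subtype.val (hs i))
  · refine (vacMap_vacElt r s).trans ?_
    simp only [hs]

/-- The twisted symbol of an element of the kernel. -/
def twistedSymbol : K →ₗ[ℂ]
    (LinearMap.ker (wedge A) ⊗[ℂ] pureSpinors base.space) ⊗[ℂ] pureSpinors base.space :=
  twistVac ∘ₗ symbolKer hr hK

theorem twistedSymbol_surjective (hK' : ∀ s, KerCond s → vacElt r s ∈ K) :
    Function.Surjective (twistedSymbol hr hK) :=
  twistVac_surjective.comp (symbolKer_surjective hr hK hK')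

theorem twistedSymbol_eq_zero_iff {s : Fin 6 → half 0} (hs : vacElt r s ∈ K) :
    twistedSymbol hr hK ⟨vacElt r s, hs⟩ = 0 ↔ ∀ i, cmp 2 (s i : S) = 0 := by
  have h1 : twistedSymbol hr hK ⟨vacElt r s, hs⟩ = 0 ↔
      TensorProduct.map r (exteriorPower.map 2 r) (∑ i, w i ⊗ₜ[ℂ] cmpTwo (s i)) = 0 := by
    rw [← vacMap_vacElt]
    exact (twistVac_injective.eq_iff' (map_zero _)).trans Subtype.ext_iff
  refine h1.trans (((map_injective_of_injective hr.1).eq_iff' (map_zero _)).trans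
    ⟨fun h i => ?_, fun h => ?_⟩)
  · exact congrArg Subtype.val (eq_zero_of_sum_w_tmul h i)
  · refine Finset.sum_eq_zero fun i _ => ?_
    have : cmpTwo (s i) = 0 := Subtype.ext (h i)
    rw [this, TensorProduct.tmul_zero]

/-- One factor `c` comes from the line in the source and one from the action on the symbol; together
they match the two twists of the target. -/
theorem twistedSymbol_map (k : A →ₗ[ℂ] A)
    (l : pureSpinors base.space →ₗ[ℂ] pureSpinors base.space) (b : half 0 →ₗ[ℂ] half 0) {c : ℂ}
    (hl : l vac = c • vac) (hb : ∀ s : half 0, cmp 4 (s : S) = 0 → cmp 6 (s : S) = 0 →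
      exteriorPower.map 2 r (cmpTwo (b s)) =
        c • exteriorPower.map 2 k (exteriorPower.map 2 r (cmpTwo s)))
    (z : K) (hz : TensorProduct.map (TensorProduct.map k l) b z.1 ∈ K) :
    twistedSymbol hr hK ⟨TensorProduct.map (TensorProduct.map k l) b z.1, hz⟩ =
      TensorProduct.map (TensorProduct.map (mapSchur k) l) l (twistedSymbol hr hK z) := by
  have h1 : symbolKer hr hK ⟨TensorProduct.map (TensorProduct.map k l) b z.1, hz⟩ =
      c ^ 2 • mapSchur k (symbolKer hr hK z) := by
    obtain ⟨s, hs, h⟩ := hK z z.2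
    refine Subtype.ext ?_
    change vacMap (exteriorPower.map 2 r ∘ₗ cmpTwo) (TensorProduct.map (TensorProduct.map k l) b z.1)
      = c ^ 2 • TensorProduct.map k (exteriorPower.map 2 k)
        (vacMap (exteriorPower.map 2 r ∘ₗ cmpTwo) z.1)
    rw [← h]
    exact vacMap_map_vacElt r _ k l b _ hl s fun i => hb _ (hs.1 i) (hs.2.1 i)
  exact (congrArg twistVac h1).trans ((twistVac.map_smul _ _).trans
    (map_twistVac (mapSchur k) l hl (symbolKer hr hK z)).symm)

end Symbol

theorem baseRho_bijective : Function.Bijective baseRho := ⟨baseRho_injective, baseRho_surjective⟩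

theorem vacElt_mem_ker_iff (s : Fin 6 → half 0) :
    vacElt baseRho s ∈ LinearMap.ker (homD2.app base) ↔ KerCond s := by
  have h : vacElt baseRho s = baseElt s := (baseElt_apply s).symm
  rw [h]
  exact baseD2_baseElt_eq_zero_iff s

theorem exists_vacElt {z : ((tautDual.tensor spinLine).tensor (trivialHalf 0)).fib base}
    (hz : z ∈ LinearMap.ker (homD2.app base)) : ∃ s, KerCond s ∧ vacElt baseRho s = z := by
  obtain ⟨s, rfl⟩ := baseElt_surjective z
  have h : vacElt baseRho s = baseElt s := (baseElt_apply s).symm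
  exact ⟨s, (baseD2_baseElt_eq_zero_iff s).1 hz, h⟩

/-- The projection of the kernel onto `𝒰_{ω₁+ω₂}(-2)` at the base point. -/
def baseProj : bundleR.fib base →ₗ[ℂ] (twistNeg schurDual 2).fib base :=
  twistedSymbol baseRho_bijective (fun _ hz => exists_vacElt hz)

theorem baseProj_act (g : G) (h : g • base = base) (z : bundleR.fib base) :
    baseProj (bundleR.act g h z) = (twistNeg schurDual 2).act g h (baseProj z) := by
  obtain ⟨c, -, hc⟩ := exists_act_vac g h
  exact twistedSymbol_map baseRho_bijective (fun _ hz => exists_vacElt hz) (tautDual.act g h)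
    (spinLine.act g h) (halfSpinRep 0 g) hc (fun s h4 h6 => symbol_act hc h4 h6) z
    (bundleR.act g h z).2

/-- The projection of the kernel onto `𝒰_{ω₁+ω₂}(-2)`. -/
def homProj : Hom bundleR (twistNeg schurDual 2) := Hom.ofBase baseProj baseProj_act

theorem homProj_app_base : homProj.app base = baseProj := Hom.ofBase_app_base _ _

theorem baseProj_surjective : Function.Surjective baseProj :=
  twistedSymbol_surjective baseRho_bijective (fun _ hz => exists_vacElt hz)
    fun s hs => (vacElt_mem_ker_iff s).2 hs

theorem baseElt_injective : Function.Injective baseElt := by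
  refine (injective_iff_map_eq_zero _).2 fun s hs => funext fun j => ?_
  have h1 := congrArg ((TensorProduct.lid ℂ (half 0)).toLinearMap ∘ₗ LinearMap.rTensor (half 0)
    (LinearMap.mul' ℂ ℂ ∘ₗ
      TensorProduct.map (Module.Dual.eval ℂ base.space (baseIncl (e j))) vacCoord)) hs
  rw [baseElt_apply, map_sum, map_zero] at h1
  simpa [w_e, vacCoord_vac, rho_base_apply] using h1

/-- The symbol of a kernel element vanishes exactly when all coordinates `sᵢ` are scalars, that is,
when the element lies in `𝒰^∨ ⊗ 𝒪(-1) ⊗ 𝒪(-1)`. -/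
theorem homIncl_exact_baseProj : Function.Exact (homIncl.app base) baseProj := by
  rintro ⟨z, hz⟩
  obtain ⟨s, hs, rfl⟩ := exists_vacElt hz
  refine (twistedSymbol_eq_zero_iff baseRho_bijective (fun _ hz => exists_vacElt hz) hz).trans
    ⟨fun h2 => ?_, ?_⟩
  · have hs : ∀ i, ∃ c : ℂ, s i = c • evenVac := fun i => by
      have h0 : (s i : S) = cmp 0 (s i : S) := by
        conv_lhs => rw [eq_of_half_zero (s i).2, h2, hs.1, hs.2.1, add_zero, add_zero, add_zero]
      obtain ⟨c, hc⟩ := Λ_zero_eq (cmp_mem 0 (s i : S))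
      refine ⟨c, Subtype.ext ?_⟩
      rw [h0, ← hc, Algebra.algebraMap_eq_smul_one]
      rfl
    choose c hc using hs
    -- With `sᵢ = cᵢ · 1`, the element `∑ wᵢ ⊗ 1 ⊗ sᵢ` is the single covector `∑ cᵢ wᵢ` tensored
    -- twice with the vacuum.
    refine ⟨twistVac (rho base (∑ i, c i • w i, 0)), Subtype.ext ?_⟩
    refine (twistIncl_twistVac _).trans ((congrArg baseElt (funext fun i => ?_)).trans
      (baseElt_apply s))
    rw [hc]
    simp [w_e]
  · rintro ⟨y, hy⟩
    obtain ⟨f, rfl⟩ := twistVac_surjective (A := Module.Dual ℂ base.space) y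
    obtain ⟨k, rfl⟩ := exists_rho_eq f
    have hz' : baseElt (fun i => k (e i) • evenVac) = baseElt s :=
      (twistIncl_twistVac k).symm.trans ((congrArg Subtype.val hy).trans (baseElt_apply s).symm)
    rw [← baseElt_injective hz']
    exact fun i => cmp_of_mem_ne (j := 0) (by decide) (Submodule.smul_mem _ _ one_mem_Λ)

theorem homIncl_shortExact_homProj : homIncl.ShortExact homProj :=
  ⟨homIncl_injective, homIncl.exact_of_base homProj (by
    rw [homProj_app_base]; exact homIncl_exact_baseProj), homProj.surjective_of_base (by
    rw [homProj_app_base]; exact baseProj_surjective)⟩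

end

section

open EquivFamily

/-! ### Irreducibility of `Σ²¹` under transvections -/

/-- The elementary endomorphism `f ↦ f(eⱼ) wᵢ`. -/
def elem (i j : Fin 6) : Module.End ℂ (Module.Dual ℂ M) :=
  (LinearMap.toSpanSingleton ℂ _ (w i)) ∘ₗ Module.Dual.eval ℂ M (e j)

theorem elem_apply (i j : Fin 6) (f : Module.Dual ℂ M) : elem i j f = f (e j) • w i := rfl

/-- The space `M^∨ ⊗ ∧²M^∨`. -/
abbrev T21 : Type := Module.Dual ℂ M ⊗[ℂ] (⋀[ℂ]^2 (Module.Dual ℂ M))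

/-- The action of an endomorphism on `M^∨ ⊗ ∧²M^∨`. -/
def tensorAct (k : Module.End ℂ (Module.Dual ℂ M)) : T21 →ₗ[ℂ] T21 :=
  TensorProduct.map k (exteriorPower.map 2 k)

theorem tensorAct_tmul (k : Module.End ℂ (Module.Dual ℂ M)) (a b c : Module.Dual ℂ M) :
    tensorAct k (a ⊗ₜ wedge2 b c) = k a ⊗ₜ wedge2 (k b) (k c) := by
  rw [tensorAct, TensorProduct.map_tmul, map_wedge2]

/-- The linear term of the action of `1 + t eᵢⱼ`. -/
def linOp (i j : Fin 6) : T21 →ₗ[ℂ] T21 :=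
  (1 / 2 : ℂ) • (tensorAct (1 + (1 : ℂ) • elem i j) - tensorAct (1 + (-1 : ℂ) • elem i j))

/-- The quadratic term of the action of `1 + t eᵢⱼ`. -/
def sqOp (i j : Fin 6) : T21 →ₗ[ℂ] T21 :=
  (1 / 2 : ℂ) • (tensorAct (1 + (1 : ℂ) • elem i j) + tensorAct (1 + (-1 : ℂ) • elem i j)) -
    LinearMap.id

/-- The action of `1 + t eᵢⱼ` has no cubic term, because it would contain `wᵢ ∧ wᵢ`. Hence the
half-difference at `t = ±1` is exactly the linear term, and the half-sum minus the identity exactly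
the quadratic one. -/
theorem linOp_tmul (i j : Fin 6) (a b c : Module.Dual ℂ M) :
    linOp i j (a ⊗ₜ wedge2 b c) = a (e j) • (w i ⊗ₜ[ℂ] wedge2 b c) +
      b (e j) • (a ⊗ₜ[ℂ] wedge2 (w i) c) + c (e j) • (a ⊗ₜ[ℂ] wedge2 b (w i)) := by
  simp only [linOp, LinearMap.smul_apply, LinearMap.sub_apply, tensorAct_tmul, LinearMap.add_apply,
    Module.End.one_apply, elem_apply, map_add, map_smul, wedge2_self, TensorProduct.add_tmul,
    TensorProduct.tmul_add, TensorProduct.tmul_smul, ← TensorProduct.smul_tmul', smul_zero,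
    TensorProduct.tmul_zero]
  module

theorem sqOp_tmul (i j : Fin 6) (a b c : Module.Dual ℂ M) :
    sqOp i j (a ⊗ₜ wedge2 b c) =
      w i ⊗ₜ[ℂ] wedge2 (w i) ((a (e j) * b (e j)) • c - (a (e j) * c (e j)) • b) := by
  simp only [sqOp, LinearMap.smul_apply, LinearMap.sub_apply, tensorAct_tmul, LinearMap.add_apply,
    Module.End.one_apply, elem_apply, map_add, map_sub, map_smul, wedge2_self,
    TensorProduct.add_tmul, TensorProduct.tmul_add, TensorProduct.tmul_sub, LinearMap.id_apply,
    TensorProduct.tmul_smul, ← TensorProduct.smul_tmul', smul_zero, TensorProduct.tmul_zero]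
  rw [wedge2_swap b (w i)]
  simp only [TensorProduct.tmul_neg]
  module

/-- The coordinates of an element of `M^∨ ⊗ ∧²M^∨`. -/
def coord21 (a b c : Fin 6) : T21 →ₗ[ℂ] ℂ := ev12 (Module.Dual.eval ℂ M (e a)) (e b) (e c)

theorem coord21_tmul (a b c : Fin 6) (f g h : Module.Dual ℂ M) :
    coord21 a b c (f ⊗ₜ wedge2 g h) = f (e a) * (g (e b) * h (e c) - h (e b) * g (e c)) :=
  ev12_tmul _ _ _ _ _ _

theorem coord21_swap (a b c : Fin 6) (t : T21) : coord21 a c b t = -coord21 a b c t := by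
  refine tensor_wedge_induction (p := fun t => coord21 a c b t = -coord21 a b c t) (by simp)
    (fun x y hx hy => by rw [map_add, map_add, hx, hy]; ring) (fun f g h => ?_) t
  rw [coord21_tmul, coord21_tmul]
  ring

/-- The cyclic sum is the value at `(eₐ, e_b, e_c)` of the wedge product of `t`. -/
theorem coord21_cyclic (a b c : Fin 6) {t : T21} (ht : wedge (Module.Dual ℂ M) t = 0) :
    coord21 a b c t + coord21 b c a t + coord21 c a b t = 0 := by
  have h : ∀ t, coord21 a b c t + coord21 b c a t + coord21 c a b t =
      exteriorPower.pairingDual ℂ M 3 (wedgeMul t) (wedge3 (e a) (e b) (e c)) := fun t => by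
    refine tensor_wedge_induction (p := fun t => coord21 a b c t + coord21 b c a t +
      coord21 c a b t = exteriorPower.pairingDual ℂ M 3 (wedgeMul t)
        (wedge3 (e a) (e b) (e c))) (by simp)
      (fun x y hx hy => by simp only [map_add, LinearMap.add_apply, ← hx, ← hy]; ring)
      (fun f g h => ?_) t
    rw [wedgeMul_tmul_wedge2, exteriorPower.pairingDual_ιMulti_ιMulti, Matrix.det_fin_three,
      coord21_tmul, coord21_tmul, coord21_tmul]
    simp only [Matrix.of_apply, Matrix.cons_val]
    ring
  rw [h, (wedgeMul_eq_zero_iff t).2 ht, map_zero, LinearMap.zero_apply]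

theorem eq_zero_of_coord21 {t : T21} (h : ∀ a b c, coord21 a b c t = 0) : t = 0 := by
  refine eq_zero_of_ev12 fun φ u v => ?_
  obtain ⟨m, rfl⟩ := (Module.evalEquiv ℂ M).surjective φ
  have h1 : ev12 (Module.Dual.eval ℂ M m) u v t =
      ∑ a, ∑ b, ∑ c, m a * u b * v c * coord21 a b c t := by
    refine tensor_wedge_induction (p := fun t => ev12 (Module.Dual.eval ℂ M m) u v t =
      ∑ a, ∑ b, ∑ c, m a * u b * v c * coord21 a b c t) (by simp)
      (fun x y hx hy => by simp only [map_add, hx, hy, mul_add, Finset.sum_add_distrib])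
      (fun f g k => ?_) t
    have hf : ∀ (f : Module.Dual ℂ M) (m : M), f m = ∑ a, m a * f (e a) := fun f m => by
      conv_lhs => rw [← sum_smul_e m]
      simp
    simp only [coord21_tmul]
    rw [ev12_tmul, Module.Dual.eval_apply, hf f, hf g u, hf g v, hf k u, hf k v,
      Finset.sum_mul_sum, Finset.sum_mul_sum, ← Finset.sum_sub_distrib, Finset.sum_mul]
    refine Finset.sum_congr rfl fun a _ => ?_
    rw [Finset.mul_sum]
    refine Finset.sum_congr rfl fun b _ => ?_
    rw [← Finset.sum_sub_distrib, Finset.mul_sum]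
    exact Finset.sum_congr rfl fun c _ => by ring
  exact h1.trans (by simp [h])

/-- The vector `∑ₖ T_{j,jk} wₖ`. -/
def diagCoord (j : Fin 6) : T21 →ₗ[ℂ] Module.Dual ℂ M :=
  ∑ k, LinearMap.toSpanSingleton ℂ _ (w k) ∘ₗ coord21 j j k

theorem diagCoord_apply (j : Fin 6) (t : T21) :
    diagCoord j t = ∑ k, coord21 j j k t • w k := by
  rw [diagCoord, LinearMap.sum_apply]
  rfl

theorem diagCoord_e (j k : Fin 6) (t : T21) : diagCoord j t (e k) = coord21 j j k t := by
  rw [diagCoord_apply]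
  simp [w_e]

theorem sqOp_apply (i j : Fin 6) (t : T21) :
    sqOp i j t = w i ⊗ₜ[ℂ] wedge2 (w i) (diagCoord j t) := by
  refine tensor_wedge_induction (p := fun t =>
    sqOp i j t = w i ⊗ₜ[ℂ] wedge2 (w i) (diagCoord j t)) (by simp)
    (fun x y hx hy => by simp only [map_add, TensorProduct.tmul_add, hx, hy]) (fun f g h => ?_) t
  rw [sqOp_tmul, diagCoord_apply]
  congr 2
  simp only [coord21_tmul, mul_sub, sub_smul, Finset.sum_sub_distrib, mul_smul, ← Finset.smul_sum,
    sum_smul_w]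

theorem coord21_linOp {i j k : Fin 6} (hk : k ≠ i) (t : T21) :
    coord21 i i k (linOp i j t) = coord21 j i k t + coord21 i j k t := by
  refine tensor_wedge_induction (p := fun t =>
    coord21 i i k (linOp i j t) = coord21 j i k t + coord21 i j k t) (by simp)
    (fun x y hx hy => by simp only [map_add, hx, hy]; ring) (fun f g h => ?_) t
  rw [linOp_tmul]
  simp only [map_add, map_smul, coord21_tmul, w_e, if_true, if_neg hk.symm, smul_eq_mul]
  ring

/-- The element `a ⊗ (b ∧ c) + b ⊗ (a ∧ c)`. -/
def symElt : Module.Dual ℂ M →ₗ[ℂ] Module.Dual ℂ M →ₗ[ℂ] Module.Dual ℂ M →ₗ[ℂ] T21 :=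
  LinearMap.mk₂ ℂ (fun a b => TensorProduct.mk ℂ _ _ a ∘ₗ wedge2 b +
      TensorProduct.mk ℂ _ _ b ∘ₗ wedge2 a)
    (fun a a' b => LinearMap.ext fun c => by simp [TensorProduct.tmul_add]; abel)
    (fun c a b => LinearMap.ext fun d => by simp)
    (fun a b b' => LinearMap.ext fun c => by simp [TensorProduct.tmul_add]; abel)
    (fun c a b => LinearMap.ext fun d => by simp)

theorem symElt_apply (a b c : Module.Dual ℂ M) :
    symElt a b c = a ⊗ₜ wedge2 b c + b ⊗ₜ wedge2 a c := rfl

/-- This shows that `Σ²¹` is spanned by differences of the elements `symElt`, so a subspace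
containing all of these contains `Σ²¹`. -/
theorem coe_proj21_tmul (a b c : Module.Dual ℂ M) :
    (proj21 (a ⊗ₜ[ℂ] wedge2 b c) : T21) = (1 / 3 : ℂ) • (symElt a b c - symElt a c b) := by
  rw [coe_proj21, wedgeMul_tmul_wedge2, polarize_wedge3, symElt_apply, symElt_apply,
    wedge2_swap c b, wedge2_swap c a]
  simp only [TensorProduct.tmul_neg]
  module

section Stable

variable {N : Submodule ℂ T21}
  (hN : ∀ i j, i ≠ j → ∀ (c : ℂ), ∀ t ∈ N, tensorAct (1 + c • elem i j) t ∈ N)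

include hN

theorem linOp_mem {i j : Fin 6} (hij : i ≠ j) {t : T21} (ht : t ∈ N) : linOp i j t ∈ N :=
  N.smul_mem _ (sub_mem (hN i j hij _ t ht) (hN i j hij _ t ht))

theorem sqOp_mem {i j : Fin 6} (hij : i ≠ j) {t : T21} (ht : t ∈ N) : sqOp i j t ∈ N :=
  sub_mem (N.smul_mem _ (add_mem (hN i j hij _ t ht) (hN i j hij _ t ht))) ht

/-- A nonzero stable subspace of `Σ²¹` contains an element `wᵢ ⊗ (wᵢ ∧ wⱼ)`. -/
theorem exists_highest_mem (hk : N ≤ LinearMap.ker (wedge (Module.Dual ℂ M))) (h0 : N ≠ ⊥) :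
    ∃ i j, i ≠ j ∧ w i ⊗ₜ wedge2 (w i) (w j) ∈ N := by
  obtain ⟨t, ht, j, k, hjk⟩ : ∃ t ∈ N, ∃ j k, coord21 j j k t ≠ 0 := by
    -- If all coordinates `T_{jjk}` vanish on `N`, applying this to `linOp` of elements of `N` makes
    -- them skew in the first two indices. They are then totally skew, and the cyclic identity
    -- becomes `3 T = 0`.
    by_contra! hcon
    refine h0 ((Submodule.eq_bot_iff _).2 fun t ht => eq_zero_of_coord21 ?_)
    have hd : ∀ a b, coord21 a b a t = 0 := fun a b => by
      rw [coord21_swap, hcon t ht, neg_zero]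
    have hs : ∀ a b, coord21 a b b t = 0 := fun a b => by
      have := coord21_swap a b b t
      exact self_eq_neg.1 this
    have hanti : ∀ a b c, coord21 b a c t = -coord21 a b c t := fun a b c => by
      by_cases hab : a = b
      · subst hab; rw [hcon t ht, neg_zero]
      by_cases hca : c = a
      · subst hca; rw [hs, hd, neg_zero]
      have := hcon _ (linOp_mem hN hab ht) a c
      rw [coord21_linOp hca] at this
      exact eq_neg_of_add_eq_zero_left this
    intro a b c
    have h1 := coord21_cyclic a b c (hk ht)
    rw [coord21_swap b a c, hanti a b c, hanti a c b, coord21_swap a b c] at h1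
    have h2 : (3 : ℂ) * coord21 a b c t = 0 := by linear_combination h1
    simpa using h2
  have hjk' : k ≠ j := fun h => hjk (by
    subst h
    exact self_eq_neg.1 (coord21_swap k k k t))
  obtain ⟨i, hij, hik⟩ := exists_ne_ne j k
  refine ⟨i, j, hij, ?_⟩
  -- For `i ≠ j, k`, the quadratic operator for `(i, j)` produces `wᵢ ⊗ (wᵢ ∧ ∑ₗ T_{jjl} wₗ)`; the
  -- linear operator for `(j, k)` then extracts the nonzero coefficient `T_{jjk}` and puts `wⱼ` in
  -- its place.
  have h1 := linOp_mem hN hjk'.symm (sqOp_mem hN hij ht)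
  rw [sqOp_apply, linOp_tmul, diagCoord_e] at h1
  simp only [w_e, if_neg hik, zero_smul, zero_add] at h1
  exact (Submodule.smul_mem_iff _ hjk).1 h1

theorem highest_mem {i j : Fin 6} (hij : i ≠ j) (h : w i ⊗ₜ wedge2 (w i) (w j) ∈ N) (a b : Fin 6) :
    w a ⊗ₜ wedge2 (w a) (w b) ∈ N := by
  have h1 : ∀ {i j a : Fin 6}, i ≠ j → a ≠ j → w i ⊗ₜ wedge2 (w i) (w j) ∈ N →
      w a ⊗ₜ wedge2 (w a) (w j) ∈ N := fun {i j a} hij haj h => by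
    by_cases hai : a = i
    · rwa [hai]
    have := sqOp_mem hN hai h
    rw [sqOp_tmul] at this
    simpa [w_e, hij.symm] using this
  have h2 : ∀ {i j b : Fin 6}, i ≠ j → w i ⊗ₜ wedge2 (w i) (w j) ∈ N →
      w i ⊗ₜ wedge2 (w i) (w b) ∈ N := fun {i j b} hij h => by
    by_cases hbj : b = j
    · rwa [hbj]
    have := linOp_mem hN hbj h
    rw [linOp_tmul] at this
    simpa [w_e, hij] using this
  -- Both moves need distinct indices, so if the target `a` equals `j`, the second index is first
  -- moved out of the way to a third index `k`.
  by_cases haj : a = j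
  · subst haj
    obtain ⟨k, hka, hki⟩ := exists_ne_ne a i
    exact h2 hka.symm (h1 hki.symm hka.symm (h2 hij h))
  · exact h2 haj (h1 hij haj h)

/-- Polarization: the linear operator for `(a, b)` applied to `w_b ⊗ (w_b ∧ w_c)` replaces each
`w_b` in turn by `w_a`. -/
theorem symElt_mem {i j : Fin 6} (hij : i ≠ j) (h : w i ⊗ₜ wedge2 (w i) (w j) ∈ N)
    (a b c : Module.Dual ℂ M) : symElt a b c ∈ N := by
  have hv := highest_mem hN hij h
  have hw : ∀ a b c, symElt (w a) (w b) (w c) ∈ N := fun a b c => by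
    by_cases hab : a = b
    · subst hab
      rw [symElt_apply]
      exact add_mem (hv _ _) (hv _ _)
    by_cases hbc : b = c
    · subst hbc
      rw [symElt_apply, wedge2_self, TensorProduct.tmul_zero, zero_add, wedge2_swap,
        TensorProduct.tmul_neg]
      exact neg_mem (hv _ _)
    have := linOp_mem hN hab (hv b c)
    rw [linOp_tmul] at this
    simpa [w_e, Ne.symm hbc, symElt_apply] using this
  rw [← sum_smul_w a, ← sum_smul_w b, ← sum_smul_w c]
  simp only [map_sum, LinearMap.sum_apply, map_smul, LinearMap.smul_apply]
  exact Submodule.sum_mem _ fun _ _ => Submodule.smul_mem _ _ (Submodule.sum_mem _ fun _ _ =>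
    Submodule.smul_mem _ _ (Submodule.sum_mem _ fun _ _ => Submodule.smul_mem _ _ (hw _ _ _)))

/-- `Σ²¹` is irreducible under transvections. -/
theorem eq_bot_or_ker_wedge_le (hk : N ≤ LinearMap.ker (wedge (Module.Dual ℂ M))) :
    N = ⊥ ∨ LinearMap.ker (wedge (Module.Dual ℂ M)) ≤ N := by
  refine or_iff_not_imp_left.2 fun h0 t ht => ?_
  obtain ⟨i, j, hij, h⟩ := exists_highest_mem hN hk h0
  have hp : ∀ t : T21, (proj21 t : T21) ∈ N := fun t => by
    refine tensor_wedge_induction (p := fun t : T21 => (proj21 t : T21) ∈ N) (by simp)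
      (fun x y hx hy => by rw [map_add]; exact add_mem hx hy) (fun f a b => ?_) t
    rw [coe_proj21_tmul]
    exact N.smul_mem _ (sub_mem (symElt_mem hN hij h _ _ _) (symElt_mem hN hij h _ _ _))
  have := hp t
  rwa [proj21_of_mem ⟨t, ht⟩] at this

end Stable

end

section

open EquivFamily

/-! ### Irreducible bundles -/

/-- Irreducibility can be checked at the base point. -/
theorem EquivFamily.IsIrreducible.of_base {E : EquivFamily} (h0 : Nontrivial (E.fib base))
    (h : ∀ N : Submodule ℂ (E.fib base),
      (∀ (g : G) (h : g • base = base), ∀ v ∈ N, E.act g h v ∈ N) → N = ⊥ ∨ N = ⊤) :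
    E.IsIrreducible := by
  refine ⟨⟨base, h0⟩, fun N hN => (h (N base) fun g h => hN g h).imp (fun hb x => ?_) fun hb x => ?_⟩
  · obtain ⟨g, hg⟩ := exists_smul_base x
    refine (Submodule.eq_bot_iff _).2 fun v hv => ?_
    have h1 := hN g⁻¹ (inv_smul_eq hg) v hv
    rw [hb, Submodule.mem_bot] at h1
    rw [← E.act_act_inv hg (inv_smul_eq hg) v, h1, map_zero]
  · obtain ⟨g, hg⟩ := exists_smul_base x
    refine (Submodule.eq_top_iff'.2 fun v => ?_)
    have h1 := hN g hg (E.act g⁻¹ (inv_smul_eq hg) v) (by rw [hb]; trivial)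
    rwa [E.act_act_inv] at h1

theorem eq_bot_or_eq_top_of_comap_twistVac {A : Type} [AddCommGroup A] [Module ℂ A]
    (N : Submodule ℂ ((A ⊗[ℂ] pureSpinors base.space) ⊗[ℂ] pureSpinors base.space))
    (h : N.comap twistVac = ⊥ ∨ N.comap twistVac = ⊤) : N = ⊥ ∨ N = ⊤ := by
  refine h.imp (fun hb => (Submodule.eq_bot_iff _).2 fun v hv => ?_) fun hb =>
    Submodule.eq_top_iff'.2 fun v => ?_
  · obtain ⟨a, rfl⟩ := twistVac_surjective v
    have h2 : a ∈ N.comap twistVac := hv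
    rw [hb, Submodule.mem_bot] at h2
    rw [h2, map_zero]
  · obtain ⟨a, rfl⟩ := twistVac_surjective v
    have h2 : a ∈ N.comap twistVac := by rw [hb]; trivial
    exact h2

theorem mem_of_map_twistVac_mem {A : Type} [AddCommGroup A] [Module ℂ A]
    {N : Submodule ℂ ((A ⊗[ℂ] pureSpinors base.space) ⊗[ℂ] pureSpinors base.space)}
    {f : A →ₗ[ℂ] A} {k : pureSpinors base.space →ₗ[ℂ] pureSpinors base.space} {c : ℂ} (hc : c ≠ 0)
    (hk : k vac = c • vac) {a : A}
    (h : TensorProduct.map (TensorProduct.map f k) k (twistVac a) ∈ N) : twistVac (f a) ∈ N := by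
  rw [map_twistVac f k hk] at h
  exact (Submodule.smul_mem_iff N (pow_ne_zero 2 hc)).1 h

/-- Twisting rescales each stabilizer element by a nonzero scalar, so the stable subspaces are the
same. -/
theorem isIrreducible_twistNeg_two {E : EquivFamily} (h0 : Nontrivial (E.fib base))
    (h : ∀ N : Submodule ℂ (E.fib base),
      (∀ (g : G) (h : g • base = base), ∀ v ∈ N, E.act g h v ∈ N) → N = ⊥ ∨ N = ⊤) :
    (twistNeg E 2).IsIrreducible :=
  EquivFamily.IsIrreducible.of_base (E := (E.tensor spinLine).tensor spinLine)
    (twistVac_injective (A := E.fib base)).nontrivial fun N hN =>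
      eq_bot_or_eq_top_of_comap_twistVac N (h _ fun g hg v hv => by
        obtain ⟨c, hc, hk⟩ := exists_act_vac g hg
        exact mem_of_map_twistVac_mem hc hk (hN g hg _ hv))

/-- The transvections are realized by elements of the stabilizer of the base point. -/
theorem exists_act_eq_elem {i j : Fin 6} (hij : i ≠ j) (c : ℂ) :
    ∃ (g : G) (h : g • base = base), ∀ f,
      tautDual.act g h (baseRho f) = baseRho ((1 + c • elem i j : Module.End ℂ _) f) := by
  obtain ⟨g, hg⟩ := exists_levi hij c
  have h : g • base = base := by
    refine OGplus.ext_space (le_antisymm ?_ ?_)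
    · rintro _ ⟨_, ⟨m, rfl⟩, rfl⟩
      rw [hg]
      exact ⟨m - (c * m i) • e j, by simp⟩
    · rintro _ ⟨m, rfl⟩
      -- The inverse transvection; it undoes `g` because `eⱼ` has zero `i`-th coordinate.
      refine ⟨(0, m + (c * m i) • e j), ⟨_, rfl⟩, ?_⟩
      rw [hg]
      have h1 : e j i = 0 := (w_e i j).trans (if_neg hij)
      simp [h1]
  refine ⟨g, h, fun f => ?_⟩
  rw [baseRho_apply, ← rho_equivariant, rho_base_eq, hg]
  congr 1
  simp [elem_apply, mul_smul]

/-- A stable subspace is closed under `elem i j`, which sends `f` with `f (eⱼ) ≠ 0` to a nonzero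
multiple of `wᵢ`. -/
theorem tautDual_base_irreducible (N : Submodule ℂ (tautDual.fib base))
    (hN : ∀ (g : G) (h : g • base = base), ∀ v ∈ N, tautDual.act g h v ∈ N) : N = ⊥ ∨ N = ⊤ := by
  have hel : ∀ i j, i ≠ j → ∀ f, baseRho f ∈ N → baseRho (elem i j f) ∈ N := fun i j hij f hf => by
    obtain ⟨g, hg, hgf⟩ := exists_act_eq_elem hij 1
    have h1 := sub_mem (hN g hg _ hf) hf
    rw [hgf, ← map_sub] at h1
    simpa using h1
  refine or_iff_not_imp_left.2 fun h0 => ?_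
  obtain ⟨x, hx, hx0⟩ := (Submodule.ne_bot_iff _).1 h0
  obtain ⟨f, rfl⟩ := baseRho_surjective x
  obtain ⟨j, hj⟩ : ∃ j, f (e j) ≠ 0 := by
    by_contra! hcon
    refine hx0 ?_
    rw [← sum_smul_w f]
    simp [hcon]
  have h1 : ∀ i, i ≠ j → baseRho (w i) ∈ N := fun i hij => by
    have := hel i j hij f hx
    rw [elem_apply, map_smul] at this
    exact (Submodule.smul_mem_iff N hj).1 this
  have h2 : ∀ i, baseRho (w i) ∈ N := fun i => by
    by_cases hij : i = j
    · subst hij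
      -- The transvections give no `elem j j`, so the remaining `wⱼ` is reached through another
      -- `wₖ`.
      obtain ⟨k, hk, -⟩ := exists_ne_ne i i
      have := hel i k hk.symm _ (h1 k hk)
      rwa [elem_apply, w_e, if_pos rfl, one_smul] at this
    · exact h1 i hij
  refine Submodule.eq_top_iff'.2 fun y => ?_
  obtain ⟨k, rfl⟩ := baseRho_surjective y
  rw [← sum_smul_w k, map_sum]
  exact Submodule.sum_mem _ fun i _ => by rw [map_smul]; exact N.smul_mem _ (h2 i)

theorem map_map_tensor_map {D : Type} [AddCommGroup D] [Module ℂ D] (r : Module.Dual ℂ M →ₗ[ℂ] D)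
    (k : D →ₗ[ℂ] D) (l : Module.End ℂ (Module.Dual ℂ M)) (h : ∀ f, k (r f) = r (l f)) (t : T21) :
    TensorProduct.map k (exteriorPower.map 2 k) (TensorProduct.map r (exteriorPower.map 2 r) t) =
      TensorProduct.map r (exteriorPower.map 2 r) (tensorAct l t) := by
  refine tensor_wedge_induction (p := fun t => TensorProduct.map k (exteriorPower.map 2 k)
      (TensorProduct.map r (exteriorPower.map 2 r) t) =
      TensorProduct.map r (exteriorPower.map 2 r) (tensorAct l t)) (by simp)
    (fun x y hx hy => by simp only [map_add, hx, hy]) (fun f a b => ?_) t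
  simp only [tensorAct_tmul, TensorProduct.map_tmul, map_wedge2, h]

theorem eq_bot_or_eq_top_of_stable {D : Type} [AddCommGroup D] [Module ℂ D]
    {r : Module.Dual ℂ M →ₗ[ℂ] D} (hr : Function.Bijective r)
    (N : Submodule ℂ (LinearMap.ker (wedge D)))
    (hN : ∀ i j, i ≠ j → ∀ c : ℂ, ∃ k : D →ₗ[ℂ] D,
      (∀ f, k (r f) = r ((1 + c • elem i j : Module.End ℂ _) f)) ∧ ∀ t ∈ N, mapSchur k t ∈ N) :
    N = ⊥ ∨ N = ⊤ := by
  have hmem : ∀ t : LinearMap.ker (wedge D), (t : D ⊗[ℂ] (⋀[ℂ]^2 D)) ∈ N.map (Submodule.subtype _) ↔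
      t ∈ N := fun t => by simp
  let N' : Submodule ℂ T21 :=
    (N.map (Submodule.subtype _)).comap (TensorProduct.map r (exteriorPower.map 2 r))
  have hk : N' ≤ LinearMap.ker (wedge (Module.Dual ℂ M)) := by
    rintro t ⟨y, -, hy⟩
    have h1 : wedge D (TensorProduct.map r (exteriorPower.map 2 r) t) = 0 := by
      rw [← hy]; exact y.2
    rw [wedge_natural] at h1
    exact ExteriorAlgebra.map_injective_field (LinearMap.ker_eq_bot.2 hr.1) (h1.trans (map_zero _).symm)
  have hst : ∀ i j, i ≠ j → ∀ c : ℂ, ∀ t ∈ N', tensorAct (1 + c • elem i j) t ∈ N' := by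
    rintro i j hij c t ⟨y, hyN, hy⟩
    obtain ⟨k, hkr, hkN⟩ := hN i j hij c
    refine ⟨mapSchur k y, hkN y hyN, ?_⟩
    rw [← map_map_tensor_map r k _ hkr, ← hy]
    rfl
  have hsurj := TensorProduct.map_surjective hr.2 (exteriorPower.map_surjective (n := 2) hr.2)
  rcases eq_bot_or_ker_wedge_le hst hk with h | h
  · refine Or.inl ((Submodule.eq_bot_iff _).2 fun y hy => ?_)
    obtain ⟨t, ht⟩ := hsurj (y : D ⊗[ℂ] (⋀[ℂ]^2 D))
    have h1 : t ∈ N' := ⟨y, hy, ht.symm⟩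
    rw [h, Submodule.mem_bot] at h1
    refine Subtype.ext ?_
    rw [← ht, h1, map_zero]
    rfl
  · refine Or.inr (Submodule.eq_top_iff'.2 fun y => ?_)
    obtain ⟨t, ht⟩ := hsurj (y : D ⊗[ℂ] (⋀[ℂ]^2 D))
    have h1 : t ∈ N' := h (by
      have h2 : wedge D (TensorProduct.map r (exteriorPower.map 2 r) t) = 0 := by
        rw [ht]; exact y.2
      rw [wedge_natural] at h2
      exact ExteriorAlgebra.map_injective_field (LinearMap.ker_eq_bot.2 hr.1)
        (h2.trans (map_zero _).symm))
    have h3 : TensorProduct.map r (exteriorPower.map 2 r) t ∈ N.map (Submodule.subtype _) := h1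
    rw [ht] at h3
    exact (hmem y).1 h3

theorem schur21_base_irreducible {E : EquivFamily} {r : Module.Dual ℂ M →ₗ[ℂ] E.fib base}
    (hr : Function.Bijective r)
    (hE : ∀ i j, i ≠ j → ∀ c : ℂ, ∃ (g : G) (h : g • base = base), ∀ f,
      E.act g h (r f) = r ((1 + c • elem i j : Module.End ℂ _) f))
    (N : Submodule ℂ (E.schur21.fib base))
    (hN : ∀ (g : G) (h : g • base = base), ∀ v ∈ N, E.schur21.act g h v ∈ N) : N = ⊥ ∨ N = ⊤ :=
  eq_bot_or_eq_top_of_stable hr N fun i j hij c => by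
    obtain ⟨g, hg, hgf⟩ := hE i j hij c
    exact ⟨E.act g hg, hgf, fun t ht => hN g hg t ht⟩

theorem schurDual_base_irreducible (N : Submodule ℂ (schurDual.fib base))
    (hN : ∀ (g : G) (h : g • base = base), ∀ v ∈ N, schurDual.act g h v ∈ N) : N = ⊥ ∨ N = ⊤ :=
  schur21_base_irreducible (E := tautDual) baseRho_bijective
    (fun _ _ hij c => exists_act_eq_elem hij c) N hN

theorem wedge_tmul_wedge2_self {D : Type} [AddCommGroup D] [Module ℂ D] (a b : D) :
    wedge D (a ⊗ₜ wedge2 a b) = 0 := by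
  rw [← wedgeMul_eq_zero_iff, wedgeMul_tmul_wedge2]
  refine Subtype.ext ?_
  rw [coe_wedge3, ← mul_assoc, ExteriorAlgebra.ι_sq_zero, zero_mul]
  rfl

theorem nontrivial_ker_wedge {D : Type} [AddCommGroup D] [Module ℂ D]
    {r : Module.Dual ℂ M →ₗ[ℂ] D} (hr : Function.Injective r) :
    Nontrivial (LinearMap.ker (wedge D)) := by
  have h1 : wedge D (TensorProduct.map r (exteriorPower.map 2 r) (w 0 ⊗ₜ wedge2 (w 0) (w 1))) = 0 :=
    (wedge_natural r _).trans
      ((congrArg _ (wedge_tmul_wedge2_self (w 0) (w 1))).trans (map_zero _))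
  refine ⟨⟨⟨_, h1⟩, 0, fun h => ?_⟩⟩
  have h2 : w 0 ⊗ₜ[ℂ] wedge2 (w 0) (w 1) = 0 := map_injective_of_injective hr (by
    rw [map_zero]
    exact congrArg Subtype.val h)
  have h3 := congrArg (coord21 0 0 1) h2
  rw [coord21_tmul, map_zero] at h3
  simp [w_e] at h3

theorem isIrreducible_twistNeg_tautDual : (twistNeg tautDual 2).IsIrreducible :=
  isIrreducible_twistNeg_two baseRho_injective.nontrivial tautDual_base_irreducible

theorem isIrreducible_twistNeg_schurDual : (twistNeg schurDual 2).IsIrreducible :=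
  isIrreducible_twistNeg_two (nontrivial_ker_wedge baseRho_injective) schurDual_base_irreducible

/-! ### The semisimplification of the kernel -/

theorem isAlgebraic_zero : EquivFamily.zero.IsAlgebraic :=
  IsAlgebraic.trivial fun φ v => coordRing.algebraMap_mem (φ v)

theorem hasCompositionSeries_bundleR :
    HasCompositionSeries bundleR [twistNeg schurDual 2, twistNeg tautDual 2] := by
  have hT := Spin12.IsAlgebraic.twistNeg isAlgebraic_tautDual 2
  have hS := Spin12.IsAlgebraic.twistNeg isAlgebraic_schurDual 2
  refine .cons _ _ _ _ isAlgebraic_bundleR.isVectorBundle hS.isVectorBundle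
    isIrreducible_twistNeg_schurDual homIncl homProj homIncl_shortExact_homProj ?_
  refine .cons EquivFamily.zero _ _ _ hT.isVectorBundle hT.isVectorBundle
    isIrreducible_twistNeg_tautDual (Hom.ofEquivariant (fun _ => 0) fun _ _ _ _ _ => by simp)
    (Hom.ofEquivariant (fun _ => LinearMap.id) fun _ _ _ _ _ => rfl)
    ⟨fun x => Function.injective_of_subsingleton _, fun x y => ?_, fun x => Function.surjective_id⟩ ?_
  · constructor
    · intro hy
      exact ⟨PUnit.unit, hy.symm⟩
    · rintro ⟨z, rfl⟩
      rfl
  · exact .nil _ isAlgebraic_zero.isVectorBundle fun x => inferInstanceAs (Subsingleton PUnit)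

theorem isSemisimplification_bundleR :
    IsSemisimplification bundleR ((twistNeg tautDual 2).prod (twistNeg schurDual 2)) := by
  refine ⟨_, hasCompositionSeries_bundleR, Hom.ofEquivariant
    (F := (twistNeg schurDual 2).prod ((twistNeg tautDual 2).prod EquivFamily.zero))
    -- The composition series lists the top quotient first, so the two summands are swapped.
    (fun x => (LinearMap.snd ℂ _ _).prod ((LinearMap.fst ℂ _ _).prod 0))
    (fun _ _ _ _ _ => by rfl), fun x a b h => ?_, fun x b => ?_⟩
  · exact Prod.ext (congrArg (fun t => t.2.1) h) (congrArg Prod.fst h)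
  · exact ⟨(b.2.1, b.1), rfl⟩

end

end Spin12

end

/-! ### Assembly of the exact complex -/

theorem mainTheorem4 :
    ∃ R T : EquivFamily,
      -- all terms are equivariant algebraic vector bundles on `X = OG₊(6, V)`
      R.IsVectorBundle ∧ T.IsVectorBundle ∧ tautDual.IsVectorBundle ∧ spinLine.IsVectorBundle ∧
      ((tautDual.tensor spinLine).tensor (trivialHalf 0)).IsVectorBundle ∧
      (EquivFamily.ext 3 trivialV).IsVectorBundle ∧ schurDual.IsVectorBundle ∧
      (trivialHalf 1).IsVectorBundle ∧
      (trivialV.tensor (EquivFamily.ext 2 tautDual)).IsVectorBundle ∧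
      -- `T` is the cokernel of the equivariant inclusion `𝒰^∨ → V ⊗ ∧²𝒰^∨`
      (∃ (j : Hom tautDual (trivialV.tensor (EquivFamily.ext 2 tautDual)))
        (π : Hom (trivialV.tensor (EquivFamily.ext 2 tautDual)) T),
        IsContractionInclusion j ∧ j.ShortExact π) ∧
      -- `ss(R) = 𝒰^∨(-2) ⊕ 𝒰_{ω₁+ω₂}(-2)`
      IsSemisimplification R ((twistNeg tautDual 2).prod (twistNeg schurDual 2)) ∧
      -- the exact complex `0 → R → 𝒰^∨(-1) ⊗ S⁺ → ∧³V ⊗ 𝒪 → T → 𝒰_{ω₁+ω₂} → 0`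
      ∃ (d₁ : Hom R ((tautDual.tensor spinLine).tensor (trivialHalf 0)))
        (d₂ : Hom ((tautDual.tensor spinLine).tensor (trivialHalf 0))
          (EquivFamily.ext 3 trivialV))
        (d₃ : Hom (EquivFamily.ext 3 trivialV) T)
        (d₄ : Hom T schurDual),
        d₁.Injective ∧ d₁.Exact d₂ ∧ d₂.Exact d₃ ∧ d₃.Exact d₄ ∧ d₄.Surjective ∧
        -- the map `d₂` is `∧³η ∘ (i ⊗ id)`
        ∃ (β : LinearMap.BilinForm ℂ (half 0))
          (ξ : half 1 →ₗ[ℂ] half 0 →ₗ[ℂ] ⋀[ℂ]^3 V)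
          (i : Hom (tautDual.tensor spinLine) (trivialHalf 1)),
          IsInvariantForm β ∧ IsTransposeOfTrivectorMul β ξ ∧
          IsCliffordInclusion i ∧ i.Injective ∧
          ∀ (x : OGplus) (z : (tautDual.tensor spinLine).fib x) (s : half 0),
            d₂.app x (z ⊗ₜ[ℂ] s) = ξ (i.app x z) s := by
  refine ⟨bundleR, bundleT, isAlgebraic_bundleR.isVectorBundle, isAlgebraic_bundleT.isVectorBundle,
    isAlgebraic_tautDual.isVectorBundle, isAlgebraic_spinLine.isVectorBundle,
    ((isAlgebraic_tautDual.tensor isAlgebraic_spinLine).tensor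
      (isAlgebraic_trivialHalf 0)).isVectorBundle,
    (isAlgebraic_trivialV.ext 3).isVectorBundle, isAlgebraic_schurDual.isVectorBundle,
    (isAlgebraic_trivialHalf 1).isVectorBundle,
    (isAlgebraic_trivialV.tensor (isAlgebraic_tautDual.ext 2)).isVectorBundle,
    ⟨contractionHom, projT, isContractionInclusion_contractionHom, contractionHom_shortExact⟩,
    isSemisimplification_bundleR, homD1, homD2, homD3, homD4, homD1_injective, homD1_exact_homD2,
    homD2_exact_homD3, homD3_exact_homD4, homD4_surjective, halfForm, xi, cliffordHom,
    isInvariantForm_halfForm, isTransposeOfTrivectorMul_xi, isCliffordInclusion_cliffordHom,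
    cliffordHom_injective, fun x z s => homD2_tmul x z s⟩
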